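/- **Setting.** Let $H$ be a complex Hilbert space, $\mathcal M\subseteq B(H)$ a von Neumann algebra with commutant $\mathcal M'$, and $\{P_t\}_{t\ge 0}$ a semigroup of unital normal completely positive maps of $\mathcal M$: $P_0=\mathrm{id}$, $P_{t+s}=P_tP_s$ (no continuity in $t$ is assumed). For a Hilbert space $K$ with a $*$-representation $\pi$ of $\mathcal M$, let $\mathcal M\otimes_{P_d}K$ be the Hausdorff completion of the algebraic tensor product $\mathcal M\otimes K$ for $\langle T\otimes k,S\otimes l\rangle=\langle k,\pi(P_d(T^*S))l\rangle$ (linear in the second variable), with $\mathcal M$ acting by $S(T\otimes k)=ST\otimes k$. For a partition $\mathfrak p=\{0=t_0<t_1<\dots<t_n=t\}$ of $[0,t]$ put $$H_{\mathfrak p,t}=\mathcal M\otimes_{P_{t_1}}\mathcal M\otimes_{P_{t_2-t_1}}\cdots\mathcal M\otimes_{P_{t-t_{n-1}}}H$$ (for $t=0$ there is one partition, and $H_{\mathfrak p,0}=H$), and let $\mathcal L_{\mathcal M}(H,H_{\mathfrak p,t})$ be the space of bounded $X:H\to H_{\mathfrak p,t}$ with $XT=TX$ for all $T\in\mathcal M$.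 It is a correspondence over $\mathcal M'$ with $R\cdot X=(I\otimes R)X$, $X\cdot R=XR$ and $\langle X,Y\rangle=X^*Y$. If $\mathfrak p'$ refines $\mathfrak p$, let $v_{0,\mathfrak p,\mathfrak p'}:H_{\mathfrak p,t}\to H_{\mathfrak p',t}$ be the isometry that inserts the identity of $\mathcal M$ at the new points, and $v_{\mathfrak p,\mathfrak p'}(X)=v_{0,\mathfrak p,\mathfrak p'}X$. Let $$E(t)=\varinjlim\bigl(\mathcal L_{\mathcal M}(H,H_{\mathfrak p,t}),v_{\mathfrak p,\mathfrak p'}\bigr)$$ over the partitions of $[0,t]$, directed by refinement, and write $\iota_{\mathfrak p}:\mathcal L_{\mathcal M}(H,H_{\mathfrak p,t})\to E(t)$ for the canonical maps. A $W^*$-correspondence over a von Neumann algebra $\mathcal N$ is a self-dual Hilbert $\mathcal N$-module with a normal left action of $\mathcal N$ by adjointable operators. Isomorphisms of correspondences are bijective bimodule maps that preserve inner products. Tensor products over $\mathcal N$, with $\langle x\otimes y,x'\otimes y'\rangle=\langle y,\langle x,x'\rangle y'\rangle$, and direct limits are taken as $W^*$-correspondences, that is, as self-dual completions of the algebraic ones.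 (For $\mathcal N\subseteq B(H)$ the self-dual completion of $X$ is the $\sigma$-weak closure of the operators $h\mapsto x\otimes h$, $x\in X$, in $B(H,X\otimes_{\mathcal N}H)$.) For partitions $\mathfrak p_1=\{0=t_0<\dots<t_n=t\}$ of $[0,t]$ and $\mathfrak p_2=\{0=s_0<\dots<s_m=s\}$ of $[0,s]$ let $\mathfrak p_2\vee(\mathfrak p_1+s)=\{0=s_0<\dots<s_m=s=t_0+s<t_1+s<\dots<t_n+s=t+s\}$, a partition of $[0,t+s]$. For $X\in\mathcal L_{\mathcal M}(H,H_{\mathfrak p_1,t})$ let $I_s\otimes X:H_{\mathfrak p_2,s}\to H_{\mathfrak p_2\vee(\mathfrak p_1+s),t+s}$ be the operator $T_1\otimes\dots\otimes T_m\otimes h\mapsto T_1\otimes\dots\otimes T_m\otimes Xh$. **Claim.** Let $t,s,r\ge 0$ and let $\mathfrak p_1,\mathfrak p_2,\mathfrak p_3$ be partitions of $[0,t]$, $[0,s]$, $[0,r]$. 1. With $\mathfrak p=\mathfrak p_2\vee(\mathfrak p_1+s)$, the map $X\otimes Y\mapsto(I_s\otimes X)Y$ extends to an isomorphism of $\mathcal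 M'$-correspondences $$\mathcal L_{\mathcal M}(H,H_{\mathfrak p_1,t})\otimes\mathcal L_{\mathcal M}(H,H_{\mathfrak p_2,s})\;\cong\;\mathcal L_{\mathcal M}(H,H_{\mathfrak p,t+s}).$$ 2. For $X_i\in\mathcal L_{\mathcal M}(H,H_{\mathfrak p_i})$, $i=1,2,3$, one has $(I_r\otimes((I_s\otimes X_1)X_2))X_3=(I_{s+r}\otimes X_1)((I_r\otimes X_2)X_3)$. 3. There are isomorphisms of $\mathcal M'$-correspondences $\varepsilon:\mathcal M'\to E(0)$ and $U_{t,s}:E(t)\otimes E(s)\to E(t+s)$, for all $t,s\ge 0$, such that: * $\varepsilon(R)=\iota_{\{0\}}(R)$ for $R\in\mathcal M'=\mathcal L_{\mathcal M}(H,H)$; * $U_{t,s}(\iota_{\mathfrak p_1}(X)\otimes\iota_{\mathfrak p_2}(Y))=\iota_{\mathfrak p_2\vee(\mathfrak p_1+s)}((I_s\otimes X)Y)$ for all $\mathfrak p_1,\mathfrak p_2,X,Y$; * $U_{0,t}(\varepsilon(R)\otimes\xi)=R\xi$ and $U_{t,0}(\xi\otimes\varepsilon(R))=\xi R$ for $R\in\mathcal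 M'$, $\xi\in E(t)$; * the product is associative: there are isomorphisms $A:(E(t)\otimes E(s))\otimes E(r)\to E(t)\otimes(E(s)\otimes E(r))$, $(x\otimes y)\otimes z\mapsto x\otimes(y\otimes z)$, and $U_{t,s}\otimes I$ and $I\otimes U_{s,r}$, and $U_{t+s,r}\,(U_{t,s}\otimes I)=U_{t,s+r}\,(I\otimes U_{s,r})\,A$. 4. $\{E(t)\}_{t\ge 0}$ is a discrete product system over $\mathcal M'$: every $E(t)$ is a $W^*$-correspondence over $\mathcal M'$, $E(0)\cong\mathcal M'$, and $E(t+s)\cong E(t)\otimes E(s)$ for all $t,s\ge 0$. -/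

import Mathlib

universe u

open scoped NNReal TensorProduct InnerProductSpace ComplexOrder
open UniformSpace

noncomputable section

namespace CPSemi

section Basic

variable {H : Type u} [NormedAddCommGroup H] [InnerProductSpace ℂ H] [CompleteSpace H]

/-- The `*`-algebra (as a type) underlying a von Neumann algebra `N` on `H`. -/
abbrev Alg (N : VonNeumannAlgebra H) : Type u := ↥N.toStarSubalgebra

instance (N : VonNeumannAlgebra H) : Ring (Alg N) := inferInstance
instance (N : VonNeumannAlgebra H) : StarRing (Alg N) := inferInstance
instance (N : VonNeumannAlgebra H) : Algebra ℂ (Alg N) := inferInstance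
instance (N : VonNeumannAlgebra H) : AddCommGroup (Alg N) := inferInstance
instance (N : VonNeumannAlgebra H) : Module ℂ (Alg N) := inferInstance

theorem mem_of_commute (N : VonNeumannAlgebra H) {c : H →L[ℂ] H}
    (h : ∀ b ∈ N.commutant, b * c = c * b) : c ∈ N.toStarSubalgebra := by
  have : c ∈ N.commutant.commutant := VonNeumannAlgebra.mem_commutant_iff.2 h
  rw [VonNeumannAlgebra.commutant_commutant] at this
  exact this

theorem exists_defect {K : Type u} [NormedAddCommGroup K] [InnerProductSpace ℂ K]
    [CompleteSpace K] (G : K →L[ℂ] K) (hG : 0 ≤ G) :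
    ∃ c : K →L[ℂ] K, star c * c = G ∧ ∀ b : K →L[ℂ] K, b * G = G * b → b * c = c * b := by
  refine ⟨CFC.sqrt G, ?_, ?_⟩
  · rw [(CFC.sqrt_nonneg G).isSelfAdjoint.star_eq]
    exact CFC.sqrt_mul_sqrt_self G hG
  · intro b hb
    have : Commute G b := hb.symm
    exact (this.cfcₙ_nnreal _).symm

theorem norm_sq_sub_nonneg {K L : Type u} [NormedAddCommGroup K] [InnerProductSpace ℂ K]
    [CompleteSpace K] [NormedAddCommGroup L] [InnerProductSpace ℂ L]
    [CompleteSpace L] (X : K →L[ℂ] L) :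
    0 ≤ ((‖X‖ : ℂ) ^ 2) • (1 : K →L[ℂ] K) - X.adjoint ∘L X := by
  rw [ContinuousLinearMap.nonneg_iff_isPositive, ContinuousLinearMap.isPositive_iff_complex]
  intro x
  have h1 : ⟪(((‖X‖ : ℂ) ^ 2) • (1 : K →L[ℂ] K) - X.adjoint ∘L X) x, x⟫_ℂ
      = ((‖X‖ ^ 2 * ‖x‖ ^ 2 - ‖X x‖ ^ 2 : ℝ) : ℂ) := by
    simp [ContinuousLinearMap.adjoint_inner_left, mul_comm]
  rw [h1]
  have h2 := X.le_opNorm x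
  have h3 : ‖X x‖ ^ 2 ≤ (‖X‖ * ‖x‖) ^ 2 := by gcongr
  rw [mul_pow] at h3
  have h4 : (0:ℝ) ≤ ‖X‖ ^ 2 * ‖x‖ ^ 2 - ‖X x‖ ^ 2 := by linarith
  exact ⟨rfl, h4⟩

/-- The `σ`-weak topology on `B(K, L)`: the coarsest topology for which all the functionals
`T ↦ ∑ₙ ⟪ηₙ, T ξₙ⟫` with `∑ ‖ξₙ‖² < ∞` and `∑ ‖ηₙ‖² < ∞` are continuous. -/
@[reducible] def sigmaWeak (K L : Type u) [NormedAddCommGroup K] [InnerProductSpace ℂ K]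
    [NormedAddCommGroup L] [InnerProductSpace ℂ L] : TopologicalSpace (K →L[ℂ] L) :=
  ⨅ p : {p : (ℕ → K) × (ℕ → L) //
      (Summable fun n => ‖p.1 n‖ ^ 2) ∧ (Summable fun n => ‖p.2 n‖ ^ 2)},
    TopologicalSpace.induced (fun T : K →L[ℂ] L => ∑' n, ⟪p.1.2 n, T (p.1.1 n)⟫_ℂ) inferInstance

/-- The `σ`-weak topology of a von Neumann algebra. -/
@[reducible] def sigmaWeakAlg (N : VonNeumannAlgebra H) : TopologicalSpace (Alg N) :=
  TopologicalSpace.induced (fun a : Alg N => (a : H →L[ℂ] H)) (sigmaWeak H H)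

theorem summable_pairing {K L : Type u} [NormedAddCommGroup K] [InnerProductSpace ℂ K]
    [NormedAddCommGroup L] [InnerProductSpace ℂ L] {ξ : ℕ → K} {η : ℕ → L}
    (hξ : Summable fun n => ‖ξ n‖ ^ 2) (hη : Summable fun n => ‖η n‖ ^ 2) (T : K →L[ℂ] L) :
    Summable fun n => ⟪η n, T (ξ n)⟫_ℂ := by
  refine Summable.of_norm_bounded (g := fun n => ‖T‖ * (‖η n‖ ^ 2 + ‖ξ n‖ ^ 2))
    ((hη.add hξ).mul_left _) fun n => ?_
  have h1 := norm_inner_le_norm (𝕜 := ℂ) (η n) (T (ξ n))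
  have h2 := T.le_opNorm (ξ n)
  have h3 : ‖η n‖ * ‖T (ξ n)‖ ≤ ‖η n‖ * (‖T‖ * ‖ξ n‖) := by gcongr
  have h4 : ‖η n‖ * ‖ξ n‖ ≤ ‖η n‖ ^ 2 + ‖ξ n‖ ^ 2 := by
    nlinarith [sq_nonneg (‖η n‖ - ‖ξ n‖), sq_nonneg (‖η n‖), sq_nonneg (‖ξ n‖)]
  have h5 := mul_le_mul_of_nonneg_left h4 (norm_nonneg T)
  linarith

/-- The functionals defining the `σ`-weak topology, as linear maps. -/
def pairing {K L : Type u} [NormedAddCommGroup K] [InnerProductSpace ℂ K]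
    [NormedAddCommGroup L] [InnerProductSpace ℂ L] (ξ : ℕ → K) (η : ℕ → L)
    (hξ : Summable fun n => ‖ξ n‖ ^ 2) (hη : Summable fun n => ‖η n‖ ^ 2) :
    (K →L[ℂ] L) →ₗ[ℂ] ℂ where
  toFun T := ∑' n, ⟪η n, T (ξ n)⟫_ℂ
  map_add' S T := by
    simp only [add_apply, inner_add_right]
    exact (summable_pairing hξ hη S).tsum_add (summable_pairing hξ hη T)
  map_smul' a T := by
    simp only [smul_apply, inner_smul_right, RingHom.id_apply, smul_eq_mul]
    exact tsum_mul_left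

theorem continuous_pairing {K L : Type u} [NormedAddCommGroup K] [InnerProductSpace ℂ K]
    [NormedAddCommGroup L] [InnerProductSpace ℂ L] (ξ : ℕ → K) (η : ℕ → L)
    (hξ : Summable fun n => ‖ξ n‖ ^ 2) (hη : Summable fun n => ‖η n‖ ^ 2) :
    @Continuous _ _ (sigmaWeak K L) _ (pairing ξ η hξ hη) := by
  rw [continuous_iff_le_induced]
  exact iInf_le_of_le ⟨(ξ, η), hξ, hη⟩ le_rfl

theorem continuous_to_sigmaWeak {K L : Type u} [NormedAddCommGroup K] [InnerProductSpace ℂ K]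
    [NormedAddCommGroup L] [InnerProductSpace ℂ L] {α : Type*} (τ : TopologicalSpace α)
    (f : α → (K →L[ℂ] L))
    (h : ∀ ξ η hξ hη, @Continuous _ _ τ _ fun a => pairing ξ η hξ hη (f a)) :
    @Continuous _ _ τ (sigmaWeak K L) f := by
  rw [sigmaWeak, continuous_iInf_rng]
  rintro ⟨⟨ξ, η⟩, hξ, hη⟩
  rw [continuous_induced_rng]
  exact h ξ η hξ hη

/-- The `σ`-weak closure of a linear subspace of `B(K, L)`. -/
def sigmaClosure {K L : Type u} [NormedAddCommGroup K] [InnerProductSpace ℂ K]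
    [NormedAddCommGroup L] [InnerProductSpace ℂ L] (S : Submodule ℂ (K →L[ℂ] L)) :
    Submodule ℂ (K →L[ℂ] L) :=
  letI := sigmaWeak K L
  haveI : ContinuousAdd (K →L[ℂ] L) := continuousAdd_iInf fun p =>
    continuousAdd_induced (pairing p.1.1 p.1.2 p.2.1 p.2.2)
  haveI : ContinuousSMul ℂ (K →L[ℂ] L) := continuousSMul_iInf fun p =>
    continuousSMul_induced (pairing p.1.1 p.1.2 p.2.1 p.2.2)
  S.topologicalClosure

theorem coe_sigmaClosure {K L : Type u} [NormedAddCommGroup K] [InnerProductSpace ℂ K]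
    [NormedAddCommGroup L] [InnerProductSpace ℂ L] (S : Submodule ℂ (K →L[ℂ] L)) :
    (sigmaClosure S : Set (K →L[ℂ] L)) = @closure _ (sigmaWeak K L) (S : Set (K →L[ℂ] L)) := rfl

theorem le_sigmaClosure {K L : Type u} [NormedAddCommGroup K] [InnerProductSpace ℂ K]
    [NormedAddCommGroup L] [InnerProductSpace ℂ L] (S : Submodule ℂ (K →L[ℂ] L)) :
    S ≤ sigmaClosure S := fun x hx => by
  letI := sigmaWeak K L
  exact subset_closure hx

/-- `T ↦ B T A` is `σ`-weakly continuous. -/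
theorem continuous_conj_sigmaWeak {K L K' L' : Type u} [NormedAddCommGroup K]
    [InnerProductSpace ℂ K] [CompleteSpace K] [NormedAddCommGroup L] [InnerProductSpace ℂ L]
    [CompleteSpace L] [NormedAddCommGroup K'] [InnerProductSpace ℂ K'] [CompleteSpace K']
    [NormedAddCommGroup L'] [InnerProductSpace ℂ L'] [CompleteSpace L']
    (A : K' →L[ℂ] K) (B : L →L[ℂ] L') :
    @Continuous _ _ (sigmaWeak K L) (sigmaWeak K' L') fun T => B ∘L T ∘L A := by
  refine continuous_to_sigmaWeak _ _ fun ξ η hξ hη => ?_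
  have hb : ∀ {E F : Type u} [NormedAddCommGroup E] [InnerProductSpace ℂ E]
      [NormedAddCommGroup F] [InnerProductSpace ℂ F] (C : E →L[ℂ] F) (x : ℕ → E),
      (Summable fun n => ‖x n‖ ^ 2) → Summable fun n => ‖C (x n)‖ ^ 2 := by
    intro E F _ _ _ _ C x hx
    refine Summable.of_nonneg_of_le (fun n => by positivity) (fun n => ?_) (hx.mul_left (‖C‖ ^ 2))
    rw [← mul_pow]
    gcongr
    exact C.le_opNorm _
  have := continuous_pairing (fun n => A (ξ n)) (fun n => B.adjoint (η n)) (hb A ξ hξ)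
    (hb B.adjoint η hη)
  convert this using 2 with T
  simp [pairing, ContinuousLinearMap.adjoint_inner_left]

theorem sigmaClosure_mem_of {K L K' L' : Type u} [NormedAddCommGroup K]
    [InnerProductSpace ℂ K] [CompleteSpace K] [NormedAddCommGroup L] [InnerProductSpace ℂ L]
    [CompleteSpace L] [NormedAddCommGroup K'] [InnerProductSpace ℂ K'] [CompleteSpace K']
    [NormedAddCommGroup L'] [InnerProductSpace ℂ L'] [CompleteSpace L']
    (A : K' →L[ℂ] K) (B : L →L[ℂ] L') (S : Submodule ℂ (K →L[ℂ] L))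
    (S' : Submodule ℂ (K' →L[ℂ] L')) (h : ∀ T ∈ S, B ∘L T ∘L A ∈ S') {T : K →L[ℂ] L}
    (hT : T ∈ sigmaClosure S) : B ∘L T ∘L A ∈ sigmaClosure S' := by
  have hc := continuous_conj_sigmaWeak A B
  letI := sigmaWeak K L
  letI := sigmaWeak K' L'
  exact map_mem_closure (f := fun T : K →L[ℂ] L => B ∘L T ∘L A) hc hT h

/-- An equation `f T = 0`, `f` the functional `T ↦ ⟪l, T k⟫`, passes to the `σ`-weak closure. -/
theorem continuous_vector {K L : Type u} [NormedAddCommGroup K] [InnerProductSpace ℂ K]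
    [NormedAddCommGroup L] [InnerProductSpace ℂ L] (k : K) (l : L) :
    @Continuous _ _ (sigmaWeak K L) _ fun T : K →L[ℂ] L => ⟪l, T k⟫_ℂ := by
  have h1 : Summable fun n => ‖(Pi.single 0 k : ℕ → K) n‖ ^ 2 :=
    summable_of_ne_finset_zero (s := {0}) fun n hn => by
      have : n ≠ 0 := by simpa using hn
      simp [this]
  have h2 : Summable fun n => ‖(Pi.single 0 l : ℕ → L) n‖ ^ 2 :=
    summable_of_ne_finset_zero (s := {0}) fun n hn => by
      have : n ≠ 0 := by simpa using hn
      simp [this]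
  have := continuous_pairing _ _ h1 h2
  convert this using 2 with T
  simp only [pairing, LinearMap.coe_mk, AddHom.coe_mk]
  rw [tsum_eq_single 0]
  · simp
  · intro n hn
    simp [hn]

/-- The operators `T : K → L` with `S* T ∈ N` for all `S` in the image of a subspace form a
`σ`-weakly closed set; hence `S* T ∈ N` for `S`, `T` in the closure. -/
theorem adjoint_comp_mem {L : Type u} [NormedAddCommGroup L] [InnerProductSpace ℂ L]
    [CompleteSpace L] (N : VonNeumannAlgebra H) (Z : Submodule ℂ (H →L[ℂ] L))
    (h : ∀ S ∈ Z, ∀ T ∈ Z, S.adjoint ∘L T ∈ N.toStarSubalgebra) {S T : H →L[ℂ] L}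
    (hS : S ∈ sigmaClosure Z) (hT : T ∈ sigmaClosure Z) :
    S.adjoint ∘L T ∈ N.toStarSubalgebra := by
  have key : ∀ S : H →L[ℂ] L, (∀ T ∈ Z, S.adjoint ∘L T ∈ N.toStarSubalgebra) →
      ∀ T ∈ sigmaClosure Z, S.adjoint ∘L T ∈ N.toStarSubalgebra := by
    intro S hS T hT
    refine mem_of_commute N fun b hb => ?_
    ext k
    refine ext_inner_left ℂ fun l => ?_
    have hc : @IsClosed _ (sigmaWeak H L) {T : H →L[ℂ] L | ⟪S (b.adjoint l), T k⟫_ℂ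
        = ⟪S l, T (b k)⟫_ℂ} := by
      letI := sigmaWeak H L
      exact isClosed_eq (continuous_vector _ _) (continuous_vector _ _)
    have hsub : (Z : Set (H →L[ℂ] L)) ⊆ {T : H →L[ℂ] L | ⟪S (b.adjoint l), T k⟫_ℂ
        = ⟪S l, T (b k)⟫_ℂ} := by
      intro T hT
      have h1 := VonNeumannAlgebra.mem_commutant_iff.1 hb _ (hS T hT)
      have h2 := congrArg (fun A : H →L[ℂ] H => ⟪l, A k⟫_ℂ) h1
      simp only [mul_apply_eq_comp, ContinuousLinearMap.comp_apply,
        ContinuousLinearMap.adjoint_inner_right] at h2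
      simp only [Set.mem_ofPred_eq]
      rw [h2, ← ContinuousLinearMap.adjoint_inner_right, ContinuousLinearMap.adjoint_inner_left]
    have hTm : T ∈ {T : H →L[ℂ] L | ⟪S (b.adjoint l), T k⟫_ℂ = ⟪S l, T (b k)⟫_ℂ} := by
      letI := sigmaWeak H L
      exact closure_minimal hsub hc hT
    simp only [Set.mem_ofPred_eq] at hTm
    simp only [mul_apply_eq_comp, ContinuousLinearMap.comp_apply]
    rw [ContinuousLinearMap.adjoint_inner_right, ← hTm, ← ContinuousLinearMap.adjoint_inner_left,
      ContinuousLinearMap.adjoint_inner_right]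
  refine key S (fun T hT => ?_) T hT
  have h1 := key T (fun S hS => h T hT S hS) S hS
  have h2 : star (T.adjoint ∘L S) ∈ N.toStarSubalgebra := star_mem h1
  rwa [ContinuousLinearMap.star_eq_adjoint, ContinuousLinearMap.adjoint_comp,
    ContinuousLinearMap.adjoint_adjoint] at h2

end Basic

section WeightedTensor

/-- A positive definite sesquilinear map on a vector space `V` with values in `B(K)`. -/
structure PosKernel (V : Type u) [AddCommGroup V] [Module ℂ V] (K : Type u)
    [NormedAddCommGroup K] [InnerProductSpace ℂ K] [CompleteSpace K] where
  ker : V →ₗ⋆[ℂ] V →ₗ[ℂ] (K →L[ℂ] K)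
  symm : ∀ v w, star (ker v w) = ker w v
  pos : ∀ {ι : Type} [Fintype ι] (v : ι → V) (k : ι → K),
    0 ≤ (∑ i, ∑ j, ⟪k i, ker (v i) (v j) (k j)⟫_ℂ).re

variable {V : Type u} [AddCommGroup V] [Module ℂ V]
  {K : Type u} [NormedAddCommGroup K] [InnerProductSpace ℂ K] [CompleteSpace K]

namespace PosKernel

variable (κ : PosKernel V K)

/-- The algebraic tensor product `V ⊗ K`, to be given the semi-inner product
`⟪v ⊗ k, w ⊗ l⟫ = ⟪k, κ(v, w) l⟫`. -/
@[nolint unusedArguments]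
def Pre (_κ : PosKernel V K) : Type u := V ⊗[ℂ] K

instance : AddCommGroup κ.Pre := inferInstanceAs (AddCommGroup (V ⊗[ℂ] K))
instance : Module ℂ κ.Pre := inferInstanceAs (Module ℂ (V ⊗[ℂ] K))

/-- The form `⟪v ⊗ k, w ⊗ l⟫ = ⟪k, κ(v, w) l⟫`. -/
def form : V ⊗[ℂ] K →ₗ⋆[ℂ] V ⊗[ℂ] K →ₗ[ℂ] ℂ :=
  TensorProduct.lift (LinearMap.mk₂'ₛₗ (starRingEnd ℂ) (starRingEnd ℂ)
    (fun v k => TensorProduct.lift (LinearMap.mk₂ ℂ (fun w l => ⟪k, κ.ker v w l⟫_ℂ)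
      (fun w w' l => by simp) (fun c w l => by simp)
      (fun w l l' => by simp) (fun c w l => by simp)))
    (fun v v' k => by ext; simp) (fun c v k => by ext; simp)
    (fun v k k' => by ext; simp) (fun c v k => by ext; simp [mul_comm]))

@[simp] theorem form_tmul (v w : V) (k l : K) :
    κ.form (v ⊗ₜ k) (w ⊗ₜ l) = ⟪k, κ.ker v w l⟫_ℂ := rfl

theorem form_symm (x y : V ⊗[ℂ] K) : starRingEnd ℂ (κ.form y x) = κ.form x y := by
  induction x using TensorProduct.induction_on with
  | zero => simp
  | add x x' hx hx' => simp [hx, hx']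
  | tmul v k =>
    induction y using TensorProduct.induction_on with
    | zero => simp
    | add y y' hy hy' => simp [hy, hy']
    | tmul w l =>
      simp only [form_tmul, inner_conj_symm]
      rw [← κ.symm, ContinuousLinearMap.star_eq_adjoint, ContinuousLinearMap.adjoint_inner_left]

theorem exists_fin {V K : Type*} [AddCommGroup V] [Module ℂ V] [AddCommGroup K] [Module ℂ K]
    (x : V ⊗[ℂ] K) :
    ∃ (n : ℕ) (v : Fin n → V) (k : Fin n → K), x = ∑ i, v i ⊗ₜ[ℂ] k i := by
  induction x using TensorProduct.induction_on with
  | zero => exact ⟨0, Fin.elim0, Fin.elim0, by simp⟩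
  | tmul v k => exact ⟨1, fun _ => v, fun _ => k, by simp⟩
  | add x y hx hy =>
    obtain ⟨n, v, k, rfl⟩ := hx
    obtain ⟨m, w, l, rfl⟩ := hy
    exact ⟨n + m, Fin.append v w, Fin.append k l, by simp [Fin.sum_univ_add]⟩

theorem form_nonneg (x : V ⊗[ℂ] K) : 0 ≤ (κ.form x x).re := by
  obtain ⟨n, v, k, rfl⟩ := exists_fin x
  have := κ.pos v k
  simp only [map_sum, LinearMap.sum_apply, form_tmul]
  rw [Finset.sum_comm]
  exact this

/-- The semi-inner product space structure. -/
abbrev core : PreInnerProductSpace.Core ℂ κ.Pre where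
  inner x y := κ.form x y
  conj_inner_symm x y := κ.form_symm x y
  re_inner_nonneg x := κ.form_nonneg x
  add_left x y z := LinearMap.congr_fun (map_add κ.form (show V ⊗[ℂ] K from x) y) z
  smul_left x y c := LinearMap.congr_fun (map_smulₛₗ κ.form c (show V ⊗[ℂ] K from x)) y

instance : SeminormedAddCommGroup κ.Pre :=
  InnerProductSpace.Core.toSeminormedAddCommGroup (c := κ.core)
instance : InnerProductSpace ℂ κ.Pre := InnerProductSpace.ofCore κ.core

theorem inner_def (x y : κ.Pre) : ⟪x, y⟫_ℂ = κ.form x y := rfl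

/-- The Hilbert space `V ⊗_κ K`: the Hausdorff completion of the algebraic tensor product `V ⊗ K`
with respect to the semi-inner product `⟪v ⊗ k, w ⊗ l⟫ = ⟪k, κ(v, w) l⟫`. -/
abbrev Space : Type u := Completion κ.Pre

/-- The canonical map of the algebraic tensor product to its Hausdorff completion. -/
def toSpace : V ⊗[ℂ] K →ₗ[ℂ] κ.Space where
  toFun x := ((show κ.Pre from x : κ.Pre) : Completion κ.Pre)
  map_add' x y := Completion.coe_add (α := κ.Pre) x y
  map_smul' c x := Completion.coe_smul (X := κ.Pre) c x

/-- The image of the elementary tensor `v ⊗ k` in `V ⊗_κ K`. -/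
def tmul (v : V) (k : K) : κ.Space := κ.toSpace (v ⊗ₜ k)

theorem add_tmul (v w : V) (k : K) : κ.tmul (v + w) k = κ.tmul v k + κ.tmul w k := by
  rw [tmul, TensorProduct.add_tmul, map_add]; rfl

theorem tmul_add (v : V) (k l : K) : κ.tmul v (k + l) = κ.tmul v k + κ.tmul v l := by
  rw [tmul, TensorProduct.tmul_add, map_add]; rfl

theorem smul_tmul (c : ℂ) (v : V) (k : K) : κ.tmul (c • v) k = c • κ.tmul v k := by
  rw [tmul, ← TensorProduct.smul_tmul', map_smul]; rfl

theorem tmul_smul (c : ℂ) (v : V) (k : K) : κ.tmul v (c • k) = c • κ.tmul v k := by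
  rw [tmul, TensorProduct.tmul_smul, map_smul]; rfl

@[simp] theorem inner_toSpace (x y : V ⊗[ℂ] K) :
    ⟪κ.toSpace x, κ.toSpace y⟫_ℂ = κ.form x y :=
  Completion.inner_coe (E := κ.Pre) x y

theorem inner_tmul (v w : V) (k l : K) : ⟪κ.tmul v k, κ.tmul w l⟫_ℂ = ⟪k, κ.ker v w l⟫_ℂ :=
  κ.inner_toSpace _ _

theorem norm_toSpace_sq (x : V ⊗[ℂ] K) : ‖κ.toSpace x‖ ^ 2 = (κ.form x x).re := by
  rw [← inner_toSpace, inner_self_eq_norm_sq_to_K (𝕜 := ℂ)]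
  norm_cast

theorem denseRange_toSpace : DenseRange κ.toSpace := Completion.denseRange_coe (α := κ.Pre)

/-- Operators on `V ⊗_κ K` are determined by elementary tensors. -/
theorem hom_ext {L : Type*} [NormedAddCommGroup L] [NormedSpace ℂ L] {f g : κ.Space →L[ℂ] L}
    (h : ∀ v k, f (κ.tmul v k) = g (κ.tmul v k)) : f = g := by
  have h1 : f.toLinearMap ∘ₗ κ.toSpace = g.toLinearMap ∘ₗ κ.toSpace :=
    TensorProduct.ext' fun v k => h v k
  refine ContinuousLinearMap.ext fun x => ?_
  refine congrFun (κ.denseRange_toSpace.equalizer f.continuous g.continuous ?_) x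
  exact funext fun x => LinearMap.congr_fun h1 x

/-- The bounded extension to the completions of a linear map between algebraic tensor
products. -/
def extend {V' : Type u} [AddCommGroup V'] [Module ℂ V']
    {K' : Type u} [NormedAddCommGroup K'] [InnerProductSpace ℂ K'] [CompleteSpace K']
    (κ' : PosKernel V' K') (f : V ⊗[ℂ] K →ₗ[ℂ] V' ⊗[ℂ] K') (C : ℝ)
    (hf : ∀ x, (κ'.form (f x) (f x)).re ≤ C ^ 2 * (κ.form x x).re) : κ.Space →L[ℂ] κ'.Space :=
  ((LinearMap.mkContinuous (show κ.Pre →ₗ[ℂ] κ'.Pre from f) |C|) fun x => by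
    rw [← sq_le_sq₀ (by positivity) (by positivity), mul_pow, sq_abs]
    have h1 := InnerProductSpace.norm_sq_eq_re_inner (𝕜 := ℂ) x
    have h2 := InnerProductSpace.norm_sq_eq_re_inner (𝕜 := ℂ) (show κ'.Pre from f x)
    rw [h1]
    exact h2.trans_le (hf x)).completion

theorem extend_toSpace {V' : Type u} [AddCommGroup V'] [Module ℂ V']
    {K' : Type u} [NormedAddCommGroup K'] [InnerProductSpace ℂ K'] [CompleteSpace K']
    (κ' : PosKernel V' K') (f : V ⊗[ℂ] K →ₗ[ℂ] V' ⊗[ℂ] K') (C : ℝ)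
    (hf : ∀ x, (κ'.form (f x) (f x)).re ≤ C ^ 2 * (κ.form x x).re) (x : V ⊗[ℂ] K) :
    κ.extend κ' f C hf (κ.toSpace x) = κ'.toSpace (f x) :=
  ContinuousLinearMap.completion_apply_coe _ (show κ.Pre from x)

end PosKernel

section LeftRep

variable {H : Type u} [NormedAddCommGroup H] [InnerProductSpace ℂ H] [CompleteSpace H]
  (N : VonNeumannAlgebra H) (κ : PosKernel V K) (l : Alg N →ₐ[ℂ] Module.End ℂ V)

theorem PosKernel.form_left
    (hl : ∀ a v w, κ.ker (l a v) w = κ.ker v (l (star a) w)) (a : Alg N) (x y : V ⊗[ℂ] K) :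
    κ.form ((l a).rTensor K x) y = κ.form x ((l (star a)).rTensor K y) := by
  induction x using TensorProduct.induction_on with
  | zero => simp
  | add x x' hx hx' => simp [hx, hx']
  | tmul v k =>
    induction y using TensorProduct.induction_on with
    | zero => simp
    | add y y' hy hy' => simp only [map_add, hy, hy']
    | tmul w k' => simp [hl]

theorem exists_defect_alg (a : Alg N) :
    ∃ c : Alg N, star a * a + star c * c = algebraMap ℂ (Alg N) ((‖(a : H →L[ℂ] H)‖ : ℂ) ^ 2) := by
  obtain ⟨c, hc, hcomm⟩ := exists_defect _ (norm_sq_sub_nonneg (a : H →L[ℂ] H))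
  have hmem : c ∈ N.toStarSubalgebra := by
    refine mem_of_commute N fun b hb => hcomm b ?_
    have h1 : b * (a : H →L[ℂ] H) = a * b :=
      (VonNeumannAlgebra.mem_commutant_iff.1 hb _ a.2).symm
    have h2 : b * star (a : H →L[ℂ] H) = star (a : H →L[ℂ] H) * b :=
      (VonNeumannAlgebra.mem_commutant_iff.1 hb _ (star_mem (s := N.toStarSubalgebra) a.2)).symm
    have h3 : b * (star (a : H →L[ℂ] H) * a) = star (a : H →L[ℂ] H) * a * b := by
      rw [← mul_assoc, h2, mul_assoc, h1, mul_assoc]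
    rw [mul_sub, sub_mul]
    congr 1
    simp
  refine ⟨⟨c, hmem⟩, Subtype.ext ?_⟩
  have : (star (a : H →L[ℂ] H) * a + star c * c : H →L[ℂ] H)
      = algebraMap ℂ (H →L[ℂ] H) ((‖(a : H →L[ℂ] H)‖ : ℂ) ^ 2) := by
    rw [hc, Algebra.algebraMap_eq_smul_one]
    exact add_sub_cancel _ _
  exact this

theorem PosKernel.form_left_le
    (hl : ∀ a v w, κ.ker (l a v) w = κ.ker v (l (star a) w)) (a : Alg N) (x : V ⊗[ℂ] K) :
    (κ.form ((l a).rTensor K x) ((l a).rTensor K x)).re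
      ≤ ‖(a : H →L[ℂ] H)‖ ^ 2 * (κ.form x x).re := by
  obtain ⟨c, hc⟩ := exists_defect_alg N a
  have h1 : ∀ b : Alg N, κ.form ((l b).rTensor K x) ((l b).rTensor K x)
      = κ.form x ((l (star b * b)).rTensor K x) := by
    intro b
    rw [PosKernel.form_left N κ l hl, map_mul, Module.End.mul_eq_comp, LinearMap.rTensor_comp]
    rfl
  have h2 : κ.form x ((l (star a * a)).rTensor K x) + κ.form x ((l (star c * c)).rTensor K x)
      = (‖(a : H →L[ℂ] H)‖ : ℂ) ^ 2 * κ.form x x := by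
    rw [← map_add, ← LinearMap.add_apply, ← LinearMap.rTensor_add, ← map_add, hc,
      AlgHom.commutes, Algebra.algebraMap_eq_smul_one, LinearMap.rTensor_smul]
    simp [Module.End.one_eq_id]
  rw [← h1, ← h1] at h2
  have h3 := congrArg Complex.re h2
  have h4 := κ.form_nonneg ((l c).rTensor K x)
  rw [← Complex.ofReal_pow, Complex.re_ofReal_mul, Complex.add_re] at h3
  linarith

/-- If the von Neumann algebra `N` acts on `V` and `κ(a v, w) = κ(v, a* w)`, this is the resulting
`*`-representation `a (v ⊗ k) = (a v) ⊗ k` on `V ⊗_κ K`. -/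
def leftRep (hl : ∀ a v w, κ.ker (l a v) w = κ.ker v (l (star a) w)) :
    Alg N →⋆ₐ[ℂ] (κ.Space →L[ℂ] κ.Space) :=
  let op (a : Alg N) : κ.Space →L[ℂ] κ.Space :=
    κ.extend κ ((l a).rTensor K) ‖(a : H →L[ℂ] H)‖ (PosKernel.form_left_le N κ l hl a)
  have hop : ∀ a v k, op a (κ.tmul v k) = κ.tmul (l a v) k := fun a v k =>
    κ.extend_toSpace _ _ _ _ _
  { toFun := op
    map_one' := κ.hom_ext fun v k => by rw [hop]; simp
    map_mul' := fun a b => κ.hom_ext fun v k => by simp [hop]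
    map_zero' := κ.hom_ext fun v k => by
      rw [hop, map_zero]
      simp [PosKernel.tmul]
    map_add' := fun a b => κ.hom_ext fun v k => by
      rw [hop, map_add, LinearMap.add_apply, κ.add_tmul, ← hop, ← hop]
      rfl
    commutes' := fun c => κ.hom_ext fun v k => by
      rw [hop, AlgHom.commutes, Algebra.algebraMap_eq_smul_one, Algebra.algebraMap_eq_smul_one,
        LinearMap.smul_apply, κ.smul_tmul]
      rfl
    map_star' := fun a => by
      rw [ContinuousLinearMap.star_eq_adjoint, ContinuousLinearMap.eq_adjoint_iff]
      intro x y
      have hd := κ.denseRange_toSpace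
      refine hd.induction_on₂ (p := fun x y => ⟪op (star a) x, y⟫_ℂ = ⟪x, op a y⟫_ℂ)
        (isClosed_eq (by fun_prop) (by fun_prop)) (fun x y => ?_) x y
      simp only [op, PosKernel.extend_toSpace, PosKernel.inner_toSpace]
      rw [PosKernel.form_left N κ l hl, star_star] }

@[simp] theorem leftRep_tmul (hl : ∀ a v w, κ.ker (l a v) w = κ.ker v (l (star a) w))
    (a : Alg N) (v : V) (k : K) : leftRep N κ l hl a (κ.tmul v k) = κ.tmul (l a v) k :=
  κ.extend_toSpace _ _ _ (PosKernel.form_left_le N κ l hl a) _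

end LeftRep

end WeightedTensor

section Stinespring

variable {H : Type u} [NormedAddCommGroup H] [InnerProductSpace ℂ H] [CompleteSpace H]

open scoped Matrix

/-- A normal, unital, completely positive map of a von Neumann algebra `M` to itself: for every
`n` the map `P` takes positive elements `Bᴴ B` of `Mₙ(M)` to positive elements of `Mₙ(M)`, and `P`
is `σ`-weakly continuous. -/
structure NCPMap (M : VonNeumannAlgebra H) where
  toLin : Alg M →ₗ[ℂ] Alg M
  unital : toLin 1 = 1
  cp : ∀ (n : ℕ) (A : Matrix (Fin n) (Fin n) (Alg M)),
    (∃ B : Matrix (Fin n) (Fin n) (Alg M), A = Bᴴ * B) →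
      ∃ C : Matrix (Fin n) (Fin n) (Alg M), A.map toLin = Cᴴ * C
  normal : @Continuous _ _ (sigmaWeakAlg M) (sigmaWeakAlg M) toLin

/-- A completely positive semigroup on `M`: unital normal completely positive maps `P t`, `t ≥ 0`,
with `P 0 = id` and `P (t + s) = P t ∘ P s`. No continuity in `t` is required. -/
structure CPSemigroup (M : VonNeumannAlgebra H) where
  P : ℝ≥0 → NCPMap M
  zero : ∀ T, (P 0).toLin T = T
  add : ∀ t s T, (P (t + s)).toLin T = (P t).toLin ((P s).toLin T)

variable {M : VonNeumannAlgebra H}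

theorem NCPMap.gram (P : NCPMap M) {n : ℕ} (v : Fin n → Alg M) :
    ∃ C : Matrix (Fin n) (Fin n) (Alg M), ∀ i j,
      P.toLin (star (v i) * v j) = ∑ k, star (C k i) * C k j := by
  let B : Matrix (Fin n) (Fin n) (Alg M) := fun i j => if (i : ℕ) = 0 then v j else 0
  obtain ⟨C, hC⟩ := P.cp n (Bᴴ * B) ⟨B, rfl⟩
  refine ⟨C, fun i j => ?_⟩
  have h := congrFun (congrFun hC i) j
  simp only [Matrix.map_apply, Matrix.mul_apply, Matrix.conjTranspose_apply] at h
  rw [← h, Finset.sum_eq_single ⟨0, i.pos⟩]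
  · simp [B]
  · intro b _ hb
    have : (b : ℕ) ≠ 0 := fun h => hb (Fin.ext h)
    simp [B, this]
  · simp

theorem NCPMap.star_apply (P : NCPMap M) (T S : Alg M) :
    star (P.toLin (star T * S)) = P.toLin (star S * T) := by
  obtain ⟨C, hC⟩ := P.gram ![T, S]
  have h1 := hC 0 1
  have h2 := hC 1 0
  simp only [Matrix.cons_val_zero, Matrix.cons_val_one] at h1 h2
  rw [h1, h2]
  simp

/-- A Hilbert space with a `*`-representation of `M`. -/
structure VNRep (M : VonNeumannAlgebra H) : Type (u + 1) where
  K : Type u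
  [normed : NormedAddCommGroup K]
  [inner : InnerProductSpace ℂ K]
  [complete : CompleteSpace K]
  π : Alg M →⋆ₐ[ℂ] (K →L[ℂ] K)

attribute [instance] VNRep.normed VNRep.inner VNRep.complete

/-- The identity representation of `M` on `H`. -/
@[reducible] def idRep (M : VonNeumannAlgebra H) : VNRep M where
  K := H
  π := M.toStarSubalgebra.subtype

/-- The space `L_M(A, B)` of bounded operators `X : A → B` with `X T = T X` for `T ∈ M`. -/
def VNRep.Hom (A B : VNRep M) : Submodule ℂ (A.K →L[ℂ] B.K) where
  carrier := {X | ∀ T, X ∘L A.π T = B.π T ∘L X}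
  add_mem' {X Y} hX hY T := by
    rw [ContinuousLinearMap.add_comp, ContinuousLinearMap.comp_add, hX T, hY T]
  zero_mem' T := by simp
  smul_mem' c X hX T := by
    rw [ContinuousLinearMap.smul_comp, ContinuousLinearMap.comp_smul, hX T]

theorem VNRep.Hom.apply {A B : VNRep M} (X : VNRep.Hom A B) (T : Alg M) (k : A.K) :
    X.1 (A.π T k) = B.π T (X.1 k) :=
  DFunLike.congr_fun (X.2 T) k

/-- The identity intertwiner. -/
def VNRep.Hom.id (A : VNRep M) : VNRep.Hom A A := ⟨ContinuousLinearMap.id ℂ _, fun _ => rfl⟩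

/-- Composition `X Y` of intertwiners. -/
def VNRep.Hom.comp {A B C : VNRep M} (X : VNRep.Hom B C) (Y : VNRep.Hom A B) : VNRep.Hom A C :=
  ⟨X.1 ∘L Y.1, fun T => by
    ext k
    simp [VNRep.Hom.apply]⟩

/-- The adjoint `X*` of an intertwiner. -/
def VNRep.Hom.adj {A B : VNRep M} (X : VNRep.Hom A B) : VNRep.Hom B A :=
  ⟨X.1.adjoint, fun T => by
    have h := congrArg ContinuousLinearMap.adjoint (X.2 (star T))
    rw [ContinuousLinearMap.adjoint_comp, ContinuousLinearMap.adjoint_comp,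
      ← ContinuousLinearMap.star_eq_adjoint (A.π _), ← ContinuousLinearMap.star_eq_adjoint (B.π _),
      ← map_star, ← map_star, star_star] at h
    exact h.symm⟩

/-- The kernel `(T, S) ↦ π(P(T* S))`. -/
def stineKernel (P : NCPMap M) (A : VNRep M) : PosKernel (Alg M) A.K where
  ker := LinearMap.mk₂'ₛₗ (starRingEnd ℂ) (RingHom.id ℂ)
    (fun T S => A.π (P.toLin (star T * S)))
    (fun T T' S => by simp [add_mul]) (fun c T S => by simp)
    (fun T S S' => by simp [mul_add]) (fun c T S => by simp)
  symm T S := by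
    simp only [LinearMap.mk₂'ₛₗ_apply]
    rw [← map_star, P.star_apply]
  pos {ι} _ v k := by
    classical
    let e := Fintype.equivFin ι
    obtain ⟨C, hC⟩ := P.gram (fun i => v (e.symm i))
    have h1 : ∀ i j, ⟪k i, A.π (P.toLin (star (v i) * v j)) (k j)⟫_ℂ
        = ∑ n, ⟪A.π (C n (e i)) (k i), A.π (C n (e j)) (k j)⟫_ℂ := by
      intro i j
      have := hC (e i) (e j)
      simp only [Equiv.symm_apply_apply] at this
      rw [this, map_sum, sum_apply, inner_sum]
      refine Finset.sum_congr rfl fun n _ => ?_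
      rw [map_mul, map_star, mul_apply_eq_comp, ContinuousLinearMap.star_eq_adjoint,
        ContinuousLinearMap.adjoint_inner_right]
    have h2 : (∑ i, ∑ j, ⟪k i, A.π (P.toLin (star (v i) * v j)) (k j)⟫_ℂ)
        = ∑ n, ⟪∑ i, A.π (C n (e i)) (k i), ∑ i, A.π (C n (e i)) (k i)⟫_ℂ := by
      simp only [h1, sum_inner, inner_sum]
      rw [Finset.sum_congr rfl fun i _ => Finset.sum_comm, Finset.sum_comm]
      exact Finset.sum_congr rfl fun n _ => Finset.sum_comm
    simp only [LinearMap.mk₂'ₛₗ_apply]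
    rw [h2, Complex.re_sum]
    exact Finset.sum_nonneg fun n _ => inner_self_nonneg (𝕜 := ℂ)

@[simp] theorem stineKernel_ker (P : NCPMap M) (A : VNRep M) (T S : Alg M) :
    (stineKernel P A).ker T S = A.π (P.toLin (star T * S)) := rfl

/-- The left multiplication of an algebra on itself. -/
def mulLeft (N : VonNeumannAlgebra H) : Alg N →ₐ[ℂ] Module.End ℂ (Alg N) :=
  Algebra.lmul ℂ (Alg N)

theorem stineKernel_left (P : NCPMap M) (A : VNRep M) (a v w : Alg M) :
    (stineKernel P A).ker (mulLeft M a v) w = (stineKernel P A).ker v (mulLeft M (star a) w) := by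
  simp [mulLeft, mul_assoc]

/-- `M ⊗_P A`: the Hausdorff completion of `M ⊗ A` for
`⟪T ⊗ k, S ⊗ l⟫ = ⟪k, P(T* S) l⟫`, with `M` acting by `S (T ⊗ k) = (S T) ⊗ k`. -/
@[reducible] def stine (P : NCPMap M) (A : VNRep M) : VNRep M where
  K := (stineKernel P A).Space
  π := leftRep M (stineKernel P A) (mulLeft M) (stineKernel_left P A)

theorem stine_π_tmul (P : NCPMap M) (A : VNRep M) (S T : Alg M) (k : A.K) :
    (stine P A).π S ((stineKernel P A).tmul T k) = (stineKernel P A).tmul (S * T) k :=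
  leftRep_tmul _ _ _ (stineKernel_left P A) _ _ _

theorem stine_form_lTensor (P : NCPMap M) {A B : VNRep M} (X : VNRep.Hom A B)
    (x y : Alg M ⊗[ℂ] A.K) :
    (stineKernel P B).form ((X.1.toLinearMap).lTensor _ x) ((X.1.toLinearMap).lTensor _ y)
      = (stineKernel P A).form x (((X.1.adjoint ∘L X.1).toLinearMap).lTensor _ y) := by
  induction x using TensorProduct.induction_on with
  | zero => simp
  | add x x' hx hx' => simp only [map_add, LinearMap.add_apply, hx, hx']
  | tmul T k =>
    induction y using TensorProduct.induction_on with
    | zero => simp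
    | add y y' hy hy' => simp only [map_add, hy, hy']
    | tmul S l =>
      simp only [LinearMap.lTensor_tmul, PosKernel.form_tmul, stineKernel_ker,
        ContinuousLinearMap.coe_coe, ContinuousLinearMap.comp_apply]
      rw [← VNRep.Hom.apply X, ← ContinuousLinearMap.adjoint_inner_right]
      have := VNRep.Hom.apply (VNRep.Hom.comp (VNRep.Hom.adj X) X) (P.toLin (star T * S)) l
      exact congrArg _ this

theorem stine_lTensor_le (P : NCPMap M) {A B : VNRep M} (X : VNRep.Hom A B) (x : Alg M ⊗[ℂ] A.K) :
    ((stineKernel P B).form ((X.1.toLinearMap).lTensor _ x)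
      ((X.1.toLinearMap).lTensor _ x)).re ≤ ‖X.1‖ ^ 2 * ((stineKernel P A).form x x).re := by
  obtain ⟨c, hc, hcomm⟩ := exists_defect _ (norm_sq_sub_nonneg X.1)
  have hcm : ∀ T, c ∘L A.π T = A.π T ∘L c := by
    intro T
    refine (hcomm (A.π T) ?_).symm
    rw [mul_sub, sub_mul]
    congr 1
    · simp
    · exact ((VNRep.Hom.comp (VNRep.Hom.adj X) X).2 T).symm
  have h1 := stine_form_lTensor P X x x
  have h2 := stine_form_lTensor P (⟨c, hcm⟩ : VNRep.Hom A A) x x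
  rw [ContinuousLinearMap.star_eq_adjoint] at hc
  have hc' : c.adjoint ∘L c = ((‖X.1‖ : ℂ) ^ 2) • (1 : A.K →L[ℂ] A.K) - X.1.adjoint ∘L X.1 := hc
  have h3 : (stineKernel P A).form x (((X.1.adjoint ∘L X.1).toLinearMap).lTensor _ x)
      + (stineKernel P A).form x (((c.adjoint ∘L c).toLinearMap).lTensor _ x)
      = (‖X.1‖ : ℂ) ^ 2 * (stineKernel P A).form x x := by
    rw [← map_add, ← LinearMap.add_apply, ← LinearMap.lTensor_add, hc']
    have : (X.1.adjoint ∘L X.1).toLinearMap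
        + (((‖X.1‖ : ℂ) ^ 2) • (1 : A.K →L[ℂ] A.K) - X.1.adjoint ∘L X.1).toLinearMap
        = ((‖X.1‖ : ℂ) ^ 2) • LinearMap.id := by
      ext k
      simp
    rw [this, LinearMap.lTensor_smul]
    simp
  rw [← h1, ← h2] at h3
  have h4 := congrArg Complex.re h3
  have h5 := (stineKernel P A).form_nonneg (c.toLinearMap.lTensor _ x)
  rw [← Complex.ofReal_pow, Complex.re_ofReal_mul, Complex.add_re] at h4
  have h6 : 0 ≤ ((stineKernel P A).form (c.toLinearMap.lTensor _ x)
    (c.toLinearMap.lTensor _ x)).re := h5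
  linarith

/-- `I ⊗ X : M ⊗_P A → M ⊗_P B`, `T ⊗ k ↦ T ⊗ X k`, for an intertwiner `X : A → B`. -/
def stineMap (P : NCPMap M) {A B : VNRep M} (X : VNRep.Hom A B) : VNRep.Hom (stine P A) (stine P B) :=
  ⟨(stineKernel P A).extend (stineKernel P B) ((X.1.toLinearMap).lTensor _) ‖X.1‖
      (stine_lTensor_le P X), fun T => (stineKernel P A).hom_ext fun S k => by
    have h : ∀ S k, (stineKernel P A).extend (stineKernel P B) ((X.1.toLinearMap).lTensor _) ‖X.1‖
      (stine_lTensor_le P X) ((stineKernel P A).tmul S k) = (stineKernel P B).tmul S (X.1 k) :=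
      fun S k => (stineKernel P A).extend_toSpace _ _ _ (stine_lTensor_le P X) _
    rw [ContinuousLinearMap.comp_apply, ContinuousLinearMap.comp_apply, h]
    rw [stine_π_tmul, h, stine_π_tmul]⟩

theorem stineMap_tmul (P : NCPMap M) {A B : VNRep M} (X : VNRep.Hom A B) (T : Alg M) (k : A.K) :
    (stineMap P X).1 ((stineKernel P A).tmul T k) = (stineKernel P B).tmul T (X.1 k) :=
  (stineKernel P A).extend_toSpace _ _ _ (stine_lTensor_le P X) _

/-- `k ↦ I ⊗ k`. -/
def stineUnit (P : NCPMap M) (A : VNRep M) : A.K →ₗ[ℂ] (stine P A).K where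
  toFun k := (stineKernel P A).tmul 1 k
  map_add' k l := (stineKernel P A).tmul_add 1 k l
  map_smul' c k := (stineKernel P A).tmul_smul c 1 k

theorem split_form (P Q R : NCPMap M) (h : ∀ T, R.toLin T = Q.toLin (P.toLin T)) (A : VNRep M)
    (x y : Alg M ⊗[ℂ] A.K) :
    (stineKernel P (stine Q A)).form ((stineUnit Q A).lTensor _ x) ((stineUnit Q A).lTensor _ y)
      = (stineKernel R A).form x y := by
  induction x using TensorProduct.induction_on with
  | zero => simp
  | add x x' hx hx' => simp only [map_add, LinearMap.add_apply, hx, hx']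
  | tmul T k =>
    induction y using TensorProduct.induction_on with
    | zero => simp
    | add y y' hy hy' => simp only [map_add, hy, hy']
    | tmul S l =>
      simp only [LinearMap.lTensor_tmul, PosKernel.form_tmul, stineKernel_ker]
      rw [h]
      change ⟪(stineKernel Q A).tmul 1 k, (stine Q A).π _ ((stineKernel Q A).tmul 1 l)⟫_ℂ = _
      rw [stine_π_tmul, PosKernel.inner_tmul]
      simp

theorem split_le (P Q R : NCPMap M) (h : ∀ T, R.toLin T = Q.toLin (P.toLin T)) (A : VNRep M)
    (x : Alg M ⊗[ℂ] A.K) :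
    ((stineKernel P (stine Q A)).form ((stineUnit Q A).lTensor _ x)
      ((stineUnit Q A).lTensor _ x)).re ≤ 1 ^ 2 * ((stineKernel R A).form x x).re := by
  rw [split_form P Q R h]; simp

/-- For `R = Q ∘ P` the isometry `M ⊗_R A → M ⊗_P M ⊗_Q A`, `T ⊗ k ↦ T ⊗ I ⊗ k`. -/
def split (P Q R : NCPMap M) (h : ∀ T, R.toLin T = Q.toLin (P.toLin T)) (A : VNRep M) :
    VNRep.Hom (stine R A) (stine P (stine Q A)) :=
  ⟨(stineKernel R A).extend (stineKernel P (stine Q A)) ((stineUnit Q A).lTensor _) 1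
      (split_le P Q R h A), fun T => (stineKernel R A).hom_ext fun S k => by
    have hx : ∀ S k, (stineKernel R A).extend (stineKernel P (stine Q A))
        ((stineUnit Q A).lTensor _) 1 (split_le P Q R h A)
        ((stineKernel R A).tmul S k)
        = (stineKernel P (stine Q A)).tmul S ((stineKernel Q A).tmul 1 k) :=
      fun S k => (stineKernel R A).extend_toSpace _ _ _ (split_le P Q R h A) _
    rw [ContinuousLinearMap.comp_apply, ContinuousLinearMap.comp_apply, hx]
    rw [stine_π_tmul, hx, stine_π_tmul]⟩

theorem split_tmul (P Q R : NCPMap M) (h : ∀ T, R.toLin T = Q.toLin (P.toLin T)) (A : VNRep M)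
    (T : Alg M) (k : A.K) : (split P Q R h A).1 ((stineKernel R A).tmul T k)
      = (stineKernel P (stine Q A)).tmul T ((stineKernel Q A).tmul 1 k) :=
  (stineKernel R A).extend_toSpace _ _ _ (split_le P Q R h A) _

end Stinespring

section Partitions

/-- A partition `0 = t₀ < t₁ < ⋯ < tₙ = t` of `[0, t]`, recorded by the list of its gaps
`[t₁ - t₀, t₂ - t₁, …, tₙ - tₙ₋₁]`. For `t = 0` there is one partition, with no gap. -/
structure Part (t : ℝ≥0) where
  gaps : List ℝ≥0
  pos : ∀ d ∈ gaps, 0 < d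
  sum : gaps.sum = t

/-- `Refines l l'`: the partition with gaps `l'` is finer than the partition with gaps `l`. Reading
both from the left, either the first gaps agree, or the first gap `d = e + f` of `l` is cut at the
end of the first gap `e` of `l'`. -/
inductive Refines : List ℝ≥0 → List ℝ≥0 → Prop
  | nil : Refines [] []
  | keep (d : ℝ≥0) {l l' : List ℝ≥0} : Refines l l' → Refines (d :: l) (d :: l')
  | cut (d e f : ℝ≥0) {l l' : List ℝ≥0} : d = e + f → 0 < f → Refines (f :: l) l' →
      Refines (d :: l) (e :: l')

theorem Refines.refl (l : List ℝ≥0) : Refines l l := by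
  induction l with
  | nil => exact .nil
  | cons d l ih => exact .keep d ih

theorem Refines.trans {l₁ l₂ l₃ : List ℝ≥0} (h₁ : Refines l₁ l₂) (h₂ : Refines l₂ l₃) :
    Refines l₁ l₃ := by
  induction h₂ generalizing l₁ with
  | nil => exact h₁
  | keep d h ih =>
    cases h₁ with
    | keep _ h' => exact .keep d (ih h')
    | cut _ _ f hd hf h' => exact .cut _ _ f hd hf (ih h')
  | cut d e f hd hf h ih =>
    cases h₁ with
    | keep _ h' => exact .cut _ _ f hd hf (ih (.keep f h'))
    | cut d' _ g hd' hg h' =>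
      refine .cut d' e (f + g) ?_ (by positivity) (ih (.cut _ _ g rfl hg h'))
      rw [hd', hd, add_assoc]

theorem Refines.exists_merge (n : ℕ) : ∀ (l₁ l₂ : List ℝ≥0), l₁.length + l₂.length ≤ n →
    (∀ d ∈ l₁, 0 < d) → (∀ d ∈ l₂, 0 < d) → l₁.sum = l₂.sum →
    ∃ l : List ℝ≥0, (∀ d ∈ l, 0 < d) ∧ l.sum = l₁.sum ∧ Refines l₁ l ∧ Refines l₂ l := by
  induction n with
  | zero =>
    intro l₁ l₂ hn _ _ _
    have h1 : l₁ = [] := List.length_eq_zero_iff.1 (by omega)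
    have h2 : l₂ = [] := List.length_eq_zero_iff.1 (by omega)
    subst h1 h2
    exact ⟨[], by simp, rfl, .nil, .nil⟩
  | succ n ih =>
    intro l₁ l₂ hn h₁ h₂ hs
    match l₁, l₂ with
    | [], [] => exact ⟨[], by simp, rfl, .nil, .nil⟩
    | [], e :: l₂ =>
      have := h₂ e (by simp)
      simp only [List.sum_nil, List.sum_cons] at hs
      exact absurd (add_eq_zero.1 hs.symm).1 this.ne'
    | d :: l₁, [] =>
      have := h₁ d (by simp)
      simp only [List.sum_nil, List.sum_cons] at hs
      exact absurd (add_eq_zero.1 hs).1 this.ne'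
    | d :: l₁, e :: l₂ =>
      simp only [List.length_cons, List.sum_cons] at hn hs
      simp only [List.mem_cons, forall_eq_or_imp] at h₁ h₂
      rcases lt_trichotomy d e with h | h | h
      · have hpos : 0 < e - d := tsub_pos_of_lt h
        have he : e = d + (e - d) := (add_tsub_cancel_of_le h.le).symm
        obtain ⟨l, hl, hsum, r₁, r₂⟩ := ih l₁ ((e - d) :: l₂) (by simp; omega) h₁.2
          (by simp only [List.mem_cons, forall_eq_or_imp]; exact ⟨hpos, h₂.2⟩)
          (by
            rw [List.sum_cons]
            apply add_left_cancel (a := d)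
            rw [hs, ← add_assoc, ← he])
        refine ⟨d :: l, ?_, by simp [hsum], .keep d r₁, .cut e d (e - d) he hpos r₂⟩
        simp only [List.mem_cons, forall_eq_or_imp]
        exact ⟨h₁.1, hl⟩
      · subst h
        obtain ⟨l, hl, hsum, r₁, r₂⟩ := ih l₁ l₂ (by omega) h₁.2 h₂.2 (add_left_cancel hs)
        refine ⟨d :: l, ?_, by simp [hsum], .keep d r₁, .keep d r₂⟩
        simp only [List.mem_cons, forall_eq_or_imp]
        exact ⟨h₁.1, hl⟩
      · have hpos : 0 < d - e := tsub_pos_of_lt h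
        have he : d = e + (d - e) := (add_tsub_cancel_of_le h.le).symm
        have hs' : ((d - e) :: l₁).sum = l₂.sum := by
          rw [List.sum_cons]
          apply add_left_cancel (a := e)
          rw [← hs, ← add_assoc, ← he]
        obtain ⟨l, hl, hsum, r₁, r₂⟩ := ih ((d - e) :: l₁) l₂ (by simp; omega)
          (by simp only [List.mem_cons, forall_eq_or_imp]; exact ⟨hpos, h₁.2⟩) h₂.2 hs'
        refine ⟨e :: l, ?_, ?_, .cut d e (d - e) he hpos r₁, .keep e r₂⟩
        · simp only [List.mem_cons, forall_eq_or_imp]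
          exact ⟨h₂.1, hl⟩
        · rw [List.sum_cons, List.sum_cons, hsum, hs', hs]

/-- Partitions of `[0, t]` ordered by refinement. -/
instance (t : ℝ≥0) : Preorder (Part t) where
  le p q := Refines p.gaps q.gaps
  le_refl p := Refines.refl _
  le_trans _ _ _ := Refines.trans

instance (t : ℝ≥0) : IsDirectedOrder (Part t) where
  directed p q := by
    obtain ⟨l, hl, hs, h₁, h₂⟩ := Refines.exists_merge _ p.gaps q.gaps le_rfl p.pos q.pos
      (p.sum.trans q.sum.symm)
    exact ⟨⟨l, hl, hs.trans p.sum⟩, h₁, h₂⟩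

instance (t : ℝ≥0) : Nonempty (Part t) := by
  by_cases h : t = 0
  · exact ⟨⟨[], by simp, h.symm⟩⟩
  · exact ⟨⟨[t], by simpa using pos_iff_ne_zero.2 h, by simp⟩⟩

/-- The concatenation `p₂ ∨ (p₁ + s)` of partitions `p₁` of `[0, t]` and `p₂` of `[0, s]`:
first the gaps of `p₂`, then those of `p₁`. -/
def Part.concat {t s u : ℝ≥0} (h : t + s = u) (p₁ : Part t) (p₂ : Part s) : Part u where
  gaps := p₂.gaps ++ p₁.gaps
  pos d hd := (List.mem_append.1 hd).elim (p₂.pos d) (p₁.pos d)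
  sum := by rw [List.sum_append, p₁.sum, p₂.sum, add_comm, h]

/-- The one-point partition of `[0, 0]`. -/
def Part.trivial : Part 0 := ⟨[], by simp, rfl⟩

end Partitions

section TensorSpaces

variable {H : Type u} [NormedAddCommGroup H] [InnerProductSpace ℂ H] [CompleteSpace H]
  {M : VonNeumannAlgebra H} (Φ : CPSemigroup M)

/-- The Hilbert space `H_𝔭 = M ⊗_{P_{d₁}} M ⊗_{P_{d₂}} ⋯ M ⊗_{P_{dₙ}} H` attached to the
list `[d₁, …, dₙ]` of gaps of a partition, with its left action of `M`. -/
@[reducible] def HPart : List ℝ≥0 → VNRep M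
  | [] => idRep M
  | d :: l => stine (Φ.P d) (HPart l)

/-- The intertwiner of the identity representation given by an element of `M'`. -/
def ofCommutant (R : Alg M.commutant) : VNRep.Hom (idRep M) (idRep M) :=
  ⟨(R : H →L[ℂ] H), fun T => (VonNeumannAlgebra.mem_commutant_iff.1 R.2 _ T.2).symm⟩

/-- `I ⊗ R` on `H_𝔭`, for `R ∈ M'`: `T₁ ⊗ ⋯ ⊗ Tₙ ⊗ h ↦ T₁ ⊗ ⋯ ⊗ Tₙ ⊗ R h`. -/
def amp (R : Alg M.commutant) : ∀ l : List ℝ≥0, VNRep.Hom (HPart Φ l) (HPart Φ l)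
  | [] => ofCommutant R
  | d :: l => stineMap (Φ.P d) (amp R l)

/-- `I_s ⊗ X : H_{𝔭₂} → H_𝔭`, `T₁ ⊗ ⋯ ⊗ Tₙ ⊗ h ↦ T₁ ⊗ ⋯ ⊗ Tₙ ⊗ X h`, for
`X : H → H_{𝔭₁}` intertwining `M`, where `l` is the list of gaps of `𝔭₂`. -/
def ampTail {l₁ : List ℝ≥0} (X : VNRep.Hom (idRep M) (HPart Φ l₁)) :
    ∀ l : List ℝ≥0, VNRep.Hom (HPart Φ l) (HPart Φ (l ++ l₁))
  | [] => X
  | d :: l => stineMap (Φ.P d) (ampTail X l)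

/-- For `d = e + f`, the isometry `T ⊗ k ↦ T ⊗ I ⊗ k` from `M ⊗_{P_d} A` to
`M ⊗_{P_e} M ⊗_{P_f} A`. -/
def cutMap (d e f : ℝ≥0) (h : d = e + f) (A : VNRep M) :
    VNRep.Hom (stine (Φ.P d) A) (stine (Φ.P e) (stine (Φ.P f) A)) :=
  split (Φ.P e) (Φ.P f) (Φ.P d) (fun T => by rw [h, add_comm, Φ.add]) A

/-- The isometry `v₀ : H_𝔭 → H_𝔭'` for a refinement `𝔭'` of `𝔭`, which inserts the identity of `M`
at all the positions where `𝔭'` has a new point (with the value `0` if `𝔭'` does not refine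
`𝔭`). -/
def ins : ∀ l l' : List ℝ≥0, VNRep.Hom (HPart Φ l) (HPart Φ l')
  | [], [] => VNRep.Hom.id _
  | [], _ :: _ => 0
  | _ :: _, [] => 0
  | d :: l, e :: l' =>
    if h : d = e then h ▸ stineMap (Φ.P d) (ins l l')
    else if h : e < d then
      VNRep.Hom.comp (stineMap (Φ.P e) (ins ((d - e) :: l) l'))
        (cutMap Φ d e (d - e) (add_tsub_cancel_of_le h.le).symm (HPart Φ l))
    else 0

theorem ins_nil : ins Φ [] [] = VNRep.Hom.id _ := by rw [ins]

theorem ins_keep (d : ℝ≥0) (l l' : List ℝ≥0) :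
    ins Φ (d :: l) (d :: l') = stineMap (Φ.P d) (ins Φ l l') := by
  rw [ins, dif_pos rfl]

theorem ins_cut (d e f : ℝ≥0) (h : d = e + f) (hf : 0 < f) (l l' : List ℝ≥0) :
    ins Φ (d :: l) (e :: l') = VNRep.Hom.comp (stineMap (Φ.P e) (ins Φ (f :: l) l'))
      (cutMap Φ d e f h (HPart Φ l)) := by
  have h1 : e < d := by rw [h]; exact lt_add_of_pos_right e hf
  have h2 : d - e = f := by rw [h, add_tsub_cancel_left]
  subst h2
  rw [ins, dif_neg h1.ne', dif_pos h1]

theorem stine_hom_ext {P : NCPMap M} {A B : VNRep M} {X Y : VNRep.Hom (stine P A) B}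
    (h : ∀ T k, X.1 ((stineKernel P A).tmul T k) = Y.1 ((stineKernel P A).tmul T k)) : X = Y :=
  Subtype.ext ((stineKernel P A).hom_ext h)

theorem comp_apply {A B C : VNRep M} (X : VNRep.Hom B C) (Y : VNRep.Hom A B) (k : A.K) :
    (VNRep.Hom.comp X Y).1 k = X.1 (Y.1 k) := rfl

theorem stineMap_id (P : NCPMap M) (A : VNRep M) :
    stineMap P (VNRep.Hom.id A) = VNRep.Hom.id (stine P A) :=
  stine_hom_ext fun T k => stineMap_tmul ..

theorem stineMap_comp (P : NCPMap M) {A B C : VNRep M} (X : VNRep.Hom B C) (Y : VNRep.Hom A B) :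
    stineMap P (VNRep.Hom.comp X Y) = VNRep.Hom.comp (stineMap P X) (stineMap P Y) :=
  stine_hom_ext fun T k => by
    rw [comp_apply, stineMap_tmul, stineMap_tmul, stineMap_tmul, comp_apply]

theorem cutMap_tmul (d e f : ℝ≥0) (h : d = e + f) (A : VNRep M) (T : Alg M) (k : A.K) :
    (cutMap Φ d e f h A).1 ((stineKernel (Φ.P d) A).tmul T k)
      = (stineKernel (Φ.P e) (stine (Φ.P f) A)).tmul T ((stineKernel (Φ.P f) A).tmul 1 k) :=
  split_tmul ..

theorem cutMap_natural (d e f : ℝ≥0) (h : d = e + f) {A B : VNRep M} (X : VNRep.Hom A B) :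
    VNRep.Hom.comp (cutMap Φ d e f h B) (stineMap (Φ.P d) X)
      = VNRep.Hom.comp (stineMap (Φ.P e) (stineMap (Φ.P f) X)) (cutMap Φ d e f h A) :=
  stine_hom_ext fun T k => by
    rw [comp_apply, comp_apply, stineMap_tmul, cutMap_tmul, cutMap_tmul, stineMap_tmul,
      stineMap_tmul]

theorem cutMap_coassoc (d e f g a b : ℝ≥0) (h₁ : d = a + g) (h₂ : a = e + f) (h₃ : d = e + b)
    (h₄ : b = f + g) (A : VNRep M) :
    VNRep.Hom.comp (cutMap Φ a e f h₂ (stine (Φ.P g) A)) (cutMap Φ d a g h₁ A)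
      = VNRep.Hom.comp (stineMap (Φ.P e) (cutMap Φ b f g h₄ A)) (cutMap Φ d e b h₃ A) :=
  stine_hom_ext fun T k => by
    rw [comp_apply, comp_apply, cutMap_tmul, cutMap_tmul, cutMap_tmul, stineMap_tmul, cutMap_tmul]

theorem ins_self (l : List ℝ≥0) : ins Φ l l = VNRep.Hom.id _ := by
  induction l with
  | nil => exact ins_nil Φ
  | cons d l ih => rw [ins_keep, ih, stineMap_id]

theorem comp_assoc {A B C D : VNRep M} (X : VNRep.Hom C D) (Y : VNRep.Hom B C) (Z : VNRep.Hom A B) :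
    VNRep.Hom.comp (VNRep.Hom.comp X Y) Z = VNRep.Hom.comp X (VNRep.Hom.comp Y Z) := rfl

theorem ins_comp {l₁ l₂ l₃ : List ℝ≥0} (h₁ : Refines l₁ l₂) (h₂ : Refines l₂ l₃) :
    VNRep.Hom.comp (ins Φ l₂ l₃) (ins Φ l₁ l₂) = ins Φ l₁ l₃ := by
  induction h₂ generalizing l₁ with
  | nil => rw [ins_nil]; rfl
  | @keep d m' m'' h ih =>
    cases h₁ with
    | keep _ h' => rw [ins_keep, ins_keep, ins_keep, ← stineMap_comp, ih h']
    | cut _ _ f hd hf h' =>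
      rw [ins_keep, ins_cut Φ _ _ f hd hf, ins_cut Φ _ _ f hd hf, ← comp_assoc, ← stineMap_comp,
        ih h']
  | @cut d e f m' m'' hd hf h ih =>
    cases h₁ with
    | keep _ h' =>
      rw [ins_keep, ins_cut Φ _ _ f hd hf, ins_cut Φ _ _ f hd hf, comp_assoc, cutMap_natural,
        ← comp_assoc, ← stineMap_comp, ← ins_keep, ih (.keep f h')]
    | cut d' _ g hd' hg h' =>
      have hd'' : d' = e + (f + g) := by rw [hd', hd, add_assoc]
      rw [ins_cut Φ _ _ f hd hf, ins_cut Φ _ _ g hd' hg,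
        ins_cut Φ d' e (f + g) hd'' (by positivity), ← ih (.cut _ _ g rfl hg h'),
        ins_cut Φ (f + g) f g rfl hg, stineMap_comp, stineMap_comp]
      rw [comp_assoc, ← comp_assoc (cutMap Φ d e f hd _), cutMap_natural, comp_assoc,
        cutMap_coassoc Φ d' e f g d (f + g) hd' hd hd'' rfl]
      rfl

theorem stineMap_inner (P : NCPMap M) {A B : VNRep M} (X : VNRep.Hom A B)
    (h : X.1.adjoint ∘L X.1 = ContinuousLinearMap.id ℂ _) :
    (stineMap P X).1.adjoint ∘L (stineMap P X).1 = ContinuousLinearMap.id ℂ _ := by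
  have : ∀ x y, ⟪(stineMap P X).1 x, (stineMap P X).1 y⟫_ℂ = ⟪x, y⟫_ℂ := by
    intro x y
    refine (stineKernel P A).denseRange_toSpace.induction_on₂
      (p := fun x y => ⟪(stineMap P X).1 x, (stineMap P X).1 y⟫_ℂ = ⟪x, y⟫_ℂ)
      (isClosed_eq (by fun_prop) (by fun_prop)) (fun x y => ?_) x y
    have hx : ∀ x, (stineMap P X).1 ((stineKernel P A).toSpace x)
        = (stineKernel P B).toSpace ((X.1.toLinearMap).lTensor _ x) := fun x =>
      (stineKernel P A).extend_toSpace _ _ _ (stine_lTensor_le P X) _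
    rw [hx, hx, PosKernel.inner_toSpace, PosKernel.inner_toSpace, stine_form_lTensor, h]
    have h2 : LinearMap.lTensor (Alg M) (ContinuousLinearMap.id ℂ A.K).toLinearMap
        = LinearMap.id := LinearMap.lTensor_id _ _
    rw [h2, LinearMap.id_apply]
  ext x
  refine ext_inner_left ℂ fun y => ?_
  rw [ContinuousLinearMap.comp_apply, ContinuousLinearMap.adjoint_inner_right, this]
  rfl

theorem split_isometry (P Q R : NCPMap M) (h : ∀ T, R.toLin T = Q.toLin (P.toLin T)) (A : VNRep M) :
    (split P Q R h A).1.adjoint ∘L (split P Q R h A).1 = ContinuousLinearMap.id ℂ _ := by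
  have : ∀ x y, ⟪(split P Q R h A).1 x, (split P Q R h A).1 y⟫_ℂ = ⟪x, y⟫_ℂ := by
    intro x y
    refine (stineKernel R A).denseRange_toSpace.induction_on₂
      (p := fun x y => ⟪(split P Q R h A).1 x, (split P Q R h A).1 y⟫_ℂ = ⟪x, y⟫_ℂ)
      (isClosed_eq (by fun_prop) (by fun_prop)) (fun x y => ?_) x y
    have hx : ∀ x, (split P Q R h A).1 ((stineKernel R A).toSpace x)
        = (stineKernel P (stine Q A)).toSpace ((stineUnit Q A).lTensor _ x) := fun x =>
      (stineKernel R A).extend_toSpace _ _ _ (split_le P Q R h A) _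
    rw [hx, hx, PosKernel.inner_toSpace, PosKernel.inner_toSpace, split_form P Q R h]
  ext x
  refine ext_inner_left ℂ fun y => ?_
  rw [ContinuousLinearMap.comp_apply, ContinuousLinearMap.adjoint_inner_right, this]
  rfl

theorem comp_isometry {A B C : VNRep M} (X : VNRep.Hom B C) (Y : VNRep.Hom A B)
    (hX : X.1.adjoint ∘L X.1 = ContinuousLinearMap.id ℂ _)
    (hY : Y.1.adjoint ∘L Y.1 = ContinuousLinearMap.id ℂ _) :
    (VNRep.Hom.comp X Y).1.adjoint ∘L (VNRep.Hom.comp X Y).1 = ContinuousLinearMap.id ℂ _ := by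
  change (X.1 ∘L Y.1).adjoint ∘L (X.1 ∘L Y.1) = _
  rw [ContinuousLinearMap.adjoint_comp]
  have h : (Y.1.adjoint ∘L X.1.adjoint) ∘L (X.1 ∘L Y.1)
    = Y.1.adjoint ∘L ((X.1.adjoint ∘L X.1) ∘L Y.1) := rfl
  rw [h, hX, ContinuousLinearMap.id_comp, hY]

theorem ins_isometry {l l' : List ℝ≥0} (h : Refines l l') :
    (ins Φ l l').1.adjoint ∘L (ins Φ l l').1 = ContinuousLinearMap.id ℂ _ := by
  induction h with
  | nil =>
    rw [ins_nil]
    ext x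
    refine ext_inner_left ℂ fun y => ?_
    rw [ContinuousLinearMap.comp_apply, ContinuousLinearMap.adjoint_inner_right]
    rfl
  | keep d h ih => rw [ins_keep]; exact stineMap_inner _ _ ih
  | @cut d e f m m' hd hf h ih =>
    rw [ins_cut Φ _ _ f hd hf]
    exact comp_isometry _ _ (stineMap_inner (Φ.P e) _ ih) (split_isometry ..)

end TensorSpaces

section Correspondences

variable {H : Type u} [NormedAddCommGroup H] [InnerProductSpace ℂ H] [CompleteSpace H]

open MulOpposite

/-- A semi-inner product correspondence over the von Neumann algebra `N`: a complex vector space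
with commuting left and right actions of `N` and an `N`-valued semi-inner product, linear in the
second variable, such that `⟨x, y b⟩ = ⟨x, y⟩ b` and `⟨a x, y⟩ = ⟨x, a* y⟩`. Positivity is recorded
for all Gram matrices: `(⟨xᵢ, xⱼ⟩)ᵢⱼ = Cᴴ C` for a matrix `C` over `N` (for one element:
`⟨x, x⟩ ≥ 0`). -/
structure PreCorr (N : VonNeumannAlgebra H) : Type (u + 1) where
  carrier : Type u
  [grp : AddCommGroup carrier]
  [mod : Module ℂ carrier]
  lact : Alg N →ₐ[ℂ] Module.End ℂ carrier
  ract : (Alg N)ᵐᵒᵖ →ₐ[ℂ] Module.End ℂ carrier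
  lact_ract : ∀ a b x, lact a (ract b x) = ract b (lact a x)
  ip : carrier →ₗ⋆[ℂ] carrier →ₗ[ℂ] Alg N
  star_ip : ∀ x y, star (ip x y) = ip y x
  ip_ract : ∀ x y b, ip x (ract (op b) y) = ip x y * b
  ip_lact : ∀ x y a, ip (lact a x) y = ip x (lact (star a) y)
  gram : ∀ {ι : Type} [Fintype ι] (x : ι → carrier), ∃ (κ : Type) (_ : Fintype κ)
    (C : κ → ι → Alg N), ∀ i j, ip (x i) (x j) = ∑ k, star (C k i) * C k j

attribute [instance] PreCorr.grp PreCorr.mod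

variable {N : VonNeumannAlgebra H}

/-- The norm `‖⟨x, x⟩‖^{1/2}`. -/
def PreCorr.nrm (X : PreCorr N) (x : X.carrier) : ℝ := √‖(X.ip x x : H →L[ℂ] H)‖

/-- A `W*`-correspondence over `N`: the inner product is definite, the space is complete, the
module is self-dual (every bounded right `N`-linear map `X → N` is of the form `⟨ξ, ·⟩`), and the
left action is normal. -/
structure PreCorr.IsWStar (X : PreCorr N) : Prop where
  definite : ∀ x, X.ip x x = 0 → x = 0
  complete : ∀ u : ℕ → X.carrier,
    (∀ ε > 0, ∃ n₀, ∀ m ≥ n₀, ∀ n ≥ n₀, X.nrm (u m - u n) < ε) →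
      ∃ x, ∀ ε > 0, ∃ n₀, ∀ n ≥ n₀, X.nrm (u n - x) < ε
  selfDual : ∀ φ : X.carrier →ₗ[ℂ] Alg N, (∀ x b, φ (X.ract (op b) x) = φ x * b) →
    (∃ C : ℝ, ∀ x, ‖(φ x : H →L[ℂ] H)‖ ≤ C * X.nrm x) → ∃ ξ, ∀ x, φ x = X.ip ξ x
  normal : ∀ x y, @Continuous _ _ (sigmaWeakAlg N) (sigmaWeakAlg N) fun a => X.ip x (X.lact a y)

/-- An isomorphism of correspondences: a bijective bimodule map preserving inner products. -/
structure PreCorr.Iso (X Y : PreCorr N) where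
  toEquiv : X.carrier ≃ₗ[ℂ] Y.carrier
  map_lact : ∀ a x, toEquiv (X.lact a x) = Y.lact a (toEquiv x)
  map_ract : ∀ b x, toEquiv (X.ract b x) = Y.ract b (toEquiv x)
  map_ip : ∀ x y, Y.ip (toEquiv x) (toEquiv y) = X.ip x y

instance (X Y : PreCorr N) : CoeFun (PreCorr.Iso X Y) fun _ => X.carrier → Y.carrier :=
  ⟨fun f => f.toEquiv⟩

/-! ### Gram matrices of operators -/

theorem gram_of_operators {L : Type u} [NormedAddCommGroup L] [InnerProductSpace ℂ L]
    [CompleteSpace L] {ι : Type} [Fintype ι] (T : ι → H →L[ℂ] L)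
    (hT : ∀ i j, (T i).adjoint ∘L T j ∈ N.toStarSubalgebra) :
    ∃ C : ι → ι → Alg N, ∀ i j,
      (T i).adjoint ∘L T j = ((∑ k, star (C k i) * C k j : Alg N) : H →L[ℂ] H) := by
  classical
  let E := PiLp 2 fun _ : ι => H
  let p : ι → E →L[ℂ] H := fun k => PiLp.proj 2 (fun _ : ι => H) k
  let s : ι → H →L[ℂ] E := fun k => (p k).adjoint
  have hs : ∀ k h, s k h = WithLp.toLp 2 (Pi.single k h) := by
    intro k h
    refine ext_inner_right ℂ fun y => ?_
    rw [ContinuousLinearMap.adjoint_inner_left, PiLp.inner_apply]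
    rw [Finset.sum_eq_single k]
    · simp only [Pi.single_eq_same]
      rfl
    · intro j _ hj
      simp [hj]
    · simp
  have hps : ∀ i k h, p i (s k h) = if i = k then h else 0 := by
    intro i k h
    rw [hs]
    change (Pi.single k h : ι → H) i = _
    rw [Pi.single_apply]
  have hsum : ∀ x : E, ∑ k, s k (p k x) = x := by
    intro x
    refine ext_inner_left ℂ fun y => ?_
    rw [inner_sum, PiLp.inner_apply]
    refine Finset.sum_congr rfl fun k _ => ?_
    rw [ContinuousLinearMap.adjoint_inner_right]
    rfl
  let S : E →L[ℂ] L := ∑ i, T i ∘L p i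
  have hSs : ∀ i, S ∘L s i = T i := by
    intro i
    ext h
    simp [S, sum_apply, hps, apply_ite]
  have hG : 0 ≤ S.adjoint ∘L S := by
    rw [ContinuousLinearMap.nonneg_iff_isPositive]
    exact ContinuousLinearMap.isPositive_adjoint_comp_self S
  obtain ⟨c, hc, hcomm⟩ := exists_defect _ hG
  have hmem : ∀ k i, p k ∘L c ∘L s i ∈ N.toStarSubalgebra := by
    intro k i
    refine mem_of_commute N fun b hb => ?_
    let D : E →L[ℂ] E := ∑ k, s k ∘L b ∘L p k
    have hDs : ∀ i h, D (s i h) = s i (b h) := by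
      intro i h
      simp [D, sum_apply, hps, apply_ite]
    have hpD : ∀ i x, p i (D x) = b (p i x) := by
      intro i x
      simp [D, sum_apply, hps]
    have hSs' : ∀ i x, p i (S.adjoint x) = (T i).adjoint x := by
      intro i x
      rw [← hSs i, ContinuousLinearMap.adjoint_comp]
      simp [s]
    have hSx : ∀ x, S x = ∑ j, T j (p j x) := fun x => by simp [S, sum_apply]
    have hDG : D * (S.adjoint ∘L S) = (S.adjoint ∘L S) * D := by
      ext1 x
      rw [← hsum ((D * (S.adjoint ∘L S)) x), ← hsum (((S.adjoint ∘L S) * D) x)]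
      refine Finset.sum_congr rfl fun i _ => congrArg (s i) ?_
      simp only [mul_apply_eq_comp, ContinuousLinearMap.comp_apply, hpD, hSs', hSx, map_sum]
      refine Finset.sum_congr rfl fun j _ => ?_
      exact DFunLike.congr_fun (VonNeumannAlgebra.mem_commutant_iff.1 hb _ (hT i j)).symm (p j x)
    have h1 := hcomm D hDG
    ext h
    have h2 := congrArg (fun A : E →L[ℂ] E => p k (A (s i h))) h1
    simp only [mul_apply_eq_comp, hpD, hDs] at h2
    exact h2
  refine ⟨fun k i => ⟨_, hmem k i⟩, fun i j => ?_⟩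
  ext h
  refine ext_inner_left ℂ fun l => ?_
  have e1 : ((∑ k, star (⟨_, hmem k i⟩ : Alg N) * (⟨_, hmem k j⟩ : Alg N) : Alg N) : H →L[ℂ] H)
      = ∑ k, (p k ∘L c ∘L s i).adjoint ∘L (p k ∘L c ∘L s j) := by
    rw [AddSubmonoidClass.coe_finsetSum]
    rfl
  rw [e1, sum_apply, inner_sum]
  have e2 : ∀ k, ⟪l, ((p k ∘L c ∘L s i).adjoint ∘L (p k ∘L c ∘L s j)) h⟫_ℂ
      = ⟪p k (c (s i l)), p k (c (s j h))⟫_ℂ := fun k => by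
    rw [ContinuousLinearMap.comp_apply, ContinuousLinearMap.adjoint_inner_right]
    rfl
  have e3 : ∑ k, ⟪p k (c (s i l)), p k (c (s j h))⟫_ℂ = ⟪c (s i l), c (s j h)⟫_ℂ := by
    rw [PiLp.inner_apply]
    rfl
  rw [Finset.sum_congr rfl fun k _ => e2 k, e3, ← ContinuousLinearMap.adjoint_inner_right,
    ← ContinuousLinearMap.star_eq_adjoint, ← mul_apply_eq_comp, hc,
    ContinuousLinearMap.comp_apply, ContinuousLinearMap.comp_apply,
    ContinuousLinearMap.adjoint_inner_right, ContinuousLinearMap.adjoint_inner_right, ← hSs i,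
    ← hSs j]
  rfl

/-! ### The self-dual completion -/

/-- The kernel `(x, y) ↦ ⟨x, y⟩ ∈ N ⊆ B(H)`. -/
def indKernel (X : PreCorr N) : PosKernel X.carrier H where
  ker := LinearMap.mk₂'ₛₗ (starRingEnd ℂ) (RingHom.id ℂ) (fun x y => (X.ip x y : H →L[ℂ] H))
    (fun x x' y => by simp) (fun c x y => by simp)
    (fun x y y' => by simp) (fun c x y => by simp)
  symm x y := congrArg Subtype.val (X.star_ip x y)
  pos {ι} _ x k := by
    obtain ⟨κ, _, C, hC⟩ := X.gram x
    have h1 : ∀ i j, ⟪k i, (X.ip (x i) (x j) : H →L[ℂ] H) (k j)⟫_ℂ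
        = ∑ n, ⟪(C n i : H →L[ℂ] H) (k i), (C n j : H →L[ℂ] H) (k j)⟫_ℂ := by
      intro i j
      rw [hC i j, AddSubmonoidClass.coe_finsetSum, sum_apply, inner_sum]
      refine Finset.sum_congr rfl fun n _ => ?_
      rw [← ContinuousLinearMap.adjoint_inner_right]
      rfl
    have h2 : (∑ i, ∑ j, ⟪k i, (X.ip (x i) (x j) : H →L[ℂ] H) (k j)⟫_ℂ)
        = ∑ n, ⟪∑ i, (C n i : H →L[ℂ] H) (k i), ∑ i, (C n i : H →L[ℂ] H) (k i)⟫_ℂ := by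
      simp only [h1, sum_inner, inner_sum]
      rw [Finset.sum_congr rfl fun i _ => Finset.sum_comm, Finset.sum_comm]
      exact Finset.sum_congr rfl fun n _ => Finset.sum_comm
    simp only [LinearMap.mk₂'ₛₗ_apply]
    rw [h2, Complex.re_sum]
    exact Finset.sum_nonneg fun n _ => inner_self_nonneg (𝕜 := ℂ)

@[simp] theorem indKernel_ker (X : PreCorr N) (x y : X.carrier) :
    (indKernel X).ker x y = (X.ip x y : H →L[ℂ] H) := rfl

theorem indKernel_left (X : PreCorr N) (a : Alg N) (v w : X.carrier) :
    (indKernel X).ker (X.lact a v) w = (indKernel X).ker v (X.lact (star a) w) :=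
  congrArg Subtype.val (X.ip_lact v w a)

/-- The Hilbert space `X ⊗_N H`. -/
abbrev Ind (X : PreCorr N) : Type u := (indKernel X).Space

/-- The left action of `N` on `X ⊗_N H`. -/
def indRep (X : PreCorr N) : Alg N →⋆ₐ[ℂ] (Ind X →L[ℂ] Ind X) :=
  leftRep N (indKernel X) X.lact (indKernel_left X)

theorem indRep_tmul (X : PreCorr N) (a : Alg N) (x : X.carrier) (h : H) :
    indRep X a ((indKernel X).tmul x h) = (indKernel X).tmul (X.lact a x) h :=
  leftRep_tmul _ _ _ (indKernel_left X) _ _ _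

theorem norm_ind_tmul_le (X : PreCorr N) (x : X.carrier) (h : H) :
    ‖(indKernel X).tmul x h‖ ≤ X.nrm x * ‖h‖ := by
  have h0 : 0 ≤ X.nrm x * ‖h‖ := mul_nonneg (Real.sqrt_nonneg _) (norm_nonneg _)
  refine (abs_le_of_sq_le_sq' ?_ h0).2
  rw [mul_pow, PreCorr.nrm, Real.sq_sqrt (norm_nonneg _)]
  have h1 := (indKernel X).norm_toSpace_sq (x ⊗ₜ h)
  rw [PosKernel.form_tmul, indKernel_ker] at h1
  refine h1.trans_le ?_
  calc (⟪h, (X.ip x x : H →L[ℂ] H) h⟫_ℂ).re ≤ ‖⟪h, (X.ip x x : H →L[ℂ] H) h⟫_ℂ‖ :=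
        Complex.re_le_norm _
    _ ≤ ‖h‖ * ‖(X.ip x x : H →L[ℂ] H) h‖ := norm_inner_le_norm _ _
    _ ≤ ‖h‖ * (‖(X.ip x x : H →L[ℂ] H)‖ * ‖h‖) := by
        gcongr
        exact ContinuousLinearMap.le_opNorm _ _
    _ = ‖(X.ip x x : H →L[ℂ] H)‖ * ‖h‖ ^ 2 := by ring

/-- The operator `h ↦ x ⊗ h` from `H` to `X ⊗_N H`. -/
def creation (X : PreCorr N) : X.carrier →ₗ[ℂ] (H →L[ℂ] Ind X) where
  toFun x := LinearMap.mkContinuous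
    { toFun := fun h => (indKernel X).tmul x h
      map_add' := (indKernel X).tmul_add x
      map_smul' := fun c h => (indKernel X).tmul_smul c x h } (X.nrm x) (norm_ind_tmul_le X x)
  map_add' x y := ContinuousLinearMap.ext fun h => (indKernel X).add_tmul x y h
  map_smul' c x := ContinuousLinearMap.ext fun h => (indKernel X).smul_tmul c x h

theorem creation_apply (X : PreCorr N) (x : X.carrier) (h : H) :
    creation X x h = (indKernel X).tmul x h := rfl

theorem creation_adjoint_comp (X : PreCorr N) (x y : X.carrier) :
    (creation X x).adjoint ∘L creation X y = (X.ip x y : H →L[ℂ] H) := by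
  ext h
  refine ext_inner_left ℂ fun l => ?_
  rw [ContinuousLinearMap.comp_apply, ContinuousLinearMap.adjoint_inner_right, creation_apply,
    creation_apply, PosKernel.inner_tmul, indKernel_ker]

theorem indRep_comp_creation (X : PreCorr N) (a : Alg N) (x : X.carrier) :
    indRep X a ∘L creation X x = creation X (X.lact a x) :=
  ContinuousLinearMap.ext fun h => indRep_tmul X a x h

theorem creation_comp (X : PreCorr N) (b : Alg N) (x : X.carrier) :
    creation X x ∘L (b : H →L[ℂ] H) = creation X (X.ract (op b) x) := by
  have key : ∀ y z : X.carrier, ∀ h, creation X (X.ract (op b) y) h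
      = creation X y ((b : H →L[ℂ] H) h) := by
    intro y z h
    rw [creation_apply, creation_apply, ← sub_eq_zero, ← norm_eq_zero (E := Ind X), ← sq_eq_zero_iff,
      ← Complex.ofReal_eq_zero, Complex.ofReal_pow]
    have := inner_self_eq_norm_sq_to_K (𝕜 := ℂ)
      ((indKernel X).tmul (X.ract (op b) y) h - (indKernel X).tmul y ((b : H →L[ℂ] H) h))
    refine this.symm.trans ?_
    have h3 : ∀ w, X.ip (X.ract (op b) y) w = star b * X.ip y w := by
      intro w
      rw [← X.star_ip, X.ip_ract, star_mul, X.star_ip]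
    simp only [inner_sub_left, inner_sub_right, PosKernel.inner_tmul, indKernel_ker, X.ip_ract, h3]
    have e1 : ∀ (a c : Alg N) (h : H), ((a * c : Alg N) : H →L[ℂ] H) h
        = (a : H →L[ℂ] H) ((c : H →L[ℂ] H) h) := fun _ _ _ => rfl
    have e2 : ∀ (h k : H), ⟪h, ((star b : Alg N) : H →L[ℂ] H) k⟫_ℂ = ⟪(b : H →L[ℂ] H) h, k⟫_ℂ :=
      fun h k => ContinuousLinearMap.adjoint_inner_right _ _ _
    simp only [e1, e2]
    ring
  exact ContinuousLinearMap.ext fun h => (key x x h).symm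

/-- The operators `h ↦ x ⊗ h`, `x ∈ X`. -/
def creationRange (X : PreCorr N) : Submodule ℂ (H →L[ℂ] Ind X) := LinearMap.range (creation X)

theorem completion_mem (X : PreCorr N) {S T : H →L[ℂ] Ind X}
    (hS : S ∈ sigmaClosure (creationRange X)) (hT : T ∈ sigmaClosure (creationRange X)) :
    S.adjoint ∘L T ∈ N.toStarSubalgebra := by
  refine adjoint_comp_mem N _ ?_ hS hT
  rintro _ ⟨x, rfl⟩ _ ⟨y, rfl⟩
  rw [creation_adjoint_comp]
  exact (X.ip x y).2

theorem completion_left (X : PreCorr N) (a : Alg N) {T : H →L[ℂ] Ind X}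
    (hT : T ∈ sigmaClosure (creationRange X)) :
    indRep X a ∘L T ∈ sigmaClosure (creationRange X) := by
  refine sigmaClosure_mem_of (ContinuousLinearMap.id ℂ H) (indRep X a) _ _ ?_ hT
  rintro _ ⟨x, rfl⟩
  exact ⟨X.lact a x, (indRep_comp_creation X a x).symm⟩

theorem completion_right (X : PreCorr N) (b : Alg N) {T : H →L[ℂ] Ind X}
    (hT : T ∈ sigmaClosure (creationRange X)) :
    T ∘L (b : H →L[ℂ] H) ∈ sigmaClosure (creationRange X) := by
  refine sigmaClosure_mem_of (b : H →L[ℂ] H) (ContinuousLinearMap.id ℂ (Ind X)) _ _ ?_ hT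
  rintro _ ⟨x, rfl⟩
  exact ⟨X.ract (op b) x, (creation_comp X b x).symm⟩

/-- The left action `a T = (a ⊗ I) T` on the completion. -/
def completionLact (X : PreCorr N) :
    Alg N →ₐ[ℂ] Module.End ℂ (sigmaClosure (creationRange X)) where
  toFun a :=
    { toFun := fun T => ⟨indRep X a ∘L T.1, completion_left X a T.2⟩
      map_add' := fun S T => Subtype.ext (ContinuousLinearMap.comp_add _ _ _)
      map_smul' := fun c T => Subtype.ext (ContinuousLinearMap.comp_smul _ _ _) }
  map_one' := LinearMap.ext fun T => Subtype.ext (by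
    change indRep X 1 ∘L T.1 = T.1
    rw [map_one]
    rfl)
  map_mul' a b := LinearMap.ext fun T => Subtype.ext (by
    change indRep X (a * b) ∘L T.1 = indRep X a ∘L (indRep X b ∘L T.1)
    rw [map_mul]
    rfl)
  map_zero' := LinearMap.ext fun T => Subtype.ext (by
    change indRep X 0 ∘L T.1 = 0
    rw [map_zero, ContinuousLinearMap.zero_comp])
  map_add' a b := LinearMap.ext fun T => Subtype.ext (by
    change indRep X (a + b) ∘L T.1 = indRep X a ∘L T.1 + indRep X b ∘L T.1
    rw [map_add, ContinuousLinearMap.add_comp])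
  commutes' c := LinearMap.ext fun T => Subtype.ext (by
    change indRep X (algebraMap ℂ (Alg N) c) ∘L T.1 = c • T.1
    rw [Algebra.algebraMap_eq_smul_one, map_smul, map_one, ContinuousLinearMap.smul_comp]
    rfl)

/-- The right action `T b` on the completion. -/
def completionRact (X : PreCorr N) :
    (Alg N)ᵐᵒᵖ →ₐ[ℂ] Module.End ℂ (sigmaClosure (creationRange X)) where
  toFun b :=
    { toFun := fun T => ⟨T.1 ∘L (unop b : Alg N), completion_right X (unop b) T.2⟩
      map_add' := fun S T => Subtype.ext (ContinuousLinearMap.add_comp _ _ _)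
      map_smul' := fun c T => Subtype.ext (ContinuousLinearMap.smul_comp _ _ _) }
  map_one' := rfl
  map_mul' a b := rfl
  map_zero' := LinearMap.ext fun T => Subtype.ext (ContinuousLinearMap.comp_zero _)
  map_add' a b := LinearMap.ext fun T => Subtype.ext (ContinuousLinearMap.comp_add _ _ _)
  commutes' c := LinearMap.ext fun T => Subtype.ext (ContinuousLinearMap.ext fun h =>
    map_smul T.1 c h)

/-- The inner product `⟨S, T⟩ = S* T`, for a space of operators with all `S* T` in `N`. -/
def operatorIp {L : Type u} [NormedAddCommGroup L] [InnerProductSpace ℂ L] [CompleteSpace L]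
    (N : VonNeumannAlgebra H) (Z : Submodule ℂ (H →L[ℂ] L))
    (hZ : ∀ S ∈ Z, ∀ T ∈ Z, S.adjoint ∘L T ∈ N.toStarSubalgebra) : Z →ₗ⋆[ℂ] Z →ₗ[ℂ] Alg N :=
  LinearMap.mk₂'ₛₗ (starRingEnd ℂ) (RingHom.id ℂ)
    (fun S T => ⟨S.1.adjoint ∘L T.1, hZ S S.2 T T.2⟩)
    (fun S S' T => by ext h; simp)
    (fun c S T => Subtype.ext (by
      change (c • S.1).adjoint ∘L T.1 = starRingEnd ℂ c • (S.1.adjoint ∘L T.1)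
      rw [map_smulₛₗ, ContinuousLinearMap.smul_comp]))
    (fun S T T' => by ext h; simp) (fun c S T => by ext h; simp)

theorem coe_operatorIp {L : Type u} [NormedAddCommGroup L] [InnerProductSpace ℂ L]
    [CompleteSpace L] (N : VonNeumannAlgebra H) (Z : Submodule ℂ (H →L[ℂ] L))
    (hZ : ∀ S ∈ Z, ∀ T ∈ Z, S.adjoint ∘L T ∈ N.toStarSubalgebra) (S T : Z) :
    (operatorIp N Z hZ S T : H →L[ℂ] H) = S.1.adjoint ∘L T.1 := rfl

theorem star_operatorIp {L : Type u} [NormedAddCommGroup L] [InnerProductSpace ℂ L]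
    [CompleteSpace L] (N : VonNeumannAlgebra H) (Z : Submodule ℂ (H →L[ℂ] L))
    (hZ : ∀ S ∈ Z, ∀ T ∈ Z, S.adjoint ∘L T ∈ N.toStarSubalgebra) (S T : Z) :
    star (operatorIp N Z hZ S T) = operatorIp N Z hZ T S := Subtype.ext (by
  change (S.1.adjoint ∘L T.1).adjoint = T.1.adjoint ∘L S.1
  rw [ContinuousLinearMap.adjoint_comp, ContinuousLinearMap.adjoint_adjoint])

theorem gram_operatorIp {L : Type u} [NormedAddCommGroup L] [InnerProductSpace ℂ L]
    [CompleteSpace L] (N : VonNeumannAlgebra H) (Z : Submodule ℂ (H →L[ℂ] L))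
    (hZ : ∀ S ∈ Z, ∀ T ∈ Z, S.adjoint ∘L T ∈ N.toStarSubalgebra) {ι : Type} [Fintype ι]
    (T : ι → Z) : ∃ (κ : Type) (_ : Fintype κ) (C : κ → ι → Alg N),
      ∀ i j, operatorIp N Z hZ (T i) (T j) = ∑ k, star (C k i) * C k j := by
  obtain ⟨C, hC⟩ := gram_of_operators (N := N) (fun i => (T i).1)
    (fun i j => hZ _ (T i).2 _ (T j).2)
  exact ⟨ι, inferInstance, C, fun i j => Subtype.ext (hC i j)⟩

/-- The inner product `⟨S, T⟩ = S* T` on the completion. -/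
def completionIp (X : PreCorr N) :
    sigmaClosure (creationRange X) →ₗ⋆[ℂ] sigmaClosure (creationRange X) →ₗ[ℂ] Alg N :=
  operatorIp N _ fun _ hS _ hT => completion_mem X hS hT

theorem completionIp_ract (X : PreCorr N) (S T : sigmaClosure (creationRange X)) (b : Alg N) :
    completionIp X S (completionRact X (op b) T) = completionIp X S T * b := Subtype.ext (by
  change S.1.adjoint ∘L (T.1 ∘L (b : H →L[ℂ] H)) = (S.1.adjoint ∘L T.1) ∘L (b : H →L[ℂ] H)
  rw [ContinuousLinearMap.comp_assoc])

theorem completionIp_lact (X : PreCorr N) (S T : sigmaClosure (creationRange X)) (a : Alg N) :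
    completionIp X (completionLact X a S) T = completionIp X S (completionLact X (star a) T) :=
  Subtype.ext (by
    change (indRep X a ∘L S.1).adjoint ∘L T.1 = S.1.adjoint ∘L (indRep X (star a) ∘L T.1)
    rw [ContinuousLinearMap.adjoint_comp, map_star, ContinuousLinearMap.star_eq_adjoint,
      ContinuousLinearMap.comp_assoc])

/-- The self-dual (`W*`-)completion of `X`: the `σ`-weak closure of the image of `X` in
`B(H, X ⊗_N H)` under `x ↦ (h ↦ x ⊗ h)`, with left action `a T = (a ⊗ I) T`, right action
`T b` and inner product `⟨S, T⟩ = S* T`. -/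
def completion (X : PreCorr N) : PreCorr N where
  carrier := sigmaClosure (creationRange X)
  lact := completionLact X
  ract := completionRact X
  lact_ract a b T := Subtype.ext (ContinuousLinearMap.ext fun h => by rfl)
  ip := completionIp X
  star_ip := star_operatorIp N _ _
  ip_ract := completionIp_ract X
  ip_lact := completionIp_lact X
  gram := gram_operatorIp N _ _

/-- The canonical map of `X` to its completion. -/
def toCompletion (X : PreCorr N) : X.carrier →ₗ[ℂ] (completion X).carrier where
  toFun x := ⟨creation X x, le_sigmaClosure _ ⟨x, rfl⟩⟩
  map_add' x y := Subtype.ext (map_add _ x y)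
  map_smul' c x := Subtype.ext (map_smul _ c x)

/-! ### Tensor products and the identity correspondence -/

/-- The `N`-valued form `⟨x ⊗ y, x' ⊗ y'⟩ = ⟨y, ⟨x, x'⟩ y'⟩` on `X ⊗ Y`. -/
def tensorIp (X Y : PreCorr N) :
    X.carrier ⊗[ℂ] Y.carrier →ₗ⋆[ℂ] X.carrier ⊗[ℂ] Y.carrier →ₗ[ℂ] Alg N :=
  TensorProduct.lift (LinearMap.mk₂'ₛₗ (starRingEnd ℂ) (starRingEnd ℂ)
    (fun x y => TensorProduct.lift (LinearMap.mk₂ ℂ (fun x' y' => Y.ip y (Y.lact (X.ip x x') y'))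
      (fun w w' l => by simp) (fun c w l => by simp)
      (fun w l l' => by simp) (fun c w l => by simp)))
    (fun v v' k => by ext; simp) (fun c v k => by ext; simp)
    (fun v k k' => by ext; simp) (fun c v k => by ext; simp))

@[simp] theorem tensorIp_tmul (X Y : PreCorr N) (x x' : X.carrier) (y y' : Y.carrier) :
    tensorIp X Y (x ⊗ₜ y) (x' ⊗ₜ y') = Y.ip y (Y.lact (X.ip x x') y') := rfl

theorem tensorIp_gram (X Y : PreCorr N) {ι : Type} [Fintype ι]
    (z : ι → X.carrier ⊗[ℂ] Y.carrier) : ∃ (κ : Type) (_ : Fintype κ)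
    (C : κ → ι → Alg N), ∀ i j, tensorIp X Y (z i) (z j) = ∑ k, star (C k i) * C k j := by
  classical
  choose n x y hz using fun i => PosKernel.exists_fin (z i)
  obtain ⟨κ, _, C, hC⟩ := X.gram (fun a : Σ i, Fin (n i) => x a.1 a.2)
  choose κ' hκ' D hD using fun k : κ =>
    Y.gram (fun a : Σ i, Fin (n i) => Y.lact (C k a) (y a.1 a.2))
  refine ⟨Σ k, κ' k, inferInstance, fun m i => ∑ a, D m.1 m.2 ⟨i, a⟩, fun i j => ?_⟩
  have h1 : ∀ (a : Fin (n i)) (b : Fin (n j)),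
      tensorIp X Y (x i a ⊗ₜ y i a) (x j b ⊗ₜ y j b)
        = ∑ k, ∑ m, star (D k m ⟨i, a⟩) * D k m ⟨j, b⟩ := by
    intro a b
    have e := hC ⟨i, a⟩ ⟨j, b⟩
    simp only at e
    rw [tensorIp_tmul, e, map_sum, LinearMap.sum_apply, map_sum]
    refine Finset.sum_congr rfl fun k _ => ?_
    rw [← hD k ⟨i, a⟩ ⟨j, b⟩, Y.ip_lact, map_mul]
    rfl
  rw [hz i, hz j, Fintype.sum_sigma]
  simp only [map_sum, LinearMap.sum_apply, h1, star_sum, Finset.sum_mul, Finset.mul_sum]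
  have h2 : ∀ (f : Fin (n i) → Fin (n j) → ∀ k, κ' k → Alg N),
      ∑ b, ∑ a, ∑ k, ∑ m, f a b k m = ∑ k, ∑ m, ∑ a, ∑ b, f a b k m := fun f => by
    rw [Finset.sum_congr rfl fun b _ => Finset.sum_comm, Finset.sum_comm]
    refine Finset.sum_congr rfl fun k _ => ?_
    rw [Finset.sum_congr rfl fun b _ => Finset.sum_comm, Finset.sum_comm]
    exact Finset.sum_congr rfl fun m _ => Finset.sum_comm
  refine (h2 _).trans ?_
  exact Finset.sum_congr rfl fun k _ => Finset.sum_congr rfl fun m _ => Finset.sum_comm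

theorem tensorIp_induction (X Y : PreCorr N) {p : X.carrier ⊗[ℂ] Y.carrier →
    X.carrier ⊗[ℂ] Y.carrier → Prop} (h0 : ∀ z, p 0 z) (h0' : ∀ z, p z 0)
    (hadd : ∀ z z' w, p z w → p z' w → p (z + z') w)
    (hadd' : ∀ z w w', p z w → p z w' → p z (w + w'))
    (ht : ∀ x y x' y', p (x ⊗ₜ y) (x' ⊗ₜ y')) (z w : X.carrier ⊗[ℂ] Y.carrier) : p z w := by
  induction z using TensorProduct.induction_on with
  | zero => exact h0 _
  | add z z' hz hz' => exact hadd _ _ _ hz hz'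
  | tmul x y =>
    induction w using TensorProduct.induction_on with
    | zero => exact h0' _
    | add w w' hw hw' => exact hadd' _ _ _ hw hw'
    | tmul x' y' => exact ht _ _ _ _

/-- The algebraic tensor product `X ⊗ Y`, with `a (x ⊗ y) = (a x) ⊗ y`, `(x ⊗ y) b = x ⊗ (y b)`
and `⟨x ⊗ y, x' ⊗ y'⟩ = ⟨y, ⟨x, x'⟩ y'⟩`. The vectors `x a ⊗ y - x ⊗ a y` have length zero. -/
def algTensor (X Y : PreCorr N) : PreCorr N where
  carrier := X.carrier ⊗[ℂ] Y.carrier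
  lact := (Module.End.rTensorAlgHom ℂ _ _).comp X.lact
  ract := (Module.End.lTensorAlgHom ℂ _ _).comp Y.ract
  lact_ract a b z := by
    induction z using TensorProduct.induction_on with
    | zero => simp
    | add z z' hz hz' => simp only [map_add, hz, hz']
    | tmul x y => rfl
  ip := tensorIp X Y
  star_ip z w := by
    refine tensorIp_induction X Y (p := fun z w => star (tensorIp X Y z w) = tensorIp X Y w z)
      (by simp) (by simp) (fun z z' w h h' => by simp [h, h']) (fun z w w' h h' => by simp [h, h'])
      (fun x y x' y' => ?_) z w
    rw [tensorIp_tmul, tensorIp_tmul, Y.star_ip, Y.ip_lact, X.star_ip]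
  ip_ract z w b := by
    refine tensorIp_induction X Y (p := fun z w => tensorIp X Y z
        ((Module.End.lTensorAlgHom ℂ _ _).comp Y.ract (op b) w) = tensorIp X Y z w * b)
      (by simp) (by simp)
      (fun z z' w h h' => by
        rw [map_add, LinearMap.add_apply, LinearMap.add_apply, h, h', add_mul])
      (fun z w w' h h' => by rw [map_add, map_add, map_add, h, h', add_mul])
      (fun x y x' y' => ?_) z w
    change Y.ip y (Y.lact (X.ip x x') (Y.ract (op b) y')) = _
    rw [Y.lact_ract, Y.ip_ract, tensorIp_tmul]
  ip_lact z w a := by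
    refine tensorIp_induction X Y (p := fun z w => tensorIp X Y
        ((Module.End.rTensorAlgHom ℂ _ _).comp X.lact a z) w = tensorIp X Y z
        ((Module.End.rTensorAlgHom ℂ _ _).comp X.lact (star a) w))
      (by simp) (by simp)
      (fun z z' w h h' => by
        rw [map_add, map_add, map_add, LinearMap.add_apply, LinearMap.add_apply, h, h'])
      (fun z w w' h h' => by rw [map_add, map_add, map_add, h, h'])
      (fun x y x' y' => ?_) z w
    change Y.ip y (Y.lact (X.ip (X.lact a x) x') y') = Y.ip y (Y.lact (X.ip x (X.lact _ x')) y')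
    rw [X.ip_lact]
  gram z := tensorIp_gram X Y z

/-- The tensor product `X ⊗_N Y` of correspondences over `N`, as a `W*`-correspondence: the
self-dual completion of the algebraic tensor product. -/
def tensor (X Y : PreCorr N) : PreCorr N := completion (algTensor X Y)

/-- The element `x ⊗ y` of `X ⊗_N Y`. -/
def tmul {X Y : PreCorr N} (x : X.carrier) (y : Y.carrier) : (tensor X Y).carrier :=
  toCompletion (algTensor X Y) (x ⊗ₜ[ℂ] y)

/-- `N` as a correspondence over itself, with `⟨a, b⟩ = a* b`. -/
def idCorr (N : VonNeumannAlgebra H) : PreCorr N where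
  carrier := Alg N
  lact := Algebra.lmul ℂ (Alg N)
  ract :=
    { toFun := fun b => LinearMap.mulRight ℂ (unop b)
      map_one' := LinearMap.ext fun x => mul_one x
      map_mul' := fun a b => LinearMap.ext fun x => (mul_assoc x _ _).symm
      map_zero' := LinearMap.ext fun x => mul_zero x
      map_add' := fun a b => LinearMap.ext fun x => mul_add x _ _
      commutes' := fun c => LinearMap.ext fun x => by
        change x * algebraMap ℂ (Alg N) c = c • x
        rw [← Algebra.commutes, Algebra.smul_def] }
  lact_ract a b x := (mul_assoc a x _).symm
  ip := LinearMap.mk₂'ₛₗ (starRingEnd ℂ) (RingHom.id ℂ) (fun a b => star a * b)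
    (fun a a' b => by rw [star_add, add_mul])
    (fun c a b => by rw [star_smul, smul_mul_assoc]; rfl)
    (fun a b b' => mul_add _ _ _) (fun c a b => mul_smul_comm _ _ _)
  star_ip a b := (star_mul _ _).trans (congrArg (star b * ·) (star_star a))
  ip_ract a b c := (mul_assoc _ _ _).symm
  ip_lact a b c := by
    change star (c * a) * b = star a * (star c * b)
    rw [star_mul, mul_assoc]
  gram x := ⟨Unit, inferInstance, fun _ i => x i, fun i j =>
    (Fintype.sum_unique (ι := Unit) fun _ => star (x i) * x j).symm⟩

/-- A discrete product system over `N`: `W*`-correspondences `E t` over `N`, `t ≥ 0`, with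
`E 0 = N` and `E (t + s) ≅ E t ⊗ E s`. -/
def IsDiscreteProductSystem (E : ℝ≥0 → PreCorr N) : Prop :=
  (∀ t, (E t).IsWStar) ∧ Nonempty (PreCorr.Iso (E 0) (idCorr N)) ∧
    ∀ t s, Nonempty (PreCorr.Iso (E (t + s)) (tensor (E t) (E s)))

end Correspondences

section Limits

variable {H : Type u} [NormedAddCommGroup H] [InnerProductSpace ℂ H] [CompleteSpace H]

open MulOpposite

/-- A directed system of (semi-inner product) correspondences over `N`: the transition maps are
bimodule maps preserving inner products. -/
structure CorrSystem (ι : Type) [Preorder ι] (N : VonNeumannAlgebra H) where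
  X : ι → PreCorr N
  f : ∀ i j, i ≤ j → (X i).carrier →ₗ[ℂ] (X j).carrier
  map_self : ∀ i x, f i i le_rfl x = x
  map_map : ∀ i j k (hij : i ≤ j) (hjk : j ≤ k) x, f j k hjk (f i j hij x) = f i k (hij.trans hjk) x
  map_lact : ∀ i j h a x, f i j h ((X i).lact a x) = (X j).lact a (f i j h x)
  map_ract : ∀ i j h b x, f i j h ((X i).ract b x) = (X j).ract b (f i j h x)
  map_ip : ∀ i j h x y, (X j).ip (f i j h x) (f i j h y) = (X i).ip x y

namespace CorrSystem

variable {N : VonNeumannAlgebra H} {ι : Type} [Preorder ι] [IsDirectedOrder ι]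
  [Nonempty ι] (S : CorrSystem ι N)

instance : DirectedSystem (fun i => (S.X i).carrier) (fun i j h => S.f i j h) where
  map_self i x := S.map_self i x
  map_map k j i hij hjk x := S.map_map _ _ _ hij hjk x

/-- The algebraic direct limit of a directed system. -/
abbrev Lim : Type u := DirectLimit (fun i => (S.X i).carrier) S.f

/-- The canonical map to the algebraic direct limit. -/
def of (i : ι) (x : (S.X i).carrier) : S.Lim := ⟦⟨i, x⟩⟧

theorem of_add (i : ι) (x y : (S.X i).carrier) : S.of i (x + y) = S.of i x + S.of i y :=
  (DirectLimit.add_def ..).symm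

theorem of_smul (i : ι) (c : ℂ) (x : (S.X i).carrier) : S.of i (c • x) = c • S.of i x :=
  (DirectLimit.smul_def ..).symm

theorem of_zero (i : ι) : S.of i 0 = 0 := (DirectLimit.zero_def i).symm

theorem of_f (i j : ι) (h : i ≤ j) (x : (S.X i).carrier) : S.of j (S.f i j h x) = S.of i x :=
  DirectLimit.mk_apply ..

theorem ind₁ {p : S.Lim → Prop} (h : ∀ i x, p (S.of i x)) (z : S.Lim) : p z :=
  DirectLimit.induction S.f h z

theorem ind₂ {p : S.Lim → S.Lim → Prop} (h : ∀ i x y, p (S.of i x) (S.of i y)) (z w : S.Lim) :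
    p z w :=
  DirectLimit.induction₂ S.f h z w

theorem ind₃ {p : S.Lim → S.Lim → S.Lim → Prop}
    (h : ∀ i x y z, p (S.of i x) (S.of i y) (S.of i z)) (x y z : S.Lim) : p x y z :=
  DirectLimit.induction₃ S.f h x y z

/-- The linear map of direct limits given by compatible linear maps. -/
def mapLim (g : ∀ i, (S.X i).carrier →ₗ[ℂ] (S.X i).carrier)
    (hg : ∀ i j h x, S.f i j h (g i x) = g j (S.f i j h x)) : S.Lim →ₗ[ℂ] S.Lim where
  toFun := DirectLimit.map S.f S.f (fun i x => g i x) hg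
  map_add' := S.ind₂ fun i x y => by
    rw [← of_add]
    change S.of i (g i (x + y)) = S.of i (g i x) + S.of i (g i y)
    rw [map_add, of_add]
  map_smul' c := S.ind₁ fun i x => by
    rw [← of_smul]
    change S.of i (g i (c • x)) = c • S.of i (g i x)
    rw [map_smul, of_smul]

theorem mapLim_of (g : ∀ i, (S.X i).carrier →ₗ[ℂ] (S.X i).carrier)
    (hg : ∀ i j h x, S.f i j h (g i x) = g j (S.f i j h x)) (i : ι) (x : (S.X i).carrier) :
    S.mapLim g hg (S.of i x) = S.of i (g i x) := rfl

/-- The action of an algebra on the direct limit. -/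
def mapLimHom {A : Type u} [Ring A] [Algebra ℂ A]
    (g : ∀ i, A →ₐ[ℂ] Module.End ℂ (S.X i).carrier)
    (hg : ∀ i j h a x, S.f i j h (g i a x) = g j a (S.f i j h x)) :
    A →ₐ[ℂ] Module.End ℂ S.Lim where
  toFun a := S.mapLim (fun i => g i a) fun i j h x => hg i j h a x
  map_one' := LinearMap.ext <| S.ind₁ fun i x => by
    rw [mapLim_of, map_one]
    rfl
  map_mul' a b := LinearMap.ext <| S.ind₁ fun i x => by
    rw [mapLim_of, map_mul]
    rfl
  map_zero' := LinearMap.ext <| S.ind₁ fun i x => by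
    rw [mapLim_of, map_zero]
    exact S.of_zero i
  map_add' a b := LinearMap.ext <| S.ind₁ fun i x => by
    rw [mapLim_of, map_add]
    exact S.of_add i _ _
  commutes' c := LinearMap.ext <| S.ind₁ fun i x => by
    rw [mapLim_of, AlgHom.commutes]
    exact S.of_smul i c x

theorem mapLimHom_of {A : Type u} [Ring A] [Algebra ℂ A]
    (g : ∀ i, A →ₐ[ℂ] Module.End ℂ (S.X i).carrier)
    (hg : ∀ i j h a x, S.f i j h (g i a x) = g j a (S.f i j h x)) (a : A) (i : ι)
    (x : (S.X i).carrier) : S.mapLimHom g hg a (S.of i x) = S.of i (g i a x) := rfl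

/-- The inner product of the direct limit, as a function. -/
def ipFun (z w : S.Lim) : Alg N :=
  DirectLimit.lift₂ S.f S.f (fun i x y => (S.X i).ip x y)
    (fun i j h x y => (S.map_ip i j h x y).symm) z w

theorem ipFun_of (i : ι) (x y : (S.X i).carrier) :
    S.ipFun (S.of i x) (S.of i y) = (S.X i).ip x y :=
  DirectLimit.lift₂_def ..

/-- The inner product of the direct limit. -/
def limIp : S.Lim →ₗ⋆[ℂ] S.Lim →ₗ[ℂ] Alg N :=
  LinearMap.mk₂'ₛₗ (starRingEnd ℂ) (RingHom.id ℂ) S.ipFun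
    (S.ind₃ fun i x y z => by simp only [← of_add, ipFun_of, map_add, LinearMap.add_apply])
    (fun c => S.ind₂ fun i x y => by
      simp only [← of_smul, ipFun_of, map_smulₛₗ, LinearMap.smul_apply])
    (S.ind₃ fun i x y z => by simp only [← of_add, ipFun_of, map_add])
    (fun c => S.ind₂ fun i x y => by simp only [← of_smul, ipFun_of, map_smulₛₗ])

theorem limIp_of (i : ι) (x y : (S.X i).carrier) :
    S.limIp (S.of i x) (S.of i y) = (S.X i).ip x y := S.ipFun_of i x y

theorem exists_level {κ : Type} [Finite κ] (z : κ → S.Lim) :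
    ∃ (i : ι) (x : κ → (S.X i).carrier), ∀ k, z k = S.of i (x k) := by
  choose i x hx using fun k => DirectLimit.exists_eq_mk S.f (z k)
  obtain ⟨j, hj⟩ := Finite.exists_le i
  exact ⟨j, fun k => S.f _ _ (hj k) (x k), fun k => (hx k).trans (S.of_f _ _ (hj k) (x k)).symm⟩

/-- The algebraic direct limit of a directed system of correspondences. -/
def lim : PreCorr N where
  carrier := S.Lim
  lact := S.mapLimHom (fun i => (S.X i).lact) S.map_lact
  ract := S.mapLimHom (fun i => (S.X i).ract) S.map_ract
  lact_ract a b := S.ind₁ fun i x => by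
    simp only [mapLimHom_of, (S.X i).lact_ract]
  ip := S.limIp
  star_ip := S.ind₂ fun i x y => by simp only [limIp_of, (S.X i).star_ip]
  ip_ract z w b := by
    revert z w
    exact S.ind₂ fun i x y => by simp only [mapLimHom_of, limIp_of, (S.X i).ip_ract]
  ip_lact z w a := by
    revert z w
    exact S.ind₂ fun i x y => by simp only [mapLimHom_of, limIp_of, (S.X i).ip_lact]
  gram z := by
    obtain ⟨i, x, hx⟩ := S.exists_level z
    obtain ⟨κ, hκ, C, hC⟩ := (S.X i).gram x
    exact ⟨κ, hκ, C, fun k l => by rw [hx, hx, limIp_of, hC]⟩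

end CorrSystem

end Limits

section ProductSystem

variable {H : Type u} [NormedAddCommGroup H] [InnerProductSpace ℂ H] [CompleteSpace H]
  {M : VonNeumannAlgebra H} (Φ : CPSemigroup M)

open MulOpposite

theorem amp_nil (R : Alg M.commutant) : amp Φ R [] = ofCommutant R := by rw [amp]

theorem amp_cons (R : Alg M.commutant) (d : ℝ≥0) (l : List ℝ≥0) :
    amp Φ R (d :: l) = stineMap (Φ.P d) (amp Φ R l) := by rw [amp]

theorem stineMap_add (P : NCPMap M) {A B : VNRep M} (X Y : VNRep.Hom A B) :
    stineMap P (X + Y) = stineMap P X + stineMap P Y :=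
  stine_hom_ext fun T k => by
    change _ = (stineMap P X).1 _ + (stineMap P Y).1 _
    rw [stineMap_tmul, stineMap_tmul, stineMap_tmul, ← PosKernel.tmul_add]
    rfl

theorem stineMap_smul (P : NCPMap M) {A B : VNRep M} (c : ℂ) (X : VNRep.Hom A B) :
    stineMap P (c • X) = c • stineMap P X :=
  stine_hom_ext fun T k => by
    change _ = c • (stineMap P X).1 _
    rw [stineMap_tmul, stineMap_tmul, ← PosKernel.tmul_smul]
    rfl

theorem stineMap_adj (P : NCPMap M) {A B : VNRep M} (X : VNRep.Hom A B) :
    stineMap P (VNRep.Hom.adj X) = VNRep.Hom.adj (stineMap P X) := by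
  refine Subtype.ext ?_
  change _ = (stineMap P X).1.adjoint
  rw [ContinuousLinearMap.eq_adjoint_iff]
  intro x y
  refine (stineKernel P B).denseRange_toSpace.induction_on
    (p := fun x => ⟪(stineMap P (VNRep.Hom.adj X)).1 x, y⟫_ℂ = ⟪x, (stineMap P X).1 y⟫_ℂ) x
    (isClosed_eq (by fun_prop) (by fun_prop)) fun x => ?_
  refine (stineKernel P A).denseRange_toSpace.induction_on
    (p := fun y => ⟪(stineMap P (VNRep.Hom.adj X)).1 ((stineKernel P B).toSpace x), y⟫_ℂ
      = ⟪(stineKernel P B).toSpace x, (stineMap P X).1 y⟫_ℂ) y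
    (isClosed_eq (by fun_prop) (by fun_prop)) fun y => ?_
  induction x using TensorProduct.induction_on with
  | zero => simp
  | add x x' hx hx' => simp only [map_add, inner_add_left, hx, hx']
  | tmul T k =>
    induction y using TensorProduct.induction_on with
    | zero => simp
    | add y y' hy hy' => simp only [map_add, inner_add_right, hy, hy']
    | tmul S l =>
      change ⟪(stineMap P (VNRep.Hom.adj X)).1 ((stineKernel P B).tmul T k),
        (stineKernel P A).tmul S l⟫_ℂ = ⟪(stineKernel P B).tmul T k,
          (stineMap P X).1 ((stineKernel P A).tmul S l)⟫_ℂ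
      rw [stineMap_tmul, stineMap_tmul, PosKernel.inner_tmul, PosKernel.inner_tmul,
        stineKernel_ker, stineKernel_ker, ← VNRep.Hom.apply X]
      exact ContinuousLinearMap.adjoint_inner_left _ _ _

theorem amp_one (l : List ℝ≥0) : amp Φ 1 l = VNRep.Hom.id _ := by
  induction l with
  | nil => rw [amp_nil]; rfl
  | cons d l ih => rw [amp_cons, ih, stineMap_id]

theorem amp_mul (R R' : Alg M.commutant) (l : List ℝ≥0) :
    amp Φ (R * R') l = VNRep.Hom.comp (amp Φ R l) (amp Φ R' l) := by
  induction l with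
  | nil => rw [amp_nil]; rfl
  | cons d l ih => rw [amp_cons, ih, stineMap_comp, amp_cons, amp_cons]

theorem amp_add (R R' : Alg M.commutant) (l : List ℝ≥0) :
    amp Φ (R + R') l = amp Φ R l + amp Φ R' l := by
  induction l with
  | nil => rw [amp_nil]; rfl
  | cons d l ih => rw [amp_cons, ih, stineMap_add, amp_cons, amp_cons]

theorem amp_smul (c : ℂ) (R : Alg M.commutant) (l : List ℝ≥0) :
    amp Φ (c • R) l = c • amp Φ R l := by
  induction l with
  | nil => rw [amp_nil]; rfl
  | cons d l ih => rw [amp_cons, ih, stineMap_smul, amp_cons]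

theorem amp_star (R : Alg M.commutant) (l : List ℝ≥0) :
    amp Φ (star R) l = VNRep.Hom.adj (amp Φ R l) := by
  induction l with
  | nil => rw [amp_nil]; rfl
  | cons d l ih => rw [amp_cons, ih, stineMap_adj, amp_cons]

theorem ins_amp {l l' : List ℝ≥0} (h : Refines l l') (R : Alg M.commutant) :
    VNRep.Hom.comp (ins Φ l l') (amp Φ R l) = VNRep.Hom.comp (amp Φ R l') (ins Φ l l') := by
  induction h with
  | nil => rw [ins_nil]; rfl
  | keep d h ih => rw [ins_keep, amp_cons, amp_cons, ← stineMap_comp, ih, stineMap_comp]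
  | @cut d e f m m' hd hf h ih =>
    rw [ins_cut Φ _ _ f hd hf, amp_cons, amp_cons, comp_assoc, cutMap_natural, ← comp_assoc,
      ← stineMap_comp, ← amp_cons, ih, stineMap_comp, comp_assoc]

/-- `X* Y ∈ M'` for `X, Y ∈ L_M(H, A)`. -/
theorem adjoint_comp_mem_commutant {A : VNRep M} {X Y : H →L[ℂ] A.K}
    (hX : X ∈ VNRep.Hom (idRep M) A) (hY : Y ∈ VNRep.Hom (idRep M) A) :
    X.adjoint ∘L Y ∈ M.commutant.toStarSubalgebra := by
  refine VonNeumannAlgebra.mem_commutant_iff.2 fun T hT => ?_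
  exact ((VNRep.Hom.comp (VNRep.Hom.adj (⟨X, hX⟩ : VNRep.Hom (idRep M) A)) (⟨Y, hY⟩ : VNRep.Hom (idRep M) A)).2 ⟨T, hT⟩).symm

/-- The left action `R X = (I ⊗ R) X` of `M'` on `L_M(H, H_𝔭)`. -/
def lLact (l : List ℝ≥0) :
    Alg M.commutant →ₐ[ℂ] Module.End ℂ (VNRep.Hom (idRep M) (HPart Φ l)) where
  toFun R :=
    { toFun := fun X => VNRep.Hom.comp (amp Φ R l) X
      map_add' := fun X Y => Subtype.ext (ContinuousLinearMap.comp_add _ _ _)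
      map_smul' := fun c X => Subtype.ext (ContinuousLinearMap.comp_smul _ _ _) }
  map_one' := LinearMap.ext fun X => by
    change VNRep.Hom.comp (amp Φ 1 l) X = X
    rw [amp_one]
    rfl
  map_mul' R R' := LinearMap.ext fun X => by
    change VNRep.Hom.comp (amp Φ (R * R') l) X = _
    rw [amp_mul]
    rfl
  map_zero' := LinearMap.ext fun X => by
    change VNRep.Hom.comp (amp Φ 0 l) X = 0
    have h := amp_smul Φ 0 0 l
    rw [zero_smul, zero_smul] at h
    rw [h]
    exact Subtype.ext (ContinuousLinearMap.zero_comp _)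
  map_add' R R' := LinearMap.ext fun X => by
    change VNRep.Hom.comp (amp Φ (R + R') l) X = _
    rw [amp_add]
    exact Subtype.ext (ContinuousLinearMap.add_comp _ _ _)
  commutes' c := LinearMap.ext fun X => by
    change VNRep.Hom.comp (amp Φ (algebraMap ℂ _ c) l) X = c • X
    rw [Algebra.algebraMap_eq_smul_one, amp_smul, amp_one]
    rfl

/-- The right action `X R` of `M'` on `L_M(H, H_𝔭)`. -/
def lRact (l : List ℝ≥0) :
    (Alg M.commutant)ᵐᵒᵖ →ₐ[ℂ] Module.End ℂ (VNRep.Hom (idRep M) (HPart Φ l)) where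
  toFun R :=
    { toFun := fun X => VNRep.Hom.comp X (ofCommutant (unop R))
      map_add' := fun X Y => Subtype.ext (ContinuousLinearMap.add_comp _ _ _)
      map_smul' := fun c X => Subtype.ext (ContinuousLinearMap.smul_comp _ _ _) }
  map_one' := by ext X h; rfl
  map_mul' R R' := by ext X h; rfl
  map_zero' := LinearMap.ext fun X => Subtype.ext (ContinuousLinearMap.comp_zero _)
  map_add' R R' := LinearMap.ext fun X => Subtype.ext (ContinuousLinearMap.comp_add _ _ _)
  commutes' c := LinearMap.ext fun X => Subtype.ext (ContinuousLinearMap.ext fun h =>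
    map_smul X.1 c h)

/-- The `M'`-correspondence `L_M(H, H_𝔭)`: `R X = (I ⊗ R) X`, `(X R) h = X (R h)`,
`⟨X, Y⟩ = X* Y`. -/
def lCorr (l : List ℝ≥0) : PreCorr M.commutant where
  carrier := VNRep.Hom (idRep M) (HPart Φ l)
  lact := lLact Φ l
  ract := lRact Φ l
  lact_ract R R' X := rfl
  ip := operatorIp M.commutant _ fun _ hX _ hY => adjoint_comp_mem_commutant hX hY
  star_ip := star_operatorIp _ _ _
  ip_ract X Y R := Subtype.ext rfl
  ip_lact X Y R := Subtype.ext (by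
    change ((amp Φ R l).1 ∘L X.1).adjoint ∘L Y.1 = X.1.adjoint ∘L ((amp Φ (star R) l).1 ∘L Y.1)
    rw [amp_star, ContinuousLinearMap.adjoint_comp]
    rfl)
  gram := gram_operatorIp _ _ _

/-- The directed system of the `L_M(H, H_𝔭)`, `𝔭` a partition of `[0, t]`, with the maps
`X ↦ v₀ ∘ X`. -/
def lSystem (t : ℝ≥0) : CorrSystem (Part t) M.commutant where
  X p := lCorr Φ p.gaps
  f p q _ :=
    { toFun := fun X => VNRep.Hom.comp (ins Φ p.gaps q.gaps) X
      map_add' := fun X Y => Subtype.ext (ContinuousLinearMap.comp_add _ _ _)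
      map_smul' := fun c X => Subtype.ext (ContinuousLinearMap.comp_smul _ _ _) }
  map_self p X := by
    change VNRep.Hom.comp (ins Φ p.gaps p.gaps) X = X
    rw [ins_self]
    rfl
  map_map p q r h h' X :=
    congrArg (fun Z : VNRep.Hom (HPart Φ p.gaps) (HPart Φ r.gaps) =>
      VNRep.Hom.comp Z (show VNRep.Hom (idRep M) (HPart Φ p.gaps) from X)) (ins_comp Φ h h')
  map_lact p q h R X :=
    congrArg (fun Z : VNRep.Hom (HPart Φ p.gaps) (HPart Φ q.gaps) =>
      VNRep.Hom.comp Z (show VNRep.Hom (idRep M) (HPart Φ p.gaps) from X)) (ins_amp Φ h R)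
  map_ract p q h R X := rfl
  map_ip p q h X Y := Subtype.ext (by
    change ((ins Φ p.gaps q.gaps).1 ∘L X.1).adjoint ∘L ((ins Φ p.gaps q.gaps).1 ∘L Y.1)
      = X.1.adjoint ∘L Y.1
    have h1 : ((ins Φ p.gaps q.gaps).1 ∘L X.1).adjoint ∘L ((ins Φ p.gaps q.gaps).1 ∘L Y.1)
        = X.1.adjoint ∘L ((ins Φ p.gaps q.gaps).1.adjoint ∘L (ins Φ p.gaps q.gaps).1) ∘L Y.1 := by
      rw [ContinuousLinearMap.adjoint_comp]
      rfl
    rw [h1, ins_isometry Φ h]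
    rfl)

/-- The `W*`-correspondence `E(t)` over `M'`: the direct limit, as a `W*`-correspondence, of the
`L_M(H, H_𝔭)` over all partitions `𝔭` of `[0, t]`, that is, the self-dual completion of the
algebraic direct limit. -/
def E (t : ℝ≥0) : PreCorr M.commutant := completion (lSystem Φ t).lim

/-- The canonical map `L_M(H, H_𝔭) → E(t)`. -/
def toE {t : ℝ≥0} (p : Part t) (X : VNRep.Hom (idRep M) (HPart Φ p.gaps)) : (E Φ t).carrier :=
  toCompletion (lSystem Φ t).lim ((lSystem Φ t).of p X)

/-- The product `(I_s ⊗ X) Y : H → H_𝔭`, `𝔭 = 𝔭₂ ∨ (𝔭₁ + s)`, of `X ∈ L_M(H, H_𝔭₁)` and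
`Y ∈ L_M(H, H_𝔭₂)`; here `l₁` and `l₂` are the lists of gaps of `𝔭₁` and `𝔭₂`. -/
def juxt {l₁ l₂ : List ℝ≥0} (X : VNRep.Hom (idRep M) (HPart Φ l₁))
    (Y : VNRep.Hom (idRep M) (HPart Φ l₂)) : VNRep.Hom (idRep M) (HPart Φ (l₂ ++ l₁)) :=
  VNRep.Hom.comp (ampTail Φ X l₂) Y

end ProductSystem

end CPSemi

end

open CPSemi

/-!
The idea is to trade every correspondence `X` over `M'` for the Hilbert space `X ⊗ H`, with its
commuting actions of `M'` (on the left factor) and of `M` (on the right factor), and to work with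
bounded operators there.

*Completions.* The `W*`-completion of `X` is the space of all intertwiners `H → X ⊗ H` of the two
actions of `M` (`mem_sigmaClosure_creationRange_iff`, a density theorem: pass to `ℓ²`-multiples to
turn `σ`-weak into strong closures). Call `Y` *saturated* if `y ↦ (h ↦ y ⊗ h)` maps `Y` onto
the intertwiners. Completions, `M'` itself and the `L_M(H, H_𝔭)` are saturated, and a saturated `Y`
is the completion of `X` as soon as there is a bimodule map `X → Y` that preserves inner products
and whose range generates `Y`, i.e. the vectors `y ⊗ h`, `y` in the range, span `Y ⊗ H`
(`exists_completionIso`). So isomorphisms are obtained from maps on algebraic tensor products and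
algebraic limits, and two of them are equal when they agree on generators.

*Normality.* A representation of a von Neumann algebra is normal as soon as the ranges of its
intertwiners with the identity representation span (`VNRep.IsGenerated.continuous`). Conversely, a
normal vector state is dominated by that of a square-summable family, which shows that the
Stinespring representation of a normal completely positive map has this property. It passes to all
`H_𝔭`, to the actions of `M'` on `L_M(H, H_𝔭)`, to tensor products, limits and completions. It is
also what makes the tensors `d₁ ⊗ d₂` of generators generate a tensor product
(`PreCorr.Generates.algTensor`), so that completing a factor first does not matter.

*Self-duality.* A saturated correspondence is self-dual: for a bounded module map `φ : Y → M'` the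
assignment `∑ yᵢ ⊗ hᵢ ↦ ∑ φ(yᵢ) hᵢ` is bounded (`norm_sum_module_map_le`), and its adjoint is an
intertwiner `H → Y ⊗ H`, hence given by an element of `Y`.

*The product.* For intertwiners `X`, `X'` one has `(I ⊗ X)* (I ⊗ X') = I ⊗ X* X'`, so that
`X ⊗ Y ↦ (I ⊗ X) Y` preserves inner products; its range generates because the ranges of the
intertwiners span at every stage of `H_𝔭` (`exists_juxtIso`). It commutes with the maps
`v_{𝔭,𝔭'}`, and the concatenations of partitions of `[0, t]` and `[0, s]` are cofinal among the
partitions of `[0, t + s]` (`Part.exists_le_concat`). Hence the algebraic tensor product of the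
algebraic limits for `t` and `s` has both `E(t) ⊗ E(s)` and `E(t + s)` as its completion, which gives
`U_{t,s}` (`exists_productIso`). The unit laws and associativity hold on the generators
`ι_𝔭(X)`, where they come down to identities between operators.
-/

set_option linter.unusedSectionVars false

noncomputable section

namespace CPSemi

/-! ### Square-summable families of vectors -/

section Ell2

variable {ι κ : Type} {K L K' : Type u} [NormedAddCommGroup K] [InnerProductSpace ℂ K]
  [NormedAddCommGroup L] [InnerProductSpace ℂ L]
  [NormedAddCommGroup K'] [InnerProductSpace ℂ K']

/-- The Hilbert space of square-summable families of vectors of `K`. -/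
abbrev Ell2 (ι : Type) (K : Type u) [NormedAddCommGroup K] : Type u := lp (fun _ : ι => K) 2

theorem memℓp_two_iff {f : ι → K} : Memℓp f 2 ↔ Summable fun i => ‖f i‖ ^ 2 := by
  have := memℓp_gen_iff (p := 2) (f := f) (by simp)
  simpa using this

theorem Ell2.summable_sq (x : Ell2 ι K) : Summable fun i => ‖x i‖ ^ 2 :=
  memℓp_two_iff.1 (lp.memℓp x)

theorem Ell2.norm_sq (x : Ell2 ι K) : ‖x‖ ^ 2 = ∑' i, ‖x i‖ ^ 2 := by
  have := lp.norm_rpow_eq_tsum (p := 2) (by simp) x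
  simpa using this

/-- The vector of `ℓ²(ι, K)` with given entries. -/
def Ell2.mk (f : ι → K) (hf : Summable fun i => ‖f i‖ ^ 2) : Ell2 ι K :=
  ⟨f, memℓp_two_iff.2 hf⟩

@[simp] theorem Ell2.mk_apply (f : ι → K) (hf : Summable fun i => ‖f i‖ ^ 2) (i : ι) :
    Ell2.mk f hf i = f i := rfl

theorem Ell2.ext {x y : Ell2 ι K} (h : ∀ i, x i = y i) : x = y := lp.ext (funext h)

/-- The diagonal operator `(xᵢ) ↦ (T xᵢ)` on `ℓ²`. -/
def Ell2.map (ι : Type) (T : K →L[ℂ] L) : Ell2 ι K →L[ℂ] Ell2 ι L :=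
  LinearMap.mkContinuous
    { toFun := fun x => Ell2.mk (fun i => T (x i)) (by
        refine Summable.of_nonneg_of_le (fun i => by positivity) (fun i => ?_)
          ((Ell2.summable_sq x).mul_left (‖T‖ ^ 2))
        rw [← mul_pow]
        gcongr
        exact T.le_opNorm _)
      map_add' := fun x y => Ell2.ext fun i => map_add T (x i) (y i)
      map_smul' := fun c x => Ell2.ext fun i => map_smul T c (x i) } ‖T‖ fun x => by
    refine (sq_le_sq₀ (norm_nonneg _) (by positivity)).1 ?_
    rw [mul_pow, Ell2.norm_sq, Ell2.norm_sq, ← tsum_mul_left]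
    refine Summable.tsum_le_tsum (fun i => ?_) (Ell2.summable_sq _)
      ((Ell2.summable_sq x).mul_left (‖T‖ ^ 2))
    rw [← mul_pow]
    gcongr
    exact T.le_opNorm _

@[simp] theorem Ell2.map_apply (T : K →L[ℂ] L) (x : Ell2 ι K) (i : ι) :
    Ell2.map ι T x i = T (x i) := rfl

theorem Ell2.inner_map [CompleteSpace K] [CompleteSpace L] (T : K →L[ℂ] L) (x : Ell2 ι K)
    (y : Ell2 ι L) : ⟪Ell2.map ι T x, y⟫_ℂ = ⟪x, Ell2.map ι T.adjoint y⟫_ℂ := by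
  rw [lp.inner_eq_tsum, lp.inner_eq_tsum]
  exact tsum_congr fun i => by simp [ContinuousLinearMap.adjoint_inner_right]

/-- The `i`-th coordinate of a vector of `ℓ²(ι, K)`. -/
def Ell2.proj (K : Type u) [NormedAddCommGroup K] [InnerProductSpace ℂ K] (i : ι) :
    Ell2 ι K →L[ℂ] K := lp.evalCLM ℂ (fun _ : ι => K) 2 i

@[simp] theorem Ell2.proj_apply (i : ι) (x : Ell2 ι K) : Ell2.proj K i x = x i := rfl

theorem Ell2.adjoint_proj_inner [CompleteSpace K] (i : ι) (k : K) (x : Ell2 ι K) :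
    ⟪(Ell2.proj K i).adjoint k, x⟫_ℂ = ⟪k, x i⟫_ℂ := by
  rw [ContinuousLinearMap.adjoint_inner_left, Ell2.proj_apply]

theorem Ell2.proj_adjoint_proj [CompleteSpace K] (i : ι) (k : K) :
    Ell2.proj K i ((Ell2.proj K i).adjoint k) = k := by
  classical
  have : (Ell2.proj K i).adjoint k = lp.single 2 i k := by
    refine ext_inner_right ℂ fun y => ?_
    rw [Ell2.adjoint_proj_inner, lp.inner_single_left]
  rw [this, Ell2.proj_apply, lp.single_apply_self]

/-- The restriction of a square-summable family along an injection of index sets. -/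
def Ell2.comap (K : Type u) [NormedAddCommGroup K] [InnerProductSpace ℂ K] (f : ι → κ)
    (hf : Function.Injective f) : Ell2 κ K →L[ℂ] Ell2 ι K :=
  LinearMap.mkContinuous
    { toFun := fun x => Ell2.mk (fun i => x (f i)) ((Ell2.summable_sq x).comp_injective hf)
      map_add' := fun _ _ => Ell2.ext fun _ => rfl
      map_smul' := fun _ _ => Ell2.ext fun _ => rfl } 1 fun x => by
    refine (sq_le_sq₀ (norm_nonneg _) (by positivity)).1 ?_
    rw [one_mul, Ell2.norm_sq, Ell2.norm_sq]
    exact ((Ell2.summable_sq x).comp_injective hf).tsum_le_tsum_of_inj f hf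
      (fun _ _ => by positivity) (fun _ => le_rfl) (Ell2.summable_sq x)

@[simp] theorem Ell2.comap_apply (f : ι → κ) (hf : Function.Injective f) (x : Ell2 κ K) (i : ι) :
    Ell2.comap K f hf x i = x (f i) := rfl

theorem Ell2.norm_comap_le (f : ι → κ) (hf : Function.Injective f) :
    ‖Ell2.comap K f hf‖ ≤ 1 :=
  LinearMap.mkContinuous_norm_le _ zero_le_one _

theorem pairing_eq_inner (ξ : Ell2 ℕ K) (η : Ell2 ℕ L) (T : K →L[ℂ] L) :
    pairing ξ η (Ell2.summable_sq ξ) (Ell2.summable_sq η) T = ⟪η, Ell2.map ℕ T ξ⟫_ℂ := by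
  rw [lp.inner_eq_tsum]
  rfl

end Ell2

/-! ### The `σ`-weak topology -/

section SigmaWeak

variable {K L : Type u} [NormedAddCommGroup K] [InnerProductSpace ℂ K]
  [NormedAddCommGroup L] [InnerProductSpace ℂ L]

/-- Finitely many square-summable pairs give the basic neighbourhoods of the `σ`-weak topology. -/
theorem exists_pairings_of_isOpen {o : Set (K →L[ℂ] L)} (ho : @IsOpen _ (sigmaWeak K L) o)
    {T : K →L[ℂ] L} (hT : T ∈ o) : ∃ (n : ℕ) (ξ : Fin n → Ell2 ℕ K) (η : Fin n → Ell2 ℕ L),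
      ∃ ε > 0, ∀ S, (∀ i, ‖⟪η i, Ell2.map ℕ (S - T) (ξ i)⟫_ℂ‖ < ε) → S ∈ o := by
  classical
  have hs : sigmaWeak K L = TopologicalSpace.induced
      (fun (T : K →L[ℂ] L) (p : {p : (ℕ → K) × (ℕ → L) //
        (Summable fun n => ‖p.1 n‖ ^ 2) ∧ (Summable fun n => ‖p.2 n‖ ^ 2)}) =>
          pairing p.1.1 p.1.2 p.2.1 p.2.2 T) Pi.topologicalSpace := by
    rw [Pi.topologicalSpace, induced_iInf]
    refine iInf_congr fun p => ?_
    rw [induced_compose]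
    rfl
  rw [hs] at ho
  obtain ⟨U, hU, rfl⟩ := ho
  obtain ⟨I, u, hu, hsub⟩ := isOpen_pi_iff.1 hU _ hT
  have hε : ∀ p ∈ I, ∃ ε > 0, Metric.ball (pairing p.1.1 p.1.2 p.2.1 p.2.2 T) ε ⊆ u p :=
    fun p hp => Metric.isOpen_iff.1 (hu p hp).1 _ (hu p hp).2
  choose! ε hε hball using hε
  obtain ⟨δ, hδ, hδε⟩ : ∃ δ > 0, ∀ p ∈ I, δ ≤ ε p := by
    rcases I.eq_empty_or_nonempty with rfl | hI
    · exact ⟨1, one_pos, by simp⟩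
    · obtain ⟨p, hp, hmin⟩ := I.exists_min_image ε hI
      exact ⟨ε p, hε p hp, hmin⟩
  refine ⟨I.card, fun i => Ell2.mk _ (I.equivFin.symm i).1.2.1,
    fun i => Ell2.mk _ (I.equivFin.symm i).1.2.2, δ, hδ, fun S hS => hsub fun p hp => ?_⟩
  refine hball p hp (Metric.ball_subset_ball (hδε p hp) ?_)
  obtain ⟨i, rfl⟩ : ∃ i, (I.equivFin.symm i).1 = p := ⟨I.equivFin ⟨p, hp⟩, by simp⟩
  have h1 := hS i
  rw [← pairing_eq_inner] at h1
  rw [mem_ball_iff_norm, ← map_sub]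
  exact h1

/-- The sum of finitely many sequences in `ℓ²(ℕ, K)`, as one square-summable family. -/
def Ell2.join {n : ℕ} (ξ : Fin n → Ell2 ℕ K) : Ell2 (Fin n × ℕ) K :=
  Ell2.mk (fun p => ξ p.1 p.2) (by
    rw [summable_prod_of_nonneg fun _ => by positivity]
    exact ⟨fun i => Ell2.summable_sq (ξ i), Summable.of_finite⟩)

theorem Ell2.norm_map_le_join {n : ℕ} (ξ : Fin n → Ell2 ℕ K) (i : Fin n) (T : K →L[ℂ] L) :
    ‖Ell2.map ℕ T (ξ i)‖ ≤ ‖Ell2.map _ T (Ell2.join ξ)‖ := by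
  have h : Ell2.map ℕ T (ξ i)
      = Ell2.comap L (fun m : ℕ => (i, m)) (Prod.mk_right_injective i)
        (Ell2.map _ T (Ell2.join ξ)) := Ell2.ext fun _ => rfl
  rw [h]
  exact (ContinuousLinearMap.le_opNorm _ _).trans
    (mul_le_of_le_one_left (norm_nonneg _) (Ell2.norm_comap_le _ _))

/-- A `σ`-weak neighbourhood of `T` contains the operators that are close to `T` in norm on one
square-summable family. The index type varies, as finitely many sequences are joined to one family. -/
theorem exists_strong_nhd_of_isOpen {o : Set (K →L[ℂ] L)} (ho : @IsOpen _ (sigmaWeak K L) o)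
    {T : K →L[ℂ] L} (hT : T ∈ o) : ∃ (ι : Type) (ζ : Ell2 ι K), ∃ ε > 0,
      ∀ S, ‖Ell2.map ι S ζ - Ell2.map ι T ζ‖ < ε → S ∈ o := by
  obtain ⟨n, ξ, η, ε, hε, h⟩ := exists_pairings_of_isOpen ho hT
  have hpos : 0 < 1 + ∑ i, ‖η i‖ := by positivity
  refine ⟨_, Ell2.join ξ, ε / (1 + ∑ i, ‖η i‖), by positivity, fun S hS => h S fun i => ?_⟩
  have e1 : Ell2.map _ S (Ell2.join ξ) - Ell2.map _ T (Ell2.join ξ)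
      = Ell2.map _ (S - T) (Ell2.join ξ) := Ell2.ext fun _ => rfl
  rw [e1, lt_div_iff₀ hpos] at hS
  calc ‖⟪η i, Ell2.map ℕ (S - T) (ξ i)⟫_ℂ‖ ≤ ‖η i‖ * ‖Ell2.map ℕ (S - T) (ξ i)‖ :=
        norm_inner_le_norm _ _
    _ ≤ (1 + ∑ i, ‖η i‖) * ‖Ell2.map _ (S - T) (Ell2.join ξ)‖ := by
        gcongr
        · have := Finset.single_le_sum (f := fun i => ‖η i‖) (fun i _ => norm_nonneg _)
            (Finset.mem_univ i)
          linarith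
        · exact Ell2.norm_map_le_join ξ i _
    _ < ε := by rwa [mul_comm]

/-- An operator lies in the `σ`-weak closure of a subspace as soon as every square-summable
family of vectors does, for the orbits of the subspace in norm. -/
theorem mem_sigmaClosure_of_forall_ell2 (S : Submodule ℂ (K →L[ℂ] L)) (T : K →L[ℂ] L)
    (h : ∀ (ι : Type) (ζ : Ell2 ι K),
      Ell2.map ι T ζ ∈ closure ((fun A : K →L[ℂ] L => Ell2.map ι A ζ) '' S)) :
    T ∈ sigmaClosure S := by
  rw [← SetLike.mem_coe, coe_sigmaClosure]
  refine (@mem_closure_iff _ (sigmaWeak K L) _ _).2 fun o ho hT => ?_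
  obtain ⟨ι, ζ, ε, hε, hs⟩ := exists_strong_nhd_of_isOpen ho hT
  obtain ⟨_, ⟨A, hA, rfl⟩, hd⟩ := Metric.mem_closure_iff.1 (h ι ζ) ε hε
  refine ⟨A, hs A ?_, hA⟩
  rwa [dist_comm, dist_eq_norm] at hd

end SigmaWeak

/-! ### Regularised square roots -/

section Regularise

variable {K L : Type u} [NormedAddCommGroup K] [InnerProductSpace ℂ K] [CompleteSpace K]
  [NormedAddCommGroup L] [InnerProductSpace ℂ L] [CompleteSpace L]

/-- A positive invertible operator has an invertible square root, which with its inverse commutes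
with all that commutes with the operator. -/
theorem exists_invertible_sqrt {a : K →L[ℂ] K} (ha : 0 ≤ a) (hu : IsUnit a) :
    ∃ c d : K →L[ℂ] K, c * d = 1 ∧ d * c = 1 ∧ d.adjoint = d ∧ d * d = a ∧
      ∀ b : K →L[ℂ] K, Commute b a → Commute b c ∧ Commute b d := by
  have hdd : CFC.sqrt a * CFC.sqrt a = a := CFC.sqrt_mul_sqrt_self a ha
  obtain ⟨u, hud⟩ : IsUnit (CFC.sqrt a) :=
    ((Commute.refl (CFC.sqrt a)).isUnit_mul_iff.1 (by rwa [hdd])).1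
  refine ⟨↑u⁻¹, u, u.inv_mul, u.mul_inv, ?_, by rw [hud, hdd], fun b hb => ?_⟩
  · rw [hud]
    exact (CFC.sqrt_nonneg a).isSelfAdjoint.star_eq
  · have h2 : Commute b u := by
      rw [hud]
      exact (hb.symm.cfcₙ_nnreal _).symm
    exact ⟨h2.units_inv_right, h2⟩

/-- For `ε > 0` the operator `d = (V* V + ε)^{1/2}` is invertible, with inverse `c`, and `V c` is
a contraction; it replaces the absolute value in the polar decomposition of `V`. -/
theorem exists_regularised_abs (V : K →L[ℂ] L) {ε : ℝ} (hε : 0 < ε) :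
    ∃ c d : K →L[ℂ] K, c * d = 1 ∧ (∀ x, ‖V (c x)‖ ≤ ‖x‖) ∧
      (∀ x, ‖d x‖ ^ 2 = ‖V x‖ ^ 2 + ε * ‖x‖ ^ 2) ∧
      ∀ b : K →L[ℂ] K, Commute b (V.adjoint ∘L V) → Commute b c ∧ Commute b d := by
  have hG0 : 0 ≤ V.adjoint ∘L V := by
    rw [ContinuousLinearMap.nonneg_iff_isPositive]
    exact ContinuousLinearMap.isPositive_adjoint_comp_self V
  have hs : IsStrictlyPositive (algebraMap ℝ (K →L[ℂ] K) ε) :=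
    (IsStrictlyPositive.iff_of_unital).2 ⟨algebraMap_nonneg _ hε.le,
      (isUnit_iff_ne_zero.2 hε.ne').map (algebraMap ℝ (K →L[ℂ] K))⟩
  have ha := IsStrictlyPositive.nonneg_add hG0 hs
  obtain ⟨c, d, hcd, hdc, hds, hdd, hcomm⟩ := exists_invertible_sqrt ha.nonneg ha.isUnit
  have hd : ∀ x, ‖d x‖ ^ 2 = ‖V x‖ ^ 2 + ε * ‖x‖ ^ 2 := by
    intro x
    have h0 : d (d x) = V.adjoint (V x) + (ε : ℂ) • x := by
      have := DFunLike.congr_fun hdd x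
      rw [Algebra.algebraMap_eq_smul_one] at this
      exact this
    have h1 : ⟪d x, d x⟫_ℂ = ⟪V x, V x⟫_ℂ + ε * ⟪x, x⟫_ℂ := by
      rw [← ContinuousLinearMap.adjoint_inner_right, hds, h0, inner_add_right, inner_smul_right,
        ContinuousLinearMap.adjoint_inner_right]
    have h2 := congrArg Complex.re h1
    rw [Complex.add_re, Complex.re_ofReal_mul] at h2
    have e : ∀ {E : Type u} [NormedAddCommGroup E] [InnerProductSpace ℂ E] (y : E),
        ‖y‖ ^ 2 = (⟪y, y⟫_ℂ).re := fun y => InnerProductSpace.norm_sq_eq_re_inner (𝕜 := ℂ) y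
    rw [e, e, e, h2]
  refine ⟨c, d, hcd, fun x => ?_, hd, fun b hb => hcomm b ?_⟩
  · have h1 : d (c x) = x := DFunLike.congr_fun hdc x
    have h2 := hd (c x)
    rw [h1] at h2
    refine (sq_le_sq₀ (norm_nonneg _) (norm_nonneg _)).1 ?_
    have : 0 ≤ ε * ‖c x‖ ^ 2 := by positivity
    linarith
  · exact hb.add_right (Algebra.commutes ε b).symm

end Regularise

section Induced

variable {V : Type u} [AddCommGroup V] [Module ℂ V]
  {K : Type u} [NormedAddCommGroup K] [InnerProductSpace ℂ K] [CompleteSpace K]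
  {L : Type u} [NormedAddCommGroup L] [InnerProductSpace ℂ L] [CompleteSpace L]

/-! ### Bounded operators out of a weighted tensor product -/

theorem norm_sq_eq_re_inner_self {L : Type u} [NormedAddCommGroup L] [InnerProductSpace ℂ L]
    (y : L) : ‖y‖ ^ 2 = (⟪y, y⟫_ℂ).re :=
  InnerProductSpace.norm_sq_eq_re_inner (𝕜 := ℂ) y

/-- The bounded operator on `V ⊗_κ K` extending a linear map on the algebraic tensor product. -/
def PosKernel.lift (κ : PosKernel V K) (f : V ⊗[ℂ] K →ₗ[ℂ] L) : κ.Space →L[ℂ] L :=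
  f.extendOfNorm κ.toSpace

theorem PosKernel.lift_toSpace (κ : PosKernel V K) (f : V ⊗[ℂ] K →ₗ[ℂ] L) (C : ℝ)
    (h : ∀ z, ‖f z‖ ≤ C * ‖κ.toSpace z‖) (z : V ⊗[ℂ] K) : κ.lift f (κ.toSpace z) = f z :=
  LinearMap.extendOfNorm_eq κ.denseRange_toSpace ⟨C, h⟩ z

/-- Vectors of `V ⊗_κ K` are separated by elementary tensors. -/
theorem PosKernel.eq_zero_of_inner_tmul (κ : PosKernel V K) {w : κ.Space}
    (h : ∀ v k, ⟪κ.tmul v k, w⟫_ℂ = 0) : w = 0 := by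
  have h1 : (innerSL ℂ w : κ.Space →L[ℂ] ℂ) = 0 := κ.hom_ext fun v k => by
    rw [innerSL_apply_apply, ← inner_conj_symm, h]
    simp
  have h2 := DFunLike.congr_fun h1 w
  rw [innerSL_apply_apply] at h2
  exact inner_self_eq_zero.1 h2

end Induced

section RightRep

variable {H : Type u} [NormedAddCommGroup H] [InnerProductSpace ℂ H] [CompleteSpace H]
  {M : VonNeumannAlgebra H}

open MulOpposite

theorem mul_comm_of_mem_commutant (T : Alg M) (R : Alg M.commutant) :
    (R : H →L[ℂ] H) * (T : H →L[ℂ] H) = (T : H →L[ℂ] H) * R :=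
  (VonNeumannAlgebra.mem_commutant_iff.1 R.2 _ T.2).symm

theorem mem_commutant_of_forall {c : H →L[ℂ] H} (h : ∀ T : Alg M, (T : H →L[ℂ] H) * c = c * T) :
    c ∈ M.commutant.toStarSubalgebra :=
  VonNeumannAlgebra.mem_commutant_iff.2 fun T hT => h ⟨T, hT⟩

/-- The bicommutant theorem: what commutes with the commutant lies in the algebra. -/
theorem mem_of_forall_commutant {c : H →L[ℂ] H}
    (h : ∀ R : Alg M.commutant, (R : H →L[ℂ] H) * c = c * R) : c ∈ M.toStarSubalgebra :=
  mem_of_commute M fun b hb => h ⟨b, hb⟩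

theorem indKernel_form_right (X : PreCorr M.commutant) (T : Alg M) (x y : X.carrier ⊗[ℂ] H) :
    (indKernel X).form ((T : H →L[ℂ] H).toLinearMap.lTensor _ x) y
      = (indKernel X).form x (((star T : Alg M) : H →L[ℂ] H).toLinearMap.lTensor _ y) := by
  induction x using TensorProduct.induction_on with
  | zero => simp
  | add x x' hx hx' => simp only [map_add, LinearMap.add_apply, hx, hx']
  | tmul v k =>
    induction y using TensorProduct.induction_on with
    | zero => simp
    | add y y' hy hy' => simp only [map_add, hy, hy']
    | tmul w k' =>
      simp only [LinearMap.lTensor_tmul, PosKernel.form_tmul, indKernel_ker,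
        ContinuousLinearMap.coe_coe]
      rw [← mul_apply_eq_comp, mul_comm_of_mem_commutant, mul_apply_eq_comp]
      exact (ContinuousLinearMap.adjoint_inner_right (T : H →L[ℂ] H) _ _).symm

theorem indKernel_form_right_le (X : PreCorr M.commutant) (T : Alg M) (x : X.carrier ⊗[ℂ] H) :
    ((indKernel X).form ((T : H →L[ℂ] H).toLinearMap.lTensor _ x)
      ((T : H →L[ℂ] H).toLinearMap.lTensor _ x)).re
      ≤ ‖(T : H →L[ℂ] H)‖ ^ 2 * ((indKernel X).form x x).re := by
  obtain ⟨c, hc⟩ := exists_defect_alg M T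
  have h1 : ∀ b : Alg M, (indKernel X).form ((b : H →L[ℂ] H).toLinearMap.lTensor _ x)
      ((b : H →L[ℂ] H).toLinearMap.lTensor _ x)
      = (indKernel X).form x ((((star b * b : Alg M)) : H →L[ℂ] H).toLinearMap.lTensor _ x) := by
    intro b
    have e : ((star b * b : Alg M) : H →L[ℂ] H).toLinearMap.lTensor X.carrier
        = ((star b : Alg M) : H →L[ℂ] H).toLinearMap.lTensor X.carrier
          ∘ₗ (b : H →L[ℂ] H).toLinearMap.lTensor X.carrier := by
      rw [← LinearMap.lTensor_comp]
      rfl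
    rw [indKernel_form_right, e]
    rfl
  have h2 : (indKernel X).form x ((((star T * T : Alg M)) : H →L[ℂ] H).toLinearMap.lTensor _ x)
      + (indKernel X).form x ((((star c * c : Alg M)) : H →L[ℂ] H).toLinearMap.lTensor _ x)
      = (‖(T : H →L[ℂ] H)‖ : ℂ) ^ 2 * (indKernel X).form x x := by
    have e : (((star T * T : Alg M)) : H →L[ℂ] H).toLinearMap
        + (((star c * c : Alg M)) : H →L[ℂ] H).toLinearMap
        = ((‖(T : H →L[ℂ] H)‖ : ℂ) ^ 2) • LinearMap.id := by
      have := congrArg (fun a : Alg M => (a : H →L[ℂ] H).toLinearMap) hc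
      rw [Algebra.algebraMap_eq_smul_one] at this
      exact this
    rw [← map_add, ← LinearMap.add_apply, ← LinearMap.lTensor_add, e, LinearMap.lTensor_smul,
      LinearMap.lTensor_id]
    simp
  rw [← h1, ← h1] at h2
  have h3 := congrArg Complex.re h2
  have h4 := (indKernel X).form_nonneg ((c : H →L[ℂ] H).toLinearMap.lTensor _ x)
  rw [← Complex.ofReal_pow, Complex.re_ofReal_mul, Complex.add_re] at h3
  linarith

/-- The operator `I ⊗ T` on `X ⊗ H`, for `T` in the commutant of the algebra acting on `X`. -/
def indRightOp (X : PreCorr M.commutant) (T : Alg M) : Ind X →L[ℂ] Ind X :=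
  (indKernel X).extend (indKernel X) ((T : H →L[ℂ] H).toLinearMap.lTensor _)
    ‖(T : H →L[ℂ] H)‖ (indKernel_form_right_le X T)

theorem indRightOp_tmul (X : PreCorr M.commutant) (T : Alg M) (x : X.carrier) (h : H) :
    indRightOp X T ((indKernel X).tmul x h) = (indKernel X).tmul x ((T : H →L[ℂ] H) h) :=
  (indKernel X).extend_toSpace _ _ _ (indKernel_form_right_le X T) _

/-- The representation `T (x ⊗ h) = x ⊗ T h` of `M` on `X ⊗_{M'} H`. -/
@[reducible] def rightInd (X : PreCorr M.commutant) : VNRep M where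
  K := Ind X
  π :=
    { toFun := indRightOp X
      map_one' := (indKernel X).hom_ext fun v k => by rw [indRightOp_tmul]; rfl
      map_mul' := fun a b => (indKernel X).hom_ext fun v k => by
        rw [indRightOp_tmul, mul_apply_eq_comp, indRightOp_tmul, indRightOp_tmul]; rfl
      map_zero' := (indKernel X).hom_ext fun v k => by
        rw [indRightOp_tmul]
        exact map_zero (creation X v)
      map_add' := fun a b => (indKernel X).hom_ext fun v k => by
        rw [indRightOp_tmul, add_apply, indRightOp_tmul, indRightOp_tmul, ← PosKernel.tmul_add]
        rfl
      commutes' := fun c => (indKernel X).hom_ext fun v k => by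
        rw [indRightOp_tmul, Algebra.algebraMap_eq_smul_one, Algebra.algebraMap_eq_smul_one]
        exact (indKernel X).tmul_smul c v k
      map_star' := fun T => by
        rw [ContinuousLinearMap.star_eq_adjoint, ContinuousLinearMap.eq_adjoint_iff]
        intro x y
        have hd := (indKernel X).denseRange_toSpace
        refine hd.induction_on₂ (p := fun x y => ⟪indRightOp X (star T) x, y⟫_ℂ
            = ⟪x, indRightOp X T y⟫_ℂ)
          (isClosed_eq (by fun_prop) (by fun_prop)) (fun x y => ?_) x y
        simp only [indRightOp, PosKernel.extend_toSpace, PosKernel.inner_toSpace]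
        rw [indKernel_form_right, star_star] }

theorem rightInd_tmul (X : PreCorr M.commutant) (T : Alg M) (x : X.carrier) (h : H) :
    (rightInd X).π T ((indKernel X).tmul x h) = (indKernel X).tmul x ((T : H →L[ℂ] H) h) :=
  indRightOp_tmul X T x h

/-- The representation `a (x ⊗ h) = a x ⊗ h` of `N` on `X ⊗_N H`. -/
@[reducible] def leftInd {N : VonNeumannAlgebra H} (X : PreCorr N) : VNRep N where
  K := Ind X
  π := indRep X

theorem creation_mem_hom (X : PreCorr M.commutant) (x : X.carrier) :
    creation X x ∈ VNRep.Hom (idRep M) (rightInd X) := fun T =>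
  ContinuousLinearMap.ext fun h => (rightInd_tmul X T x h).symm

/-! ### Isometries out of `X ⊗ H` -/

section Lift

variable {L : Type u} [NormedAddCommGroup L] [InnerProductSpace ℂ L] [CompleteSpace L]
  {N : VonNeumannAlgebra H}

/-- The operator `x ⊗ h ↦ e(x) h` on `X ⊗ H` given by a linear map `e : X → B(H, L)`. It is used for
maps `e` with `e(x)* e(y) = ⟨x, y⟩`, for which it is an isometry. -/
def indLift (X : PreCorr N) (e : X.carrier →ₗ[ℂ] (H →L[ℂ] L)) : Ind X →L[ℂ] L :=
  (indKernel X).lift (TensorProduct.lift (ContinuousLinearMap.coeLM ℂ ∘ₗ e))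

theorem inner_lift_of_adjoint_comp (X : PreCorr N) (e : X.carrier →ₗ[ℂ] (H →L[ℂ] L))
    (he : ∀ x y, (e x).adjoint ∘L e y = X.ip x y) (z w : X.carrier ⊗[ℂ] H) :
    ⟪TensorProduct.lift (ContinuousLinearMap.coeLM ℂ ∘ₗ e) z,
      TensorProduct.lift (ContinuousLinearMap.coeLM ℂ ∘ₗ e) w⟫_ℂ = (indKernel X).form z w := by
  induction z using TensorProduct.induction_on with
  | zero => simp
  | add x x' hx hx' => simp only [map_add, LinearMap.add_apply, inner_add_left, hx, hx']
  | tmul v k =>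
    induction w using TensorProduct.induction_on with
    | zero => simp
    | add y y' hy hy' => simp only [map_add, inner_add_right, hy, hy']
    | tmul w k' =>
      rw [PosKernel.form_tmul, indKernel_ker, ← he]
      exact (ContinuousLinearMap.adjoint_inner_right (e v) _ _).symm

variable {X : PreCorr N} {e : X.carrier →ₗ[ℂ] (H →L[ℂ] L)}

theorem indLift_toSpace (he : ∀ x y, (e x).adjoint ∘L e y = X.ip x y) (z : X.carrier ⊗[ℂ] H) :
    indLift X e ((indKernel X).toSpace z)
      = TensorProduct.lift (ContinuousLinearMap.coeLM ℂ ∘ₗ e) z := by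
  refine (indKernel X).lift_toSpace _ 1 (fun z => ?_) z
  refine (sq_le_sq₀ (norm_nonneg _) (by positivity)).1 (le_of_eq ?_)
  rw [one_mul, PosKernel.norm_toSpace_sq, norm_sq_eq_re_inner_self,
    inner_lift_of_adjoint_comp X e he]

theorem indLift_tmul (he : ∀ x y, (e x).adjoint ∘L e y = X.ip x y) (x : X.carrier) (h : H) :
    indLift X e ((indKernel X).tmul x h) = e x h :=
  indLift_toSpace he _

theorem indLift_comp_creation (he : ∀ x y, (e x).adjoint ∘L e y = X.ip x y) (x : X.carrier) :
    indLift X e ∘L creation X x = e x :=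
  ContinuousLinearMap.ext fun h => indLift_tmul he x h

theorem inner_indLift (he : ∀ x y, (e x).adjoint ∘L e y = X.ip x y) (z w : Ind X) :
    ⟪indLift X e z, indLift X e w⟫_ℂ = ⟪z, w⟫_ℂ := by
  refine (indKernel X).denseRange_toSpace.induction_on₂
    (p := fun z w => ⟪indLift X e z, indLift X e w⟫_ℂ = ⟪z, w⟫_ℂ)
    (isClosed_eq (by fun_prop) (by fun_prop)) (fun x y => ?_) z w
  rw [indLift_toSpace he, indLift_toSpace he, inner_lift_of_adjoint_comp X e he,
    PosKernel.inner_toSpace]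

theorem indLift_adjoint_apply (he : ∀ x y, (e x).adjoint ∘L e y = X.ip x y) (z : Ind X) :
    (indLift X e).adjoint (indLift X e z) = z :=
  ext_inner_right ℂ fun w => by
    rw [ContinuousLinearMap.adjoint_inner_left, inner_indLift he]

theorem indLift_injective (he : ∀ x y, (e x).adjoint ∘L e y = X.ip x y) :
    Function.Injective (indLift X e) :=
  Function.LeftInverse.injective (indLift_adjoint_apply he)

end Lift

section Spanning

variable {N : VonNeumannAlgebra H}

/-- A set `D` of vectors of `X` generates `X` as a self-dual module: the vectors `d ⊗ h`, `d ∈ D`,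
span a dense subspace of `X ⊗ H`. -/
def PreCorr.Generates (X : PreCorr N) (D : Set X.carrier) : Prop :=
  ∀ w : Ind X, (∀ d ∈ D, ∀ h, ⟪(indKernel X).tmul d h, w⟫_ℂ = 0) → w = 0

theorem PreCorr.generates_univ (X : PreCorr N) : X.Generates Set.univ := fun _ hw =>
  (indKernel X).eq_zero_of_inner_tmul fun x h => hw x trivial h

theorem PreCorr.Generates.mono {X : PreCorr N} {D D' : Set X.carrier} (h : X.Generates D)
    (hD : D ⊆ D') : X.Generates D' := fun w hw => h w fun d hd => hw d (hD hd)

/-- Maps that preserve inner products are determined by their values on a generating set. -/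
theorem eq_of_eqOn_generates {X Y : PreCorr N} {D : Set X.carrier} (hD : X.Generates D)
    (hY : ∀ y, Y.ip y y = 0 → y = 0) {f g : X.carrier →ₗ[ℂ] Y.carrier}
    (hf : ∀ x x', Y.ip (f x) (f x') = X.ip x x') (hg : ∀ x x', Y.ip (g x) (g x') = X.ip x x')
    (hfg : ∀ d ∈ D, f d = g d) (x : X.carrier) : f x = g x := by
  have hF : ∀ x y, ((creation Y ∘ₗ f) x).adjoint ∘L (creation Y ∘ₗ f) y = X.ip x y :=
    fun x y => by
      rw [← hf]
      exact creation_adjoint_comp Y _ _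
  have hG : ∀ x y, ((creation Y ∘ₗ g) x).adjoint ∘L (creation Y ∘ₗ g) y = X.ip x y :=
    fun x y => by
      rw [← hg]
      exact creation_adjoint_comp Y _ _
  have key : (indLift X (creation Y ∘ₗ f)).adjoint = (indLift X (creation Y ∘ₗ g)).adjoint := by
    refine ContinuousLinearMap.ext fun z => sub_eq_zero.1 (hD _ fun d hd h => ?_)
    rw [inner_sub_right, ContinuousLinearMap.adjoint_inner_right,
      ContinuousLinearMap.adjoint_inner_right, indLift_tmul hF, indLift_tmul hG,
      LinearMap.comp_apply, LinearMap.comp_apply, hfg d hd, sub_self]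
  have key2 : indLift X (creation Y ∘ₗ f) = indLift X (creation Y ∘ₗ g) := by
    rw [← ContinuousLinearMap.adjoint_adjoint (indLift X (creation Y ∘ₗ f)), key,
      ContinuousLinearMap.adjoint_adjoint]
  have h1 : creation Y (f x - g x) = 0 := by
    rw [map_sub, sub_eq_zero]
    have e1 := indLift_comp_creation hF x
    rw [key2, indLift_comp_creation hG x] at e1
    exact e1.symm
  refine sub_eq_zero.1 (hY _ (Subtype.ext ?_))
  rw [← creation_adjoint_comp, h1, ContinuousLinearMap.comp_zero]
  rfl

/-- A representation is generated by its intertwiners with the identity representation: the vectors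
`X h`, `X` an intertwiner, span a dense subspace. It implies normality, see
`VNRep.IsGenerated.continuous`. -/
def VNRep.IsGenerated (A : VNRep N) : Prop :=
  ∀ w : A.K, (∀ X ∈ VNRep.Hom (idRep N) A, ∀ h : H, ⟪X h, w⟫_ℂ = 0) → w = 0

/-- An intertwiner with dense range carries generatedness along. -/
theorem VNRep.IsGenerated.of_hom {A B : VNRep N} (hA : A.IsGenerated) (V : VNRep.Hom A B)
    (hV : Function.Injective V.1.adjoint) : B.IsGenerated := fun w hw => by
  refine hV ?_
  rw [map_zero]
  refine hA _ fun X hX h => ?_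
  rw [ContinuousLinearMap.adjoint_inner_right]
  exact hw _ (VNRep.Hom.comp V ⟨X, hX⟩).2 h

end Spanning

end RightRep

section Commutant

variable {H : Type u} [NormedAddCommGroup H] [InnerProductSpace ℂ H] [CompleteSpace H]
  {M : VonNeumannAlgebra H}

open MulOpposite

/-! ### The self-dual completion as a space of intertwiners -/

section Density

/-- The orbit of a square-summable family under all operators `h ↦ x ⊗ h` is dense in its orbit
under all intertwiners. -/
theorem map_mem_closure_creation (X : PreCorr M.commutant) {T : H →L[ℂ] Ind X}
    (hT : T ∈ VNRep.Hom (idRep M) (rightInd X)) (ι : Type) (ζ : Ell2 ι H) :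
    Ell2.map ι T ζ ∈
      closure ((fun A : H →L[ℂ] Ind X => Ell2.map ι A ζ) '' creationRange X) := by
  let orb : (H →L[ℂ] Ind X) →ₗ[ℂ] Ell2 ι (Ind X) :=
    { toFun := fun A => Ell2.map ι A ζ
      map_add' := fun A B => Ell2.ext fun i => rfl
      map_smul' := fun c A => Ell2.ext fun i => rfl }
  let P : Submodule ℂ (Ell2 ι (Ind X)) := ((creationRange X).map orb).topologicalClosure
  have hP : (P : Set (Ell2 ι (Ind X)))
      = closure ((fun A : H →L[ℂ] Ind X => Ell2.map ι A ζ) '' creationRange X) := by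
    rw [Submodule.topologicalClosure_coe, Submodule.map_coe]
    rfl
  have : CompleteSpace P :=
    (Submodule.isClosed_topologicalClosure _).completeSpace_coe
  have hmem : ∀ x, Ell2.map ι (creation X x) ζ ∈ P := fun x =>
    Submodule.le_topologicalClosure _ ⟨_, ⟨x, rfl⟩, rfl⟩
  rw [← hP]
  -- the intertwiners `creation x ∘ (creation x)*` preserve the closed orbit `P`
  have hinv : ∀ x, ∀ p ∈ P,
      Ell2.map ι (creation X x) (Ell2.map ι (creation X x).adjoint p) ∈ P := by
    intro x p hp
    refine map_mem_closure (s := ((creationRange X).map orb : Set _))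
      (t := ((creationRange X).map orb : Set _))
      (f := fun p => Ell2.map ι (creation X x) (Ell2.map ι (creation X x).adjoint p))
      ((Ell2.map ι (creation X x)).continuous.comp (Ell2.map ι (creation X x).adjoint).continuous)
      hp ?_
    rintro _ ⟨_, ⟨y, rfl⟩, rfl⟩
    refine ⟨_, ⟨X.ract (op (X.ip x y)) x, rfl⟩, ?_⟩
    rw [← creation_comp, ← creation_adjoint_comp]
    rfl
  -- `(creation x)* T` lies in `M'`, so that `creation x ∘ (creation x)* T` is again a creation
  have hTmem : ∀ x, Ell2.map ι (creation X x) (Ell2.map ι (creation X x).adjoint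
      (Ell2.map ι T ζ)) ∈ P := by
    intro x
    have hN := adjoint_comp_mem_commutant (creation_mem_hom X x) hT
    have h1 := hmem (X.ract (op ⟨_, hN⟩) x)
    rw [← creation_comp] at h1
    exact h1
  set η : Ell2 ι (Ind X) := Ell2.map ι T ζ - P.starProjection (Ell2.map ι T ζ) with hη
  have hperp : ∀ p ∈ P, ⟪p, η⟫_ℂ = 0 := fun p hp =>
    (Submodule.mem_orthogonal _ _).1 (P.sub_starProjection_mem_orthogonal _) p hp
  have hzero : ∀ x, Ell2.map ι (creation X x).adjoint η = 0 := by
    intro x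
    have h1 : Ell2.map ι (creation X x) (Ell2.map ι (creation X x).adjoint η) ∈ P := by
      rw [hη, map_sub, map_sub]
      exact P.sub_mem (hTmem x) (hinv x _ (P.starProjection_apply_mem _))
    have h2 := hperp _ h1
    rw [Ell2.inner_map] at h2
    exact inner_self_eq_zero.1 h2
  have hη0 : η = 0 := Ell2.ext fun i => (indKernel X).eq_zero_of_inner_tmul fun x h => by
    have h1 := congrArg (fun z : Ell2 ι H => z i) (hzero x)
    rw [← creation_apply, ← ContinuousLinearMap.adjoint_inner_right]
    exact (congrArg (fun z => ⟪h, z⟫_ℂ) h1).trans (inner_zero_right _)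
  rw [sub_eq_zero.1 hη0]
  exact P.starProjection_apply_mem _

/-- The `W*`-completion of `X` consists of all operators `H → X ⊗ H` that intertwine the actions of
the commutant. -/
theorem mem_sigmaClosure_creationRange_iff (X : PreCorr M.commutant) (T : H →L[ℂ] Ind X) :
    T ∈ sigmaClosure (creationRange X) ↔ T ∈ VNRep.Hom (idRep M) (rightInd X) := by
  constructor
  · intro hT m
    refine ContinuousLinearMap.ext fun k => ext_inner_left ℂ fun l => ?_
    have hc : @IsClosed _ (sigmaWeak H (Ind X)) {T : H →L[ℂ] Ind X |
        ⟪l, T ((m : H →L[ℂ] H) k)⟫_ℂ = ⟪((rightInd X).π m).adjoint l, T k⟫_ℂ} := by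
      let := sigmaWeak H (Ind X)
      exact isClosed_eq (continuous_vector _ _) (continuous_vector _ _)
    have hsub : (creationRange X : Set (H →L[ℂ] Ind X)) ⊆ {T : H →L[ℂ] Ind X |
        ⟪l, T ((m : H →L[ℂ] H) k)⟫_ℂ = ⟪((rightInd X).π m).adjoint l, T k⟫_ℂ} := by
      rintro _ ⟨x, rfl⟩
      simp only [Set.mem_ofPred_eq]
      rw [ContinuousLinearMap.adjoint_inner_left, creation_apply, creation_apply, rightInd_tmul]
    have hTm : T ∈ {T : H →L[ℂ] Ind X |
        ⟪l, T ((m : H →L[ℂ] H) k)⟫_ℂ = ⟪((rightInd X).π m).adjoint l, T k⟫_ℂ} := by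
      let := sigmaWeak H (Ind X)
      exact closure_minimal hsub hc hT
    simp only [Set.mem_ofPred_eq, ContinuousLinearMap.adjoint_inner_left] at hTm
    exact hTm
  · intro hT
    exact mem_sigmaClosure_of_forall_ell2 _ _ fun ι ζ => map_mem_closure_creation X hT ι ζ

end Density

/-! ### Normal representations -/

section Normal

variable {N : VonNeumannAlgebra H}

/-- The diagonal representation of `N` on `ℓ²(ι, A)`. -/
@[reducible] def VNRep.ell2 (ι : Type) (A : VNRep N) : VNRep N where
  K := Ell2 ι A.K
  π :=
    { toFun := fun T => Ell2.map ι (A.π T)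
      map_one' := by ext; simp
      map_mul' := fun S T => by ext; simp
      map_zero' := by ext; simp
      map_add' := fun S T => by ext; simp
      commutes' := fun c => by
        refine ContinuousLinearMap.ext fun x => Ell2.ext fun i => ?_
        rw [Ell2.map_apply, Algebra.algebraMap_eq_smul_one, map_smul, map_one,
          Algebra.algebraMap_eq_smul_one]
        rfl
      map_star' := fun T => by
        rw [map_star, ContinuousLinearMap.star_eq_adjoint, ContinuousLinearMap.star_eq_adjoint,
          ContinuousLinearMap.eq_adjoint_iff]
        intro x y
        rw [Ell2.inner_map, ContinuousLinearMap.adjoint_adjoint] }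

/-- The coordinate projections intertwine. -/
def VNRep.projHom {ι : Type} (A : VNRep N) (i : ι) : VNRep.Hom (VNRep.ell2 ι A) A :=
  ⟨Ell2.proj A.K i, fun _ => rfl⟩

theorem VNRep.isGenerated_ell2 {A : VNRep N} (hA : A.IsGenerated) (ι : Type) :
    (VNRep.ell2 ι A).IsGenerated := fun w hw => Ell2.ext fun i => hA _ fun X hX h => by
  have := hw _ (VNRep.Hom.comp (VNRep.Hom.adj (A.projHom i)) ⟨X, hX⟩).2 h
  rw [← Ell2.adjoint_proj_inner]
  exact this

/-- A vector obtained by an intertwiner from a multiple of the identity representation is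
orthogonal to nothing but what is orthogonal to all vectors `X h`. -/
theorem inner_hom_ell2_eq_zero {A : VNRep N} {ι : Type}
    (V : VNRep.Hom (VNRep.ell2 ι (idRep N)) A) (ζ : Ell2 ι H) {w : A.K}
    (hw : ∀ X ∈ VNRep.Hom (idRep N) A, ∀ h : H, ⟪X h, w⟫_ℂ = 0) : ⟪V.1 ζ, w⟫_ℂ = 0 := by
  have h0 : V.1.adjoint w = 0 := Ell2.ext fun i => ext_inner_left ℂ fun h => by
    have := hw _ (VNRep.Hom.comp V (VNRep.Hom.adj ((idRep N).projHom i))).2 h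
    rw [comp_apply, ← ContinuousLinearMap.adjoint_inner_right] at this
    refine (Ell2.adjoint_proj_inner i h _).symm.trans (this.trans ?_)
    exact (inner_zero_right _).symm
  rw [← ContinuousLinearMap.adjoint_inner_right, h0]
  exact inner_zero_right _

/-- The vectors obtained by an intertwiner from a countable multiple of the identity
representation. -/
def VNRep.normalVec (A : VNRep N) : Set A.K :=
  {w | ∃ V ∈ VNRep.Hom (VNRep.ell2 ℕ (idRep N)) A, ∃ ζ : Ell2 ℕ H, V ζ = w}

theorem VNRep.isClosed_hom (A B : VNRep N) : IsClosed (VNRep.Hom A B : Set (A.K →L[ℂ] B.K)) := by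
  have : (VNRep.Hom A B : Set (A.K →L[ℂ] B.K)) = ⋂ T, {X | X ∘L A.π T = B.π T ∘L X} := by
    ext X
    simp only [Set.mem_iInter]
    rfl
  rw [this]
  exact isClosed_iInter fun T => isClosed_eq
    ((ContinuousLinearMap.compL ℂ A.K A.K B.K).flip (A.π T)).continuous
    (ContinuousLinearMap.compL ℂ A.K B.K B.K (B.π T)).continuous

/-- The `k`-th row of a family indexed by `ℕ ≃ ℕ × ℕ`. -/
def Ell2.row (K : Type u) [NormedAddCommGroup K] [InnerProductSpace ℂ K] (k : ℕ) :
    Ell2 ℕ K →L[ℂ] Ell2 ℕ K :=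
  Ell2.comap K (Nat.pair k) fun _ _ h => (Nat.pair_eq_pair.1 h).2

theorem Ell2.norm_row_le {K : Type u} [NormedAddCommGroup K] [InnerProductSpace ℂ K] (k : ℕ) :
    ‖Ell2.row K k‖ ≤ 1 := by
  rw [Ell2.row]
  exact Ell2.norm_comap_le (K := K) (Nat.pair k) fun _ _ h => (Nat.pair_eq_pair.1 h).2

theorem Ell2.row_apply {K : Type u} [NormedAddCommGroup K] [InnerProductSpace ℂ K] (k : ℕ)
    (x : Ell2 ℕ K) (i : ℕ) : Ell2.row K k x i = x (Nat.pair k i) :=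
  Ell2.comap_apply (Nat.pair k) (fun _ _ h => (Nat.pair_eq_pair.1 h).2) x i

theorem Ell2.row_map {K L : Type u} [NormedAddCommGroup K] [InnerProductSpace ℂ K]
    [NormedAddCommGroup L] [InnerProductSpace ℂ L] (T : K →L[ℂ] L) (x : Ell2 ℕ K) (k : ℕ) :
    Ell2.row L k (Ell2.map ℕ T x) = Ell2.map ℕ T (Ell2.row K k x) := Ell2.ext fun i => by
  rw [Ell2.row_apply, Ell2.map_apply, Ell2.map_apply, Ell2.row_apply]

theorem Ell2.exists_row_eq {K : Type u} [NormedAddCommGroup K] [InnerProductSpace ℂ K]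
    (ζ : ℕ → Ell2 ℕ K) (hζ : Summable fun k => ‖ζ k‖ ^ 2) :
    ∃ z : Ell2 ℕ K, ∀ k, Ell2.row K k z = ζ k := by
  have hs : Summable fun n : ℕ => ‖ζ n.unpair.1 n.unpair.2‖ ^ 2 := by
    rw [← Nat.pairEquiv.summable_iff]
    have : ((fun n : ℕ => ‖ζ n.unpair.1 n.unpair.2‖ ^ 2) ∘ Nat.pairEquiv)
        = fun p : ℕ × ℕ => ‖ζ p.1 p.2‖ ^ 2 := by
      funext p
      change ‖ζ (Nat.pair p.1 p.2).unpair.1 (Nat.pair p.1 p.2).unpair.2‖ ^ 2 = _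
      rw [Nat.unpair_pair]
    rw [this, summable_prod_of_nonneg fun _ => by positivity]
    refine ⟨fun i => Ell2.summable_sq (ζ i), ?_⟩
    simpa only [← Ell2.norm_sq] using hζ
  refine ⟨Ell2.mk (fun n => ζ n.unpair.1 n.unpair.2) hs, fun k => Ell2.ext fun i => ?_⟩
  rw [Ell2.row_apply, Ell2.mk_apply, Nat.unpair_pair]

theorem summable_comp_of_norm_le_one {E L : Type u} [NormedAddCommGroup E]
    [InnerProductSpace ℂ E] [NormedAddCommGroup L] [InnerProductSpace ℂ L] [CompleteSpace L]
    (V : ℕ → (E →L[ℂ] L)) (R : ℕ → (E →L[ℂ] E)) (hR : ∀ k, ‖R k‖ ≤ 1)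
    (hVs : Summable fun k => ‖V k‖) : Summable fun k => V k ∘L R k := by
  refine Summable.of_norm (Summable.of_nonneg_of_le (fun k => norm_nonneg _) (fun k => ?_) hVs)
  exact (ContinuousLinearMap.opNorm_comp_le (V k) (R k)).trans
    (mul_le_of_le_one_right (norm_nonneg _) (hR k))

theorem hasSum_clm_apply {K L : Type u} [NormedAddCommGroup K] [InnerProductSpace ℂ K]
    [NormedAddCommGroup L] [InnerProductSpace ℂ L] {V : ℕ → (K →L[ℂ] L)} {W : K →L[ℂ] L}
    (h : HasSum V W) (z : K) : HasSum (fun k => V k z) (W z) :=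
  ContinuousLinearMap.hasSum (ContinuousLinearMap.apply ℂ L z) h

theorem VNRep.hom_of_hasSum {A B : VNRep N} {V : ℕ → (A.K →L[ℂ] B.K)} {W : A.K →L[ℂ] B.K}
    (hV : ∀ k, V k ∈ VNRep.Hom A B) (h : HasSum V W) : W ∈ VNRep.Hom A B :=
  (VNRep.isClosed_hom A B).mem_of_tendsto h
    (Filter.Eventually.of_forall fun _ => Submodule.sum_mem _ fun k _ => hV k)

theorem VNRep.exists_hom_of_hasSum {A B : VNRep N} (R : ℕ → (B.K →L[ℂ] B.K))
    (hR : ∀ k, R k ∈ VNRep.Hom B B) (hR1 : ∀ k, ‖R k‖ ≤ 1) (V : ℕ → (B.K →L[ℂ] A.K))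
    (hV : ∀ k, V k ∈ VNRep.Hom B A) (hVs : Summable fun k => ‖V k‖) (z : B.K) {w : A.K}
    (hw : HasSum (fun k => V k (R k z)) w) : ∃ W ∈ VNRep.Hom B A, W z = w := by
  obtain ⟨W, hW⟩ := summable_comp_of_norm_le_one V R hR1 hVs
  exact ⟨W, VNRep.hom_of_hasSum (fun k => (VNRep.Hom.comp ⟨V k, hV k⟩ ⟨R k, hR k⟩).2) hW,
    (hasSum_clm_apply hW z).unique hw⟩

theorem VNRep.row_mem_hom (B : VNRep N) (k : ℕ) :
    Ell2.row B.K k ∈ VNRep.Hom (VNRep.ell2 ℕ B) (VNRep.ell2 ℕ B) := fun T =>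
  ContinuousLinearMap.ext fun x => Ell2.row_map (B.π T) x k

/-- A sum of vectors `Vₖ ζₖ` lies in `normalVec`, if the norms of the `Vₖ` are summable and those of the
`ζₖ` are square-summable: the `ζₖ` are the rows of one family `z`, and the sum is `(∑ Vₖ Rₖ) z` with
`Rₖ` the operator that picks the `k`-th row. -/
theorem VNRep.tsum_mem_normalVec (A : VNRep N)
    (V : ℕ → ((VNRep.ell2 ℕ (idRep N)).K →L[ℂ] A.K))
    (hV : ∀ k, V k ∈ VNRep.Hom (VNRep.ell2 ℕ (idRep N)) A)
    (ζ : ℕ → Ell2 ℕ H) (hVs : Summable fun k => ‖V k‖) (hζ : Summable fun k => ‖ζ k‖ ^ 2) {w : A.K}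
    (hw : HasSum (fun k => V k (ζ k)) w) : w ∈ A.normalVec := by
  obtain ⟨z, hz⟩ := Ell2.exists_row_eq ζ hζ
  obtain ⟨W, hW, hWz⟩ := VNRep.exists_hom_of_hasSum (fun k => Ell2.row H k)
    (VNRep.row_mem_hom (idRep N)) (fun k => Ell2.norm_row_le k) V hV hVs z (w := w)
    (by simpa only [hz] using hw)
  exact ⟨W, hW, z, hWz⟩

/-- A vector `w` of `normalVec` of norm `< r` is `V ζ` with `‖V‖ ≤ 1` and `‖ζ‖ ≤ r`: replace a given
`V ζ` by `(V c) (d ζ)`, with `d = (V* V + ε)^{1/2}` and `c` its inverse. -/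
theorem VNRep.exists_contraction_of_mem_normalVec {A : VNRep N} {w : A.K} (hw : w ∈ A.normalVec)
    {r : ℝ} (hr : ‖w‖ < r) : ∃ V ∈ VNRep.Hom (VNRep.ell2 ℕ (idRep N)) A, ∃ ζ : Ell2 ℕ H,
      V ζ = w ∧ ‖V‖ ≤ 1 ∧ ‖ζ‖ ≤ r := by
  obtain ⟨V, hV, ζ, rfl⟩ := hw
  have hr0 : 0 < r := (norm_nonneg _).trans_lt hr
  have hpos : 0 < r ^ 2 - ‖V ζ‖ ^ 2 := by
    have := (sq_lt_sq₀ (norm_nonneg (V ζ)) hr0.le).2 hr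
    linarith
  have hε : 0 < (r ^ 2 - ‖V ζ‖ ^ 2) / (1 + ‖ζ‖ ^ 2) := by positivity
  obtain ⟨c, d, hcd, hVc, hd, hcomm⟩ := exists_regularised_abs V hε
  have hc : c ∈ VNRep.Hom (VNRep.ell2 ℕ (idRep N)) (VNRep.ell2 ℕ (idRep N)) := fun T =>
    (hcomm _ ((VNRep.Hom.comp (VNRep.Hom.adj ⟨V, hV⟩) (⟨V, hV⟩ :
      VNRep.Hom (VNRep.ell2 ℕ (idRep N)) A)).2 T).symm).1.symm
  refine ⟨V ∘L c, (VNRep.Hom.comp ⟨V, hV⟩ ⟨c, hc⟩).2, d ζ, ?_, ?_, ?_⟩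
  · exact congrArg V (DFunLike.congr_fun hcd ζ)
  · exact ContinuousLinearMap.opNorm_le_bound _ zero_le_one fun x => by
      rw [one_mul]
      exact hVc x
  · refine (sq_le_sq₀ (norm_nonneg _) hr0.le).1 ?_
    rw [hd]
    have h1 : (r ^ 2 - ‖V ζ‖ ^ 2) / (1 + ‖ζ‖ ^ 2) * ‖ζ‖ ^ 2 ≤ r ^ 2 - ‖V ζ‖ ^ 2 := by
      rw [div_mul_eq_mul_div, div_le_iff₀ (by positivity)]
      nlinarith [sq_nonneg ‖ζ‖]
    linarith

/-- The subspace of vectors of `normalVec`. -/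
def VNRep.normalSubmodule (A : VNRep N) : Submodule ℂ A.K where
  carrier := A.normalVec
  zero_mem' := ⟨0, Submodule.zero_mem _, 0, rfl⟩
  smul_mem' := by
    rintro c _ ⟨V, hV, ζ, rfl⟩
    exact ⟨V, hV, c • ζ, map_smul V c ζ⟩
  add_mem' := by
    rintro _ _ ⟨V, hV, ζ, rfl⟩ ⟨W, hW, ξ, rfl⟩
    refine A.tsum_mem_normalVec (fun k => if k = 0 then V else if k = 1 then W else 0)
      (fun k => ?_) (fun k => if k = 0 then ζ else if k = 1 then ξ else 0)
      (summable_of_ne_finset_zero (s := {0, 1}) fun k hk => ?_)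
      (summable_of_ne_finset_zero (s := {0, 1}) fun k hk => ?_) ?_
    · dsimp only
      split_ifs
      exacts [hV, hW, Submodule.zero_mem _]
    · simp only [Finset.mem_insert, Finset.mem_singleton, not_or] at hk
      rw [if_neg hk.1, if_neg hk.2]
      exact norm_zero (E := Ell2 ℕ H →L[ℂ] A.K)
    · simp only [Finset.mem_insert, Finset.mem_singleton, not_or] at hk
      simp [hk]
    · have := hasSum_sum_of_ne_finset_zero (L := SummationFilter.unconditional ℕ)
        (s := ({0, 1} : Finset ℕ))
        (f := fun k => (if k = 0 then V else if k = 1 then W else 0 : Ell2 ℕ H →L[ℂ] A.K)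
          (if k = 0 then ζ else if k = 1 then ξ else 0)) fun k hk => by
            simp only [Finset.mem_insert, Finset.mem_singleton, not_or] at hk
            simp [hk]
      simpa using this

/-- Every vector of a generated representation comes from a countable multiple of the identity
representation. A limit of such vectors is a rapidly convergent sum of them, and after
`exists_contraction_of_mem_normalVec` the intertwiners can be summed as well. -/
theorem VNRep.IsGenerated.mem_normalVec {A : VNRep N} (hA : A.IsGenerated) (w : A.K) :
    w ∈ A.normalVec := by
  have hd : w ∈ closure (A.normalSubmodule : Set A.K) := by
    have : A.normalSubmodule.topologicalClosure = ⊤ := by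
      rw [Submodule.topologicalClosure_eq_top_iff, Submodule.eq_bot_iff]
      intro w hw
      refine hA w fun X hX h => hw _ ⟨X ∘L Ell2.proj H 0,
        (VNRep.Hom.comp ⟨X, hX⟩ ((idRep N).projHom 0)).2, (Ell2.proj H 0).adjoint h, ?_⟩
      exact congrArg X (Ell2.proj_adjoint_proj 0 h)
    rw [← Submodule.topologicalClosure_coe, this]
    trivial
  obtain ⟨v, hv, hvs, -, hvb⟩ := controlled_sum_of_mem_closure
    (s := A.normalSubmodule.toAddSubgroup) hd (b := fun n => (1 / 4 : ℝ) ^ n)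
    (fun n => by positivity)
  have hr : ∀ n, ‖v n‖ < (‖v 0‖ + 1) * (1 / 4 : ℝ) ^ n := by
    intro n
    rcases Nat.eq_zero_or_pos n with rfl | hn
    · simp
    · refine (hvb n hn).trans_le (le_mul_of_one_le_left (by positivity) ?_)
      have := norm_nonneg (v 0)
      linarith
  -- `v n = V n (ζ n)` with `‖ζ n‖` of order `4⁻ⁿ`; a factor `2⁻ⁿ` of this is moved to `V n`, so that
  -- the intertwiners are summable in norm and the vectors still form a square-summable family
  choose V hV ζ hVζ hV1 hζ using fun n => VNRep.exists_contraction_of_mem_normalVec (hvs n) (hr n)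
  have hVs : Summable fun k => ‖((1 / 2 : ℂ) ^ k) • V k‖ := by
    refine Summable.of_nonneg_of_le (fun k => norm_nonneg _) (fun k => ?_)
      (summable_geometric_of_lt_one (r := 1 / 2) (by norm_num) (by norm_num))
    rw [norm_smul, norm_pow]
    have h2 : ‖(1 / 2 : ℂ)‖ = 1 / 2 := by norm_num
    rw [h2]
    exact mul_le_of_le_one_right (by positivity) (hV1 k)
  have hζs : Summable fun k => ‖((2 : ℂ) ^ k) • ζ k‖ ^ 2 := by
    refine Summable.of_nonneg_of_le (fun k => by positivity) (fun k => ?_)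
      ((summable_geometric_of_lt_one (r := 1 / 4) (by norm_num) (by norm_num)).mul_left
        ((‖v 0‖ + 1) ^ 2))
    rw [norm_smul, norm_pow, RCLike.norm_ofNat, mul_pow]
    have h3 : ‖ζ k‖ ^ 2 ≤ ((‖v 0‖ + 1) * (1 / 4 : ℝ) ^ k) ^ 2 := by
      gcongr
      exact hζ k
    calc ((2 : ℝ) ^ k) ^ 2 * ‖ζ k‖ ^ 2
        ≤ ((2 : ℝ) ^ k) ^ 2 * ((‖v 0‖ + 1) * (1 / 4 : ℝ) ^ k) ^ 2 := by gcongr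
      _ = (‖v 0‖ + 1) ^ 2 * (1 / 4) ^ k := by
        rw [mul_pow, ← pow_mul, ← pow_mul, mul_comm k 2, pow_mul, pow_mul, mul_left_comm, ← mul_pow]
        norm_num
  refine A.tsum_mem_normalVec (fun k => ((1 / 2 : ℂ) ^ k) • V k)
    (fun k => Submodule.smul_mem _ _ (hV k)) (fun k => ((2 : ℂ) ^ k) • ζ k) hVs hζs ?_
  have hterm : ∀ k, (((1 / 2 : ℂ) ^ k) • V k) (((2 : ℂ) ^ k) • ζ k) = v k := by
    intro k
    rw [map_smul, smul_apply, smul_smul, ← mul_pow, hVζ]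
    norm_num
  have hsv : Summable v := by
    refine Summable.of_norm_bounded (g := fun n => (‖v 0‖ + 1) * (1 / 4 : ℝ) ^ n)
      ((summable_geometric_of_lt_one (by norm_num) (by norm_num)).mul_left _) fun n => (hr n).le
  simp only [hterm]
  have h5 : Filter.Tendsto (fun n => ∑ i ∈ Finset.range (n + 1), v i) Filter.atTop
      (nhds (∑' i, v i)) :=
    hsv.hasSum.tendsto_sum_nat.comp (Filter.tendsto_add_atTop_nat 1)
  rw [tendsto_nhds_unique hv h5]
  exact hsv.hasSum

/-- A generated representation is `σ`-weakly continuous: a square-summable family is the image of a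
family of vectors of `H`, so that its pairings are pairings on `H`. -/
theorem VNRep.IsGenerated.continuous {A : VNRep N} (hA : A.IsGenerated) :
    @Continuous _ _ (sigmaWeakAlg N) (sigmaWeak A.K A.K) fun a => A.π a := by
  refine continuous_to_sigmaWeak _ _ fun ξ η hξ hη => ?_
  obtain ⟨V, hV, ζ, hζ⟩ := (VNRep.isGenerated_ell2 hA ℕ).mem_normalVec (Ell2.mk ξ hξ)
  have key : ∀ a : Alg N, pairing ξ η hξ hη (A.π a)
      = pairing ζ (V.adjoint (Ell2.mk η hη)) (Ell2.summable_sq _) (Ell2.summable_sq _)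
        (a : H →L[ℂ] H) := by
    intro a
    have h1 := pairing_eq_inner (Ell2.mk ξ hξ) (Ell2.mk η hη) (A.π a)
    rw [pairing_eq_inner, ContinuousLinearMap.adjoint_inner_left]
    refine h1.trans ?_
    rw [← hζ]
    exact congrArg (fun z => ⟪Ell2.mk η hη, z⟫_ℂ) (DFunLike.congr_fun (hV a) ζ).symm
  simp only [key]
  let := sigmaWeak H H
  let := sigmaWeakAlg N
  exact (continuous_pairing _ _ _ _).comp continuous_induced_dom

end Normal

/-! ### Saturated correspondences and the universal property of the completion -/

section Saturated

/-- The identity isomorphism. -/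
def PreCorr.Iso.refl {N : VonNeumannAlgebra H} (X : PreCorr N) : PreCorr.Iso X X where
  toEquiv := LinearEquiv.refl ℂ _
  map_lact _ _ := rfl
  map_ract _ _ := rfl
  map_ip _ _ := rfl

/-- The inverse of an isomorphism of correspondences. -/
def PreCorr.Iso.symm {N : VonNeumannAlgebra H} {X Y : PreCorr N} (f : PreCorr.Iso X Y) :
    PreCorr.Iso Y X where
  toEquiv := f.toEquiv.symm
  map_lact a y := by rw [LinearEquiv.symm_apply_eq, f.map_lact, LinearEquiv.apply_symm_apply]
  map_ract b y := by rw [LinearEquiv.symm_apply_eq, f.map_ract, LinearEquiv.apply_symm_apply]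
  map_ip y z := by
    rw [← f.map_ip, LinearEquiv.apply_symm_apply, LinearEquiv.apply_symm_apply]

/-- The composition of isomorphisms of correspondences. -/
def PreCorr.Iso.trans {N : VonNeumannAlgebra H} {X Y Z : PreCorr N} (f : PreCorr.Iso X Y)
    (g : PreCorr.Iso Y Z) : PreCorr.Iso X Z where
  toEquiv := f.toEquiv.trans g.toEquiv
  map_lact a x := by
    rw [LinearEquiv.trans_apply, f.map_lact, g.map_lact, LinearEquiv.trans_apply]
  map_ract b x := by
    rw [LinearEquiv.trans_apply, f.map_ract, g.map_ract, LinearEquiv.trans_apply]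
  map_ip x y := by
    rw [LinearEquiv.trans_apply, LinearEquiv.trans_apply, g.map_ip, f.map_ip]

/-- A correspondence `Y` over `M'` is saturated if `y ↦ (h ↦ y ⊗ h)` is a bijection of `Y` onto the
intertwiners `H → Y ⊗ H` of the actions of `M`. For correspondences with normal left action this is
equivalent to being a `W*`-correspondence. -/
structure PreCorr.IsSaturated (Y : PreCorr M.commutant) : Prop where
  injective : Function.Injective (creation Y)
  surjective : ∀ S ∈ VNRep.Hom (idRep M) (rightInd Y), ∃ y, creation Y y = S

theorem PreCorr.IsSaturated.definite {Y : PreCorr M.commutant} (hY : Y.IsSaturated)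
    (y : Y.carrier) (hy : Y.ip y y = 0) : y = 0 := by
  refine hY.injective ?_
  rw [map_zero]
  refine ContinuousLinearMap.ext fun h => ?_
  have h1 : ⟪creation Y y h, creation Y y h⟫_ℂ = 0 := by
    rw [← ContinuousLinearMap.adjoint_inner_right, ← ContinuousLinearMap.comp_apply,
      creation_adjoint_comp, hy]
    exact inner_zero_right _
  exact inner_self_eq_zero.1 h1

theorem indLift_mem_hom {A : VNRep M} {Y : PreCorr M.commutant}
    {e : Y.carrier →ₗ[ℂ] (H →L[ℂ] A.K)} (he : ∀ x y, (e x).adjoint ∘L e y = Y.ip x y)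
    (hmem : ∀ y, e y ∈ VNRep.Hom (idRep M) A) : indLift Y e ∈ VNRep.Hom (rightInd Y) A := fun T =>
  (indKernel Y).hom_ext fun y h => by
    rw [ContinuousLinearMap.comp_apply, ContinuousLinearMap.comp_apply, rightInd_tmul,
      indLift_tmul he, indLift_tmul he]
    exact DFunLike.congr_fun (hmem y T) h

/-- A correspondence that is isomorphic to the space of intertwiners from `H` to some
representation, with `⟨X, Y⟩ = X* Y`, is saturated. -/
theorem PreCorr.IsSaturated.of_equiv_hom {Y : PreCorr M.commutant} (A : VNRep M)
    (e : Y.carrier →ₗ[ℂ] (H →L[ℂ] A.K)) (he : ∀ x y, (e x).adjoint ∘L e y = Y.ip x y)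
    (hmem : ∀ y, e y ∈ VNRep.Hom (idRep M) A) (hinj : Function.Injective e)
    (hsurj : ∀ S ∈ VNRep.Hom (idRep M) A, ∃ y, e y = S) : Y.IsSaturated where
  injective x y hxy := hinj (by
    rw [← indLift_comp_creation he, hxy, indLift_comp_creation he])
  surjective S hS := by
    obtain ⟨y, hy⟩ := hsurj _ (VNRep.Hom.comp ⟨_, indLift_mem_hom he hmem⟩ ⟨S, hS⟩).2
    refine ⟨y, ContinuousLinearMap.ext fun h => indLift_injective he ?_⟩
    rw [← ContinuousLinearMap.comp_apply, indLift_comp_creation he, hy]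
    rfl

theorem isSaturated_completion (X : PreCorr M.commutant) : (completion X).IsSaturated :=
  .of_equiv_hom (rightInd X) (Submodule.subtype _) (fun _ _ => rfl)
    (fun T => (mem_sigmaClosure_creationRange_iff X _).1 T.2) Subtype.val_injective
    fun S hS => ⟨⟨S, (mem_sigmaClosure_creationRange_iff X S).2 hS⟩, rfl⟩

theorem isSaturated_idCorr : (idCorr M.commutant).IsSaturated :=
  .of_equiv_hom (idRep M) (Y := idCorr M.commutant)
    { toFun := fun R => (show Alg M.commutant from R).1
      map_add' := fun _ _ => rfl
      map_smul' := fun _ _ => rfl } (fun _ _ => rfl)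
    (fun R => (ofCommutant R).2) Subtype.val_injective
    fun S hS => ⟨⟨S, mem_commutant_of_forall fun T => (hS T).symm⟩, rfl⟩

variable {X Y : PreCorr M.commutant}

theorem adjoint_comp_creation_comp {N : VonNeumannAlgebra H} {X Y : PreCorr N}
    {j : X.carrier →ₗ[ℂ] Y.carrier} (hj : ∀ x x', Y.ip (j x) (j x') = X.ip x x')
    (x x' : X.carrier) :
    ((creation Y ∘ₗ j) x).adjoint ∘L (creation Y ∘ₗ j) x' = X.ip x x' := by
  rw [← hj]
  exact creation_adjoint_comp Y _ _

/-- If the range of `j` generates, the isometry `X ⊗ H → Y ⊗ H` induced by `j` has dense range. -/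
theorem indLift_adjoint_injective {N : VonNeumannAlgebra H} {X Y : PreCorr N}
    {j : X.carrier →ₗ[ℂ] Y.carrier} (hj : ∀ x x', Y.ip (j x) (j x') = X.ip x x')
    (hgen : Y.Generates (Set.range j)) :
    Function.Injective (indLift X (creation Y ∘ₗ j)).adjoint :=
  (injective_iff_map_eq_zero _).2 fun w hw => hgen w <| by
    rintro _ ⟨x, rfl⟩ h
    have h1 := indLift_tmul (adjoint_comp_creation_comp hj) x h
    rw [← creation_apply]
    refine (congrArg (fun z => ⟪z, w⟫_ℂ) h1).symm.trans ?_
    rw [← ContinuousLinearMap.adjoint_inner_right, hw]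
    exact inner_zero_right _

theorem indLift_comp_indRep {N : VonNeumannAlgebra H} {X Y : PreCorr N}
    {j : X.carrier →ₗ[ℂ] Y.carrier} (hj : ∀ x x', Y.ip (j x) (j x') = X.ip x x')
    (hl : ∀ a x, j (X.lact a x) = Y.lact a (j x)) :
    indLift X (creation Y ∘ₗ j) ∈ VNRep.Hom (leftInd X) (leftInd Y) := fun a =>
  (indKernel X).hom_ext fun x h => by
    have h1 := indLift_tmul (adjoint_comp_creation_comp hj)
    rw [ContinuousLinearMap.comp_apply, ContinuousLinearMap.comp_apply, indRep_tmul, h1, h1,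
      LinearMap.comp_apply, LinearMap.comp_apply, hl, ← indRep_comp_creation]
    rfl

/-- The map `y ↦ U* ∘ (h ↦ y ⊗ h)` to the completion of `X`, for `U` an intertwiner from `X ⊗ H` to
`Y ⊗ H`. -/
def pullCreation (U : VNRep.Hom (rightInd X) (rightInd Y)) :
    Y.carrier →ₗ[ℂ] (completion X).carrier where
  toFun y := ⟨U.1.adjoint ∘L creation Y y, (mem_sigmaClosure_creationRange_iff X _).2
    (VNRep.Hom.comp (VNRep.Hom.adj U) ⟨_, creation_mem_hom Y y⟩).2⟩
  map_add' y z := Subtype.ext (by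
    change U.1.adjoint ∘L creation Y (y + z)
      = U.1.adjoint ∘L creation Y y + U.1.adjoint ∘L creation Y z
    rw [map_add, ContinuousLinearMap.comp_add])
  map_smul' c y := Subtype.ext (by
    change U.1.adjoint ∘L creation Y (c • y) = c • (U.1.adjoint ∘L creation Y y)
    rw [map_smul, ContinuousLinearMap.comp_smul])

theorem coe_pullCreation (U : VNRep.Hom (rightInd X) (rightInd Y)) (y : Y.carrier) :
    (pullCreation U y).1 = U.1.adjoint ∘L creation Y y := rfl

theorem pullCreation_bijective (hY : Y.IsSaturated) (U : VNRep.Hom (rightInd X) (rightInd Y))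
    (h₁ : ∀ z, U.1.adjoint (U.1 z) = z) (h₂ : ∀ z, U.1 (U.1.adjoint z) = z) :
    Function.Bijective (pullCreation U) := by
  constructor
  · intro y z hyz
    refine hY.injective (ContinuousLinearMap.ext fun h => ?_)
    rw [← h₂ (creation Y y h), ← h₂ (creation Y z h)]
    exact congrArg U.1 (DFunLike.congr_fun (congrArg Subtype.val hyz) h)
  · intro T
    obtain ⟨y, hy⟩ := hY.surjective _ (VNRep.Hom.comp U
      ⟨T.1, (mem_sigmaClosure_creationRange_iff X _).1 T.2⟩).2
    refine ⟨y, Subtype.ext (ContinuousLinearMap.ext fun h => ?_)⟩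
    rw [coe_pullCreation, hy]
    exact h₁ _

/-- A unitary bimodule map `U` of `X ⊗ H` onto `Y ⊗ H` identifies a saturated `Y` with the
completion of `X`. -/
def pullCreationIso (hY : Y.IsSaturated) (U : VNRep.Hom (rightInd X) (rightInd Y))
    (hl : U.1 ∈ VNRep.Hom (leftInd X) (leftInd Y))
    (h₁ : ∀ z, U.1.adjoint (U.1 z) = z) (h₂ : ∀ z, U.1 (U.1.adjoint z) = z) :
    PreCorr.Iso Y (completion X) where
  toEquiv := LinearEquiv.ofBijective _ (pullCreation_bijective hY U h₁ h₂)
  map_lact a y := Subtype.ext (ContinuousLinearMap.ext fun h => by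
    change U.1.adjoint (creation Y (Y.lact a y) h) = indRep X a (U.1.adjoint (creation Y y h))
    rw [← indRep_comp_creation]
    exact DFunLike.congr_fun
      ((VNRep.Hom.adj (⟨U.1, hl⟩ : VNRep.Hom (leftInd X) (leftInd Y))).2 a) (creation Y y h))
  map_ract b y := Subtype.ext (by
    change U.1.adjoint ∘L creation Y (Y.ract b y)
      = (U.1.adjoint ∘L creation Y y) ∘L ((unop b : Alg M.commutant) : H →L[ℂ] H)
    rw [ContinuousLinearMap.comp_assoc, creation_comp, op_unop])
  map_ip y z := Subtype.ext (by
    change (U.1.adjoint ∘L creation Y y).adjoint ∘L (U.1.adjoint ∘L creation Y z) = _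
    rw [ContinuousLinearMap.adjoint_comp, ContinuousLinearMap.adjoint_adjoint,
      ← creation_adjoint_comp]
    exact ContinuousLinearMap.ext fun h => congrArg (creation Y y).adjoint (h₂ _))

/-- The universal property of the completion: a bimodule map of `X` to a saturated correspondence
`Y` that preserves inner products and has generating range extends to an isomorphism of the
`W*`-completion of `X` with `Y`. -/
theorem exists_completionIso (hY : Y.IsSaturated) (j : X.carrier →ₗ[ℂ] Y.carrier)
    (hj : ∀ x x', Y.ip (j x) (j x') = X.ip x x') (hl : ∀ a x, j (X.lact a x) = Y.lact a (j x))
    (hgen : Y.Generates (Set.range j)) :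
    ∃ α : PreCorr.Iso (completion X) Y, ∀ x, α (toCompletion X x) = j x := by
  have hc := adjoint_comp_creation_comp hj
  have h₁ := indLift_adjoint_apply hc
  refine ⟨(pullCreationIso hY ⟨_, indLift_mem_hom hc fun x => creation_mem_hom Y _⟩
    (indLift_comp_indRep hj hl) h₁ fun z => indLift_adjoint_injective hj hgen (h₁ _)).symm,
    fun x => ?_⟩
  refine (LinearEquiv.symm_apply_eq _).2 (Subtype.ext (ContinuousLinearMap.ext fun h => ?_))
  have h₂ := DFunLike.congr_fun (indLift_comp_creation hc x) h
  exact ((congrArg _ h₂.symm).trans (h₁ _)).symm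

theorem ip_toCompletion {N : VonNeumannAlgebra H} (X : PreCorr N) (x y : X.carrier) :
    (completion X).ip (toCompletion X x) (toCompletion X y) = X.ip x y :=
  Subtype.ext (creation_adjoint_comp X x y)

theorem toCompletion_lact {N : VonNeumannAlgebra H} (X : PreCorr N) (a : Alg N) (x : X.carrier) :
    toCompletion X (X.lact a x) = (completion X).lact a (toCompletion X x) :=
  Subtype.ext (indRep_comp_creation X a x).symm

theorem toCompletion_ract {N : VonNeumannAlgebra H} (X : PreCorr N) (b : Alg N) (x : X.carrier) :
    toCompletion X (X.ract (op b) x) = (completion X).ract (op b) (toCompletion X x) :=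
  Subtype.ext (creation_comp X b x).symm

/-- The isometry `T ⊗ h ↦ T h` of the Hilbert space of the completion of `X` to that of `X`. -/
def completionInd {N : VonNeumannAlgebra H} (X : PreCorr N) : Ind (completion X) →L[ℂ] Ind X :=
  indLift (completion X) (Submodule.subtype _)

theorem completionInd_tmul {N : VonNeumannAlgebra H} (X : PreCorr N) (T : (completion X).carrier)
    (h : H) : completionInd X ((indKernel (completion X)).tmul T h)
      = (show sigmaClosure (creationRange X) from T).1 h :=
  indLift_tmul (X := completion X) (e := Submodule.subtype _) (fun _ _ => rfl) T h

theorem inner_completionInd {N : VonNeumannAlgebra H} (X : PreCorr N) (z w : Ind (completion X)) :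
    ⟪completionInd X z, completionInd X w⟫_ℂ = ⟪z, w⟫_ℂ :=
  inner_indLift (X := completion X) (e := Submodule.subtype _) (fun _ _ => rfl) z w

theorem completionInd_injective {N : VonNeumannAlgebra H} (X : PreCorr N) :
    Function.Injective (completionInd X) :=
  indLift_injective (X := completion X) (e := Submodule.subtype _) (fun _ _ => rfl)

theorem PreCorr.Generates.completion {N : VonNeumannAlgebra H} {X : PreCorr N}
    {D : Set X.carrier} (hD : X.Generates D) :
    (completion X).Generates (toCompletion X '' D) := fun w hw => by
  refine completionInd_injective X ?_
  rw [map_zero]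
  refine hD _ fun d hd h => ?_
  rw [← hw _ ⟨d, hd, rfl⟩ h, ← inner_completionInd, completionInd_tmul]
  rfl

theorem completionInd_mem_hom {N : VonNeumannAlgebra H} (X : PreCorr N) :
    completionInd X ∈ VNRep.Hom (leftInd (completion X)) (leftInd X) := fun a =>
  (indKernel (completion X)).hom_ext fun T h => by
    rw [ContinuousLinearMap.comp_apply, ContinuousLinearMap.comp_apply, indRep_tmul,
      completionInd_tmul, completionInd_tmul]
    rfl

theorem isGenerated_leftInd_completion {N : VonNeumannAlgebra H} {X : PreCorr N}
    (hX : (leftInd X).IsGenerated) : (leftInd (completion X)).IsGenerated :=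
  hX.of_hom (VNRep.Hom.adj ⟨_, completionInd_mem_hom X⟩) (by
    change Function.Injective (completionInd X).adjoint.adjoint
    rw [ContinuousLinearMap.adjoint_adjoint]
    exact completionInd_injective X)

end Saturated

/-! ### Saturated correspondences with normal left action are `W*`-correspondences -/

section WStar

theorem norm_creation {N : VonNeumannAlgebra H} (Y : PreCorr N) (y : Y.carrier) :
    ‖creation Y y‖ = Y.nrm y := by
  have h := ContinuousLinearMap.norm_adjoint_comp_self (creation Y y)
  rw [creation_adjoint_comp] at h
  rw [PreCorr.nrm, h, Real.sqrt_mul_self (norm_nonneg _)]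

theorem exists_norm_limit {E : Type*} [NormedAddCommGroup E] [CompleteSpace E] (u : ℕ → E)
    (hu : ∀ ε > 0, ∃ n₀, ∀ m ≥ n₀, ∀ n ≥ n₀, ‖u m - u n‖ < ε) {Z : Set E} (hZ : IsClosed Z)
    (huZ : ∀ n, u n ∈ Z) : ∃ S ∈ Z, ∀ ε > 0, ∃ n₀, ∀ n ≥ n₀, ‖u n - S‖ < ε := by
  have hc : CauchySeq u := Metric.cauchySeq_iff.2 fun ε hε => by
    simpa only [dist_eq_norm] using hu ε hε
  obtain ⟨S, hS⟩ := cauchySeq_tendsto_of_complete hc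
  refine ⟨S, hZ.mem_of_tendsto hS (Filter.Eventually.of_forall huZ), fun ε hε => ?_⟩
  simpa only [dist_eq_norm] using Metric.tendsto_atTop.1 hS ε hε

theorem PreCorr.IsSaturated.complete {Y : PreCorr M.commutant} (hY : Y.IsSaturated)
    (u : ℕ → Y.carrier)
    (hu : ∀ ε > 0, ∃ n₀, ∀ m ≥ n₀, ∀ n ≥ n₀, Y.nrm (u m - u n) < ε) :
    ∃ x, ∀ ε > 0, ∃ n₀, ∀ n ≥ n₀, Y.nrm (u n - x) < ε := by
  simp only [← norm_creation, map_sub] at hu ⊢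
  obtain ⟨S, hS, h⟩ := exists_norm_limit (fun n => creation Y (u n)) hu
    (VNRep.isClosed_hom (idRep M) (rightInd Y)) (fun n => creation_mem_hom Y (u n))
  obtain ⟨x, rfl⟩ := hY.surjective S hS
  exact ⟨x, h⟩

variable {Y : PreCorr M.commutant} {φ : Y.carrier →ₗ[ℂ] Alg M.commutant}

/-- A bounded module map `φ : Y → M'` satisfies `φ(y)* φ(y) ≤ C² ⟨y, y⟩`: apply the bound for `φ` to
`y c` with `c = (⟨y, y⟩ + ε)^{-1/2}`, an element of norm at most one, and let `ε` tend to `0`. -/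
theorem norm_module_map_apply_le (hφ : ∀ x b, φ (Y.ract (op b) x) = φ x * b) {C : ℝ} (hC : 0 ≤ C)
    (hb : ∀ x, ‖(φ x : H →L[ℂ] H)‖ ≤ C * Y.nrm x) (y : Y.carrier) (h : H) :
    ‖(φ y : H →L[ℂ] H) h‖ ^ 2 ≤ C ^ 2 * ‖creation Y y h‖ ^ 2 := by
  have key : ∀ ε > 0, ‖(φ y : H →L[ℂ] H) h‖ ^ 2
      ≤ C ^ 2 * (‖creation Y y h‖ ^ 2 + ε * ‖h‖ ^ 2) := by
    intro ε hε
    obtain ⟨c, d, hcd, hVc, hd, hcomm⟩ := exists_regularised_abs (creation Y y) hε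
    have hm : ∀ T : Alg M, Commute (T : H →L[ℂ] H) ((creation Y y).adjoint ∘L creation Y y) := by
      intro T
      rw [creation_adjoint_comp]
      exact (mul_comm_of_mem_commutant T _).symm
    let c' : Alg M.commutant := ⟨c, mem_commutant_of_forall fun T => (hcomm T (hm T)).1⟩
    let d' : Alg M.commutant := ⟨d, mem_commutant_of_forall fun T => (hcomm T (hm T)).2⟩
    have h1 : φ y = φ (Y.ract (op c') y) * d' := by
      rw [hφ, mul_assoc]
      have : c' * d' = 1 := Subtype.ext hcd
      rw [this, mul_one]
    have h2 : Y.nrm (Y.ract (op c') y) ≤ 1 := by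
      rw [← norm_creation, ← creation_comp]
      refine ContinuousLinearMap.opNorm_le_bound _ zero_le_one fun x => ?_
      rw [one_mul]
      exact hVc x
    have h3 : (φ y : H →L[ℂ] H) h = (φ (Y.ract (op c') y) : H →L[ℂ] H) (d h) :=
      DFunLike.congr_fun (congrArg Subtype.val h1) h
    rw [h3, ← hd, ← mul_pow]
    gcongr
    refine (ContinuousLinearMap.le_opNorm _ _).trans ?_
    gcongr
    exact (hb _).trans (mul_le_of_le_one_right hC h2)
  refine le_of_forall_pos_le_add fun ε hε => ?_
  refine (key (ε / (1 + C ^ 2 * ‖h‖ ^ 2)) (by positivity)).trans ?_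
  rw [mul_add]
  gcongr
  have : C ^ 2 * (ε / (1 + C ^ 2 * ‖h‖ ^ 2) * ‖h‖ ^ 2)
      = ε * ((C ^ 2 * ‖h‖ ^ 2) / (1 + C ^ 2 * ‖h‖ ^ 2)) := by ring
  rw [this]
  refine mul_le_of_le_one_right hε.le ((div_le_one (by positivity)).2 (by linarith))

theorem norm_sq_eq_add_of_projection (A : VNRep M) {Q : Alg M} (hs : star Q = Q) (hQ : Q * Q = Q)
    (x : A.K) : ‖x‖ ^ 2 = ‖A.π Q x‖ ^ 2 + ‖x - A.π Q x‖ ^ 2 := by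
  have h1 : ⟪A.π Q x, x - A.π Q x⟫_ℂ = 0 := by
    have e1 : (A.π Q).adjoint = A.π Q := by
      rw [← ContinuousLinearMap.star_eq_adjoint, ← map_star, hs]
    have e2 : A.π Q (A.π Q x) = A.π Q x := by
      rw [← mul_apply_eq_comp, ← map_mul, hQ]
    rw [← ContinuousLinearMap.adjoint_inner_right, e1, map_sub, e2, sub_self]
    exact inner_zero_right _
  have h2 := norm_add_sq_eq_norm_sq_add_norm_sq_of_inner_eq_zero _ _ h1
  rw [add_sub_cancel] at h2
  rw [sq, sq, sq, h2]

/-- The orbit map `T ↦ T ξ` of a vector of a representation. -/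
def VNRep.orbit {N : VonNeumannAlgebra H} (B : VNRep N) (ξ : B.K) : Alg N →ₗ[ℂ] B.K where
  toFun T := B.π T ξ
  map_add' S T := by rw [map_add, add_apply]
  map_smul' c T := by rw [map_smul, smul_apply, RingHom.id_apply]

/-- The closed cyclic subspace of a vector of a representation. -/
def VNRep.cyclic {N : VonNeumannAlgebra H} (B : VNRep N) (ξ : B.K) : Submodule ℂ B.K :=
  (LinearMap.range (B.orbit ξ)).topologicalClosure

section Cyclic

variable {N : VonNeumannAlgebra H} (B : VNRep N)

theorem VNRep.orbit_mem_cyclic (ξ : B.K) (T : Alg N) : B.π T ξ ∈ B.cyclic ξ :=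
  subset_closure ⟨T, rfl⟩

theorem VNRep.apply_mem_cyclic {ξ x : B.K} (hx : x ∈ B.cyclic ξ) (T : Alg N) :
    B.π T x ∈ B.cyclic ξ := by
  refine map_mem_closure (B.π T).continuous hx ?_
  rintro _ ⟨S, rfl⟩
  exact ⟨T * S, by
    change B.π (T * S) ξ = B.π T (B.π S ξ)
    rw [map_mul, mul_apply_eq_comp]⟩

theorem VNRep.self_mem_cyclic (ξ : B.K) : ξ ∈ B.cyclic ξ := by
  have := B.orbit_mem_cyclic ξ 1
  rwa [map_one, one_apply_eq_self] at this

instance (ξ : B.K) : CompleteSpace (B.cyclic ξ) :=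
  (Submodule.isClosed_topologicalClosure _).completeSpace_coe

/-- The orthogonal projection onto the closed cyclic subspace of a vector. -/
def VNRep.cyclicProj (ξ : B.K) : B.K →L[ℂ] B.K := (B.cyclic ξ).starProjection

theorem VNRep.cyclicProj_apply (ξ x : B.K) (T : Alg N) :
    B.cyclicProj ξ (B.π T x) = B.π T (B.cyclicProj ξ x) := by
  refine Submodule.eq_starProjection_of_mem_orthogonal (B.apply_mem_cyclic
    (Submodule.starProjection_apply_mem _ _) T) ?_
  rw [Submodule.mem_orthogonal]
  intro w hw
  have h1 := (Submodule.mem_orthogonal _ _).1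
    ((B.cyclic ξ).sub_starProjection_mem_orthogonal x) _ (B.apply_mem_cyclic hw (star T))
  rwa [map_star, ContinuousLinearMap.star_eq_adjoint, ContinuousLinearMap.adjoint_inner_left,
    map_sub] at h1

theorem VNRep.cyclicProj_mem (ξ x : B.K) : B.cyclicProj ξ x ∈ B.cyclic ξ :=
  Submodule.starProjection_apply_mem _ _

theorem VNRep.cyclicProj_self (ξ : B.K) : B.cyclicProj ξ ξ = ξ :=
  Submodule.starProjection_eq_self_iff.2 (B.self_mem_cyclic ξ)

theorem VNRep.star_cyclicProj (ξ : B.K) : star (B.cyclicProj ξ) = B.cyclicProj ξ :=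
  isStarProjection_starProjection.isSelfAdjoint.star_eq

theorem VNRep.cyclicProj_mul_self (ξ : B.K) :
    B.cyclicProj ξ * B.cyclicProj ξ = B.cyclicProj ξ :=
  isStarProjection_starProjection.isIdempotentElem

end Cyclic

/-- The projection onto the cyclic subspace of a vector under `M'` lies in `M`. -/
theorem exists_cyclic_projection (h : H) : ∃ Q : Alg M, star Q = Q ∧ Q * Q = Q ∧
    (∀ x, (Q : H →L[ℂ] H) x ∈ (idRep M.commutant).cyclic h) ∧ (Q : H →L[ℂ] H) h = h := by
  have hmem : (idRep M.commutant).cyclicProj h ∈ M.toStarSubalgebra :=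
    mem_of_forall_commutant fun R => ContinuousLinearMap.ext fun x =>
      ((idRep M.commutant).cyclicProj_apply h x R).symm
  exact ⟨⟨_, hmem⟩, Subtype.ext ((idRep M.commutant).star_cyclicProj h),
    Subtype.ext ((idRep M.commutant).cyclicProj_mul_self h),
    (idRep M.commutant).cyclicProj_mem h, (idRep M.commutant).cyclicProj_self h⟩

/-- For finitely many vectors: `‖∑ φ(yᵢ) hᵢ‖ ≤ C ‖∑ yᵢ ⊗ hᵢ‖`. The projection of `M` onto the cyclic
subspace of `h₀` splits both sums orthogonally. On its range the vectors are limits of `bᵢ h₀`,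
which reduces to one element of `Y`; on its kernel `h₀` drops out. -/
theorem norm_sum_module_map_le (hφ : ∀ x b, φ (Y.ract (op b) x) = φ x * b) {C : ℝ} (hC : 0 ≤ C)
    (hb : ∀ x, ‖(φ x : H →L[ℂ] H)‖ ≤ C * Y.nrm x) :
    ∀ (n : ℕ) (y : Fin n → Y.carrier) (h : Fin n → H),
    ‖∑ i, (φ (y i) : H →L[ℂ] H) (h i)‖ ^ 2 ≤ C ^ 2 * ‖∑ i, creation Y (y i) (h i)‖ ^ 2 := by
  intro n
  induction n with
  | zero => intro y h; simp
  | succ n ih =>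
    intro y h
    obtain ⟨Q, hs, hQ, hQmem, hQh⟩ := exists_cyclic_projection (M := M) (h 0)
    have e1 : (idRep M).π Q (∑ i, (φ (y i) : H →L[ℂ] H) (h i))
        = ∑ i, (φ (y i) : H →L[ℂ] H) ((Q : H →L[ℂ] H) (h i)) := by
      rw [map_sum]
      exact Finset.sum_congr rfl fun i _ =>
        (DFunLike.congr_fun (mul_comm_of_mem_commutant Q (φ (y i))) (h i)).symm
    have e2 : (rightInd Y).π Q (∑ i, creation Y (y i) (h i))
        = ∑ i, creation Y (y i) ((Q : H →L[ℂ] H) (h i)) := by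
      rw [map_sum]
      exact Finset.sum_congr rfl fun i _ => rightInd_tmul Y Q (y i) (h i)
    have p1 := norm_sq_eq_add_of_projection (idRep M) hs hQ (∑ i, (φ (y i) : H →L[ℂ] H) (h i))
    have p2 := norm_sq_eq_add_of_projection (rightInd Y) hs hQ (∑ i, creation Y (y i) (h i))
    rw [e1, ← Finset.sum_sub_distrib] at p1
    rw [e2, ← Finset.sum_sub_distrib] at p2
    simp only [← map_sub] at p1 p2
    rw [p1, p2, mul_add]
    refine add_le_add ?_ ?_
    -- the vectors `Q hᵢ` lie in the closure of `M' h₀`, and for `kᵢ = Rᵢ h₀` the two sums are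
    -- `φ(y) h₀` and `y ⊗ h₀` with `y = ∑ yᵢ Rᵢ`
    · have hcl : IsClosed {k : Fin (n + 1) → H | ‖∑ i, (φ (y i) : H →L[ℂ] H) (k i)‖ ^ 2
          ≤ C ^ 2 * ‖∑ i, creation Y (y i) (k i)‖ ^ 2} :=
        isClosed_le (by fun_prop) (by fun_prop)
      have hsub : Set.pi Set.univ (fun _ : Fin (n + 1) =>
          Set.range fun R : Alg M.commutant => (R : H →L[ℂ] H) (h 0)) ⊆
          {k : Fin (n + 1) → H | ‖∑ i, (φ (y i) : H →L[ℂ] H) (k i)‖ ^ 2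
            ≤ C ^ 2 * ‖∑ i, creation Y (y i) (k i)‖ ^ 2} := by
        intro k hk
        choose R hR using fun i => hk i trivial
        have f1 : ∑ i, (φ (y i) : H →L[ℂ] H) (k i)
            = (φ (∑ i, Y.ract (op (R i)) (y i)) : H →L[ℂ] H) (h 0) := by
          rw [map_sum, AddSubmonoidClass.coe_finsetSum, sum_apply]
          refine Finset.sum_congr rfl fun i _ => ?_
          rw [hφ, ← hR]
          rfl
        have f2 : ∑ i, creation Y (y i) (k i)
            = creation Y (∑ i, Y.ract (op (R i)) (y i)) (h 0) := by
          rw [map_sum, sum_apply]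
          refine Finset.sum_congr rfl fun i _ => ?_
          rw [← creation_comp, ← hR]
          rfl
        rw [Set.mem_ofPred_eq, f1, f2]
        exact norm_module_map_apply_le hφ hC hb _ _
      have := closure_minimal hsub hcl
      rw [closure_pi_set] at this
      exact this fun i _ => hQmem (h i)
    -- `(1 - Q) h₀ = 0`, so that only `n` summands are left
    · have := ih (fun i => y i.succ) (fun i => h i.succ - (Q : H →L[ℂ] H) (h i.succ))
      rw [Fin.sum_univ_succ, Fin.sum_univ_succ, hQh, sub_self, map_zero, map_zero, zero_add,
        zero_add]
      exact this

/-- A bounded module map `φ` is `⟨ξ, ·⟩` for the element `ξ` of `Y` that corresponds to the intertwiner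
`Ψ* : H → Y ⊗ H`, where `Ψ (y ⊗ h) = φ(y) h`. -/
theorem PreCorr.IsSaturated.selfDual (hY : Y.IsSaturated)
    (hφ : ∀ x b, φ (Y.ract (op b) x) = φ x * b)
    (hb : ∃ C : ℝ, ∀ x, ‖(φ x : H →L[ℂ] H)‖ ≤ C * Y.nrm x) : ∃ ξ, ∀ x, φ x = Y.ip ξ x := by
  obtain ⟨C, hC⟩ := hb
  have hC' : ∀ x, ‖(φ x : H →L[ℂ] H)‖ ≤ |C| * Y.nrm x := fun x =>
    (hC x).trans (mul_le_mul_of_nonneg_right (le_abs_self C) (Real.sqrt_nonneg _))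
  let e : Y.carrier →ₗ[ℂ] (H →L[ℂ] H) :=
    { toFun := fun y => (φ y : H →L[ℂ] H)
      map_add' := fun x y => by rw [map_add]; rfl
      map_smul' := fun c x => by rw [map_smul]; rfl }
  let f : Y.carrier ⊗[ℂ] H →ₗ[ℂ] H := TensorProduct.lift (ContinuousLinearMap.coeLM ℂ ∘ₗ e)
  let Ψ : Ind Y →L[ℂ] H := (indKernel Y).lift f
  have hΨ : ∀ y h, Ψ ((indKernel Y).tmul y h) = (φ y : H →L[ℂ] H) h := fun y h => by
    refine (indKernel Y).lift_toSpace f |C| (fun z => ?_) _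
    obtain ⟨n, v, k, rfl⟩ := PosKernel.exists_fin z
    refine (sq_le_sq₀ (norm_nonneg _) (by positivity)).1 ?_
    rw [mul_pow, map_sum, map_sum]
    exact norm_sum_module_map_le hφ (abs_nonneg C) hC' n v k
  have hΨm : Ψ ∈ VNRep.Hom (rightInd Y) (idRep M) := fun T => (indKernel Y).hom_ext fun y h => by
    rw [ContinuousLinearMap.comp_apply, ContinuousLinearMap.comp_apply, rightInd_tmul, hΨ, hΨ]
    exact DFunLike.congr_fun (mul_comm_of_mem_commutant T (φ y)) h
  obtain ⟨ξ, hξ⟩ := hY.surjective _ (VNRep.Hom.adj ⟨Ψ, hΨm⟩).2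
  refine ⟨ξ, fun x => Subtype.ext ?_⟩
  rw [← creation_adjoint_comp, hξ]
  change _ = Ψ.adjoint.adjoint ∘L creation Y x
  rw [ContinuousLinearMap.adjoint_adjoint]
  exact ContinuousLinearMap.ext fun h => (hΨ x h).symm

theorem continuous_ip_lact {N : VonNeumannAlgebra H} {Y : PreCorr N}
    (hY : (leftInd Y).IsGenerated) (x y : Y.carrier) :
    @Continuous _ _ (sigmaWeakAlg N) (sigmaWeakAlg N) fun a => Y.ip x (Y.lact a y) := by
  let := sigmaWeakAlg N
  let := sigmaWeak H H
  let := sigmaWeak (Ind Y) (Ind Y)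
  refine continuous_induced_rng.2 ?_
  have h1 := (continuous_conj_sigmaWeak (creation Y y) (creation Y x).adjoint).comp hY.continuous
  convert h1 using 1
  funext a
  change (Y.ip x (Y.lact a y) : H →L[ℂ] H) = _
  rw [← creation_adjoint_comp, ← indRep_comp_creation]
  rfl

theorem PreCorr.IsSaturated.isWStar (hY : Y.IsSaturated) (hl : (leftInd Y).IsGenerated) :
    Y.IsWStar where
  definite := hY.definite
  complete := hY.complete
  selfDual _ hφ hb := hY.selfDual hφ hb
  normal := continuous_ip_lact hl

end WStar

/-! ### Generating sets of tensor products -/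

section TensorGenerates

variable (X Y : PreCorr M.commutant)

/-- The elementary tensors of the algebraic tensor product, as a bilinear map. -/
def algTmul {N : VonNeumannAlgebra H} (X Y : PreCorr N) :
    X.carrier →ₗ[ℂ] Y.carrier →ₗ[ℂ] (algTensor X Y).carrier :=
  TensorProduct.mk ℂ X.carrier Y.carrier

theorem algTensor_ip {N : VonNeumannAlgebra H} (X Y : PreCorr N) (x x' : X.carrier)
    (y y' : Y.carrier) : (algTensor X Y).ip (algTmul X Y x y) (algTmul X Y x' y')
      = Y.ip y (Y.lact (X.ip x x') y') := rfl

theorem algTensor_induction {N : VonNeumannAlgebra H} {X Y : PreCorr N}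
    {p : (algTensor X Y).carrier → Prop} (h0 : p 0) (hadd : ∀ z w, p z → p w → p (z + w))
    (ht : ∀ x y, p (algTmul X Y x y)) (z : (algTensor X Y).carrier) : p z :=
  TensorProduct.induction_on z h0 ht hadd

/-- The linear map `z ↦ x ⊗ z` from the algebraic `Y ⊗ H` to the Hilbert space `(X ⊗ Y) ⊗ H`. -/
def tensorLeftAlg (x : X.carrier) : Y.carrier ⊗[ℂ] H →ₗ[ℂ] Ind (algTensor X Y) :=
  (indKernel (algTensor X Y)).toSpace ∘ₗ LinearMap.rTensor H (algTmul X Y x)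

theorem tensorLeftAlg_tmul (x : X.carrier) (y : Y.carrier) (h : H) :
    tensorLeftAlg X Y x (y ⊗ₜ h) = (indKernel (algTensor X Y)).tmul (algTmul X Y x y) h := rfl

theorem inner_tensorLeftAlg (x x' : X.carrier) (z z' : Y.carrier ⊗[ℂ] H) :
    ⟪tensorLeftAlg X Y x z, tensorLeftAlg X Y x' z'⟫_ℂ
      = ⟪(indKernel Y).toSpace z, indRep Y (X.ip x x') ((indKernel Y).toSpace z')⟫_ℂ := by
  induction z using TensorProduct.induction_on with
  | zero => simp only [map_zero, inner_zero_left]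
  | add z w hz hw => simp only [map_add, inner_add_left, hz, hw]
  | tmul y h =>
    induction z' using TensorProduct.induction_on with
    | zero => simp only [map_zero, inner_zero_right]
    | add z w hz hw => simp only [map_add, inner_add_right, hz, hw]
    | tmul y' h' =>
      rw [tensorLeftAlg_tmul, tensorLeftAlg_tmul, PosKernel.inner_tmul]
      change _ = ⟪(indKernel Y).tmul y h, indRep Y (X.ip x x') ((indKernel Y).tmul y' h')⟫_ℂ
      rw [indRep_tmul, PosKernel.inner_tmul, indKernel_ker, indKernel_ker, algTensor_ip]

/-- The operator `y ⊗ h ↦ (x ⊗ y) ⊗ h` from `Y ⊗ H` to `(X ⊗ Y) ⊗ H`. -/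
def tensorLeft (x : X.carrier) : Ind Y →L[ℂ] Ind (algTensor X Y) :=
  (indKernel Y).lift (tensorLeftAlg X Y x)

theorem tensorLeft_toSpace (x : X.carrier) (z : Y.carrier ⊗[ℂ] H) :
    tensorLeft X Y x ((indKernel Y).toSpace z) = tensorLeftAlg X Y x z := by
  refine (indKernel Y).lift_toSpace _ (√‖indRep Y (X.ip x x)‖) (fun z => ?_) z
  refine (sq_le_sq₀ (norm_nonneg _) (by positivity)).1 ?_
  rw [mul_pow, Real.sq_sqrt (norm_nonneg _), norm_sq_eq_re_inner_self, inner_tensorLeftAlg]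
  refine (Complex.re_le_norm _).trans ((norm_inner_le_norm _ _).trans ?_)
  rw [sq, ← mul_assoc, mul_comm ‖indRep Y (X.ip x x)‖, mul_assoc]
  gcongr
  exact ContinuousLinearMap.le_opNorm _ _

theorem tensorLeft_tmul (x : X.carrier) (y : Y.carrier) (h : H) :
    tensorLeft X Y x ((indKernel Y).tmul y h)
      = (indKernel (algTensor X Y)).tmul (algTmul X Y x y) h :=
  tensorLeft_toSpace X Y x _

theorem inner_tensorLeft (x x' : X.carrier) (z z' : Ind Y) :
    ⟪tensorLeft X Y x z, tensorLeft X Y x' z'⟫_ℂ = ⟪z, indRep Y (X.ip x x') z'⟫_ℂ := by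
  refine (indKernel Y).denseRange_toSpace.induction_on₂
    (p := fun z z' => ⟪tensorLeft X Y x z, tensorLeft X Y x' z'⟫_ℂ
      = ⟪z, indRep Y (X.ip x x') z'⟫_ℂ)
    (isClosed_eq (by fun_prop) (by fun_prop)) (fun z z' => ?_) z z'
  rw [tensorLeft_toSpace, tensorLeft_toSpace, inner_tensorLeftAlg]

theorem tensorLeft_add (x x' : X.carrier) :
    tensorLeft X Y (x + x') = tensorLeft X Y x + tensorLeft X Y x' :=
  (indKernel Y).hom_ext fun y h => by
    rw [add_apply, tensorLeft_tmul, tensorLeft_tmul, tensorLeft_tmul, ← PosKernel.add_tmul,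
      map_add, LinearMap.add_apply]

theorem tensorLeft_smul (c : ℂ) (x : X.carrier) :
    tensorLeft X Y (c • x) = c • tensorLeft X Y x :=
  (indKernel Y).hom_ext fun y h => by
    rw [smul_apply, tensorLeft_tmul, tensorLeft_tmul, ← PosKernel.smul_tmul,
      map_smul, LinearMap.smul_apply]

variable {X Y}

theorem adjoint_comp_mem_bicommutant {B : H →L[ℂ] Ind Y}
    (hB : B ∈ VNRep.Hom (idRep M.commutant) (leftInd Y)) :
    B.adjoint ∘L B ∈ M.toStarSubalgebra :=
  let B' : VNRep.Hom (idRep M.commutant) (leftInd Y) := ⟨B, hB⟩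
  mem_of_forall_commutant fun R => ((VNRep.Hom.comp (VNRep.Hom.adj B') B').2 R).symm

/-- The linear map `x ⊗ h ↦ x ⊗ B h` from the algebraic `X ⊗ H` to `(X ⊗ Y) ⊗ H`, for an operator
`B : H → Y ⊗ H`. -/
def tensorRightAlg (X Y : PreCorr M.commutant) (B : H →L[ℂ] Ind Y) :
    X.carrier ⊗[ℂ] H →ₗ[ℂ] Ind (algTensor X Y) :=
  TensorProduct.lift (LinearMap.mk₂ ℂ (fun x h => tensorLeft X Y x (B h))
    (fun x x' h => by rw [tensorLeft_add, add_apply])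
    (fun c x h => by rw [tensorLeft_smul, smul_apply])
    (fun x h h' => by rw [map_add, map_add]) (fun c x h => by rw [map_smul, map_smul]))

theorem tensorRightAlg_tmul (B : H →L[ℂ] Ind Y) (x : X.carrier) (h : H) :
    tensorRightAlg X Y B (x ⊗ₜ h) = tensorLeft X Y x (B h) := rfl

theorem inner_tensorRightAlg {B : H →L[ℂ] Ind Y}
    (hB : B ∈ VNRep.Hom (idRep M.commutant) (leftInd Y)) (z z' : X.carrier ⊗[ℂ] H) :
    ⟪tensorRightAlg X Y B z, tensorRightAlg X Y B z'⟫_ℂ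
      = ⟪(indKernel X).toSpace z, (rightInd X).π ⟨_, adjoint_comp_mem_bicommutant hB⟩
        ((indKernel X).toSpace z')⟫_ℂ := by
  induction z using TensorProduct.induction_on with
  | zero => simp only [map_zero, inner_zero_left]
  | add z w hz hw => simp only [map_add, inner_add_left, hz, hw]
  | tmul x h =>
    induction z' using TensorProduct.induction_on with
    | zero => simp only [map_zero, inner_zero_right]
    | add z w hz hw => simp only [map_add, inner_add_right, hz, hw]
    | tmul x' h' =>
      rw [tensorRightAlg_tmul, tensorRightAlg_tmul, inner_tensorLeft]
      change _ = ⟪(indKernel X).tmul x h, (rightInd X).π _ ((indKernel X).tmul x' h')⟫_ℂ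
      rw [rightInd_tmul, PosKernel.inner_tmul, indKernel_ker]
      have h1 : (X.ip x x' : H →L[ℂ] H) ((B.adjoint ∘L B) h')
          = B.adjoint (indRep Y (X.ip x x') (B h')) := by
        have e1 := DFunLike.congr_fun (mul_comm_of_mem_commutant
          ⟨_, adjoint_comp_mem_bicommutant hB⟩ (X.ip x x')) h'
        refine e1.trans ?_
        exact congrArg B.adjoint (DFunLike.congr_fun (hB (X.ip x x')) h')
      exact ((congrArg (inner ℂ h) h1).trans
        (ContinuousLinearMap.adjoint_inner_right B _ _)).symm

/-- The operator `x ⊗ h ↦ x ⊗ B h` from `X ⊗ H` to `(X ⊗ Y) ⊗ H`, for an intertwiner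
`B : H → Y ⊗ H` of the actions of `M'`. -/
def tensorRight (X Y : PreCorr M.commutant) (B : H →L[ℂ] Ind Y) :
    Ind X →L[ℂ] Ind (algTensor X Y) :=
  (indKernel X).lift (tensorRightAlg X Y B)

theorem tensorRight_tmul {B : H →L[ℂ] Ind Y}
    (hB : B ∈ VNRep.Hom (idRep M.commutant) (leftInd Y)) (x : X.carrier) (h : H) :
    tensorRight X Y B ((indKernel X).tmul x h) = tensorLeft X Y x (B h) := by
  refine (indKernel X).lift_toSpace (tensorRightAlg X Y B)
    (√‖(rightInd X).π ⟨_, adjoint_comp_mem_bicommutant hB⟩‖) (fun z => ?_) (x ⊗ₜ h)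
  refine (sq_le_sq₀ (norm_nonneg _) (by positivity)).1 ?_
  rw [mul_pow, Real.sq_sqrt (norm_nonneg _), norm_sq_eq_re_inner_self, inner_tensorRightAlg hB]
  refine (Complex.re_le_norm _).trans ((norm_inner_le_norm _ _).trans ?_)
  rw [sq, ← mul_assoc, mul_comm ‖(rightInd X).π _‖, mul_assoc]
  gcongr
  exact ContinuousLinearMap.le_opNorm _ _

/-- The elementary tensors of generators generate the tensor product, if the left action on the
second factor is normal: a vector orthogonal to them is orthogonal to all `d ⊗ z`, `z ∈ Y ⊗ H`, as
the second set generates; in particular to the `d ⊗ B h`, `B` an intertwiner of `H` and `Y ⊗ H`;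
hence to all `x ⊗ B h`, as the first set generates; and the `B h` span `Y ⊗ H` by normality. -/
theorem PreCorr.Generates.algTensor {D₁ : Set X.carrier} {D₂ : Set Y.carrier}
    (h₁ : X.Generates D₁) (h₂ : Y.Generates D₂) (hl : (leftInd Y).IsGenerated) :
    (algTensor X Y).Generates {z | ∃ d₁ ∈ D₁, ∃ d₂ ∈ D₂, z = algTmul X Y d₁ d₂} := by
  intro w hw
  have s1 : ∀ d ∈ D₁, (tensorLeft X Y d).adjoint w = 0 := fun d hd => h₂ _ fun d' hd' h => by
    rw [ContinuousLinearMap.adjoint_inner_right, tensorLeft_tmul]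
    exact hw _ ⟨d, hd, d', hd', rfl⟩ h
  have s2 : ∀ B ∈ VNRep.Hom (idRep M.commutant) (leftInd Y), (tensorRight X Y B).adjoint w = 0 :=
    fun B hB => h₁ _ fun d hd h => by
      rw [ContinuousLinearMap.adjoint_inner_right, tensorRight_tmul hB,
        ← ContinuousLinearMap.adjoint_inner_right, s1 d hd]
      exact inner_zero_right _
  have s3 : ∀ x, (tensorLeft X Y x).adjoint w = 0 := fun x => hl _ fun B hB h => by
    rw [ContinuousLinearMap.adjoint_inner_right, ← tensorRight_tmul hB,
      ← ContinuousLinearMap.adjoint_inner_right, s2 B hB]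
    exact inner_zero_right _
  refine (indKernel (CPSemi.algTensor X Y)).eq_zero_of_inner_tmul fun z h => ?_
  rw [← creation_apply]
  refine algTensor_induction (p := fun z => ⟪creation (CPSemi.algTensor X Y) z h, w⟫_ℂ = 0)
    ?_ (fun z z' hz hz' => ?_) (fun x y => ?_) z
  · rw [map_zero]
    exact inner_zero_left _
  · rw [map_add, add_apply, inner_add_left, hz, hz', add_zero]
  · rw [creation_apply, ← tensorLeft_tmul, ← ContinuousLinearMap.adjoint_inner_right, s3]
    exact inner_zero_right _

/-- Inner product preserving bimodule maps `X → X'`, `Y → Y'` with generating ranges induce an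
isomorphism of the algebraic tensor product, completed, with `X' ⊗ Y'`. -/
theorem exists_tensorIso {X' Y' : PreCorr M.commutant} (f : X.carrier →ₗ[ℂ] X'.carrier)
    (hf : ∀ x z, X'.ip (f x) (f z) = X.ip x z) (hfl : ∀ a x, f (X.lact a x) = X'.lact a (f x))
    (hfg : X'.Generates (Set.range f)) (g : Y.carrier →ₗ[ℂ] Y'.carrier)
    (hg : ∀ x z, Y'.ip (g x) (g z) = Y.ip x z) (hgl : ∀ a x, g (Y.lact a x) = Y'.lact a (g x))
    (hgg : Y'.Generates (Set.range g)) (hl : (leftInd Y').IsGenerated) :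
    ∃ α : PreCorr.Iso (tensor X Y) (tensor X' Y'), ∀ x y, α (tmul x y) = tmul (f x) (g y) := by
  let j : (CPSemi.algTensor X Y).carrier →ₗ[ℂ] (tensor X' Y').carrier :=
    toCompletion (CPSemi.algTensor X' Y') ∘ₗ TensorProduct.map f g
  have h₁ : ∀ z z', (tensor X' Y').ip (j z) (j z') = (CPSemi.algTensor X Y).ip z z' := by
    intro z z'
    refine (ip_toCompletion _ _ _).trans ?_
    refine tensorIp_induction X Y (p := fun z z' => tensorIp X' Y' (TensorProduct.map f g z)
      (TensorProduct.map f g z') = tensorIp X Y z z') (by simp) (by simp)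
      (fun z z' w h h' => by simp [h, h']) (fun z w w' h h' => by simp [h, h'])
      (fun x y x' y' => ?_) z z'
    rw [TensorProduct.map_tmul, TensorProduct.map_tmul, tensorIp_tmul, tensorIp_tmul, hf, ← hgl,
      hg]
  have h₂ : ∀ a z, j ((CPSemi.algTensor X Y).lact a z) = (tensor X' Y').lact a (j z) := by
    intro a z
    refine (congrArg (toCompletion (CPSemi.algTensor X' Y')) ?_).trans (toCompletion_lact _ a _)
    change TensorProduct.map f g ((X.lact a).rTensor _ z)
      = (X'.lact a).rTensor _ (TensorProduct.map f g z)
    refine LinearMap.congr_fun (f := TensorProduct.map f g ∘ₗ (X.lact a).rTensor _)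
      (g := (X'.lact a).rTensor _ ∘ₗ TensorProduct.map f g) (TensorProduct.ext' fun x y => ?_) z
    simp [hfl]
  have h₃ : (tensor X' Y').Generates (Set.range j) := by
    refine (hfg.algTensor hgg hl).completion.mono ?_
    rintro _ ⟨_, ⟨_, ⟨x, rfl⟩, _, ⟨y, rfl⟩, rfl⟩, rfl⟩
    exact ⟨algTmul X Y x y, rfl⟩
  obtain ⟨α, hα⟩ := exists_completionIso (isSaturated_completion _) j h₁ h₂ h₃
  exact ⟨α, fun x y => hα (algTmul X Y x y)⟩

theorem PreCorr.generates_range_iso {N : VonNeumannAlgebra H} {X Y : PreCorr N}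
    (f : PreCorr.Iso X Y) : Y.Generates (Set.range f) := by
  rw [Set.range_eq_univ.2 f.toEquiv.surjective]
  exact Y.generates_univ

theorem PreCorr.generates_range_toCompletion {N : VonNeumannAlgebra H} (X : PreCorr N) :
    (completion X).Generates (Set.range (toCompletion X)) := by
  rw [← Set.image_univ]
  exact X.generates_univ.completion

/-- The tensor product of isomorphisms. -/
theorem exists_tensorCongr {X' Y' : PreCorr M.commutant} (f : PreCorr.Iso X X')
    (g : PreCorr.Iso Y Y') (hl : (leftInd Y').IsGenerated) :
    ∃ α : PreCorr.Iso (tensor X Y) (tensor X' Y'), ∀ x y, α (tmul x y) = tmul (f x) (g y) :=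
  exists_tensorIso f.toEquiv.toLinearMap f.map_ip f.map_lact (PreCorr.generates_range_iso f)
    g.toEquiv.toLinearMap g.map_ip g.map_lact (PreCorr.generates_range_iso g) hl

/-- The completed tensor product is not changed by completing the factors. -/
theorem exists_tensorCompletionIso (hl : (leftInd Y).IsGenerated) :
    ∃ α : PreCorr.Iso (tensor X Y) (tensor (completion X) (completion Y)),
      ∀ x y, α (tmul x y) = tmul (toCompletion X x) (toCompletion Y y) :=
  exists_tensorIso (toCompletion X) (ip_toCompletion X) (toCompletion_lact X)
    X.generates_range_toCompletion (toCompletion Y) (ip_toCompletion Y) (toCompletion_lact Y)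
    Y.generates_range_toCompletion (isGenerated_leftInd_completion hl)

end TensorGenerates

/-! ### Normality of the representations on the spaces `H_𝔭` -/

section StineGenerated

/-- If `‖T v‖ ≤ ‖T ξ‖` for all `T ∈ N`, then `v` is the image of `ξ` under an intertwiner. -/
theorem VNRep.exists_hom_of_norm_le {N : VonNeumannAlgebra H} {A B : VNRep N} (v : A.K) (ξ : B.K)
    (h : ∀ T, ‖A.π T v‖ ≤ ‖B.π T ξ‖) : ∃ V : VNRep.Hom B A, V.1 ξ = v := by
  let e : Alg N →ₗ[ℂ] B.cyclic ξ := (B.orbit ξ).codRestrict _ (B.orbit_mem_cyclic ξ)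
  have he : DenseRange e := fun x => by
    have hx : (x : B.K) ∈ closure (LinearMap.range (B.orbit ξ) : Set B.K) := x.2
    refine closure_subtype.2 (closure_mono ?_ hx)
    rintro _ ⟨T, rfl⟩
    exact ⟨e T, ⟨T, rfl⟩, rfl⟩
  let V₀ : B.cyclic ξ →L[ℂ] A.K := (A.orbit v).extendOfNorm e
  have hV₀ : ∀ T, V₀ (e T) = A.π T v := fun T =>
    LinearMap.extendOfNorm_eq he ⟨1, fun T => by rw [one_mul]; exact h T⟩ T
  have hV₁ : ∀ T, ∀ x : B.cyclic ξ,
      V₀ ⟨B.π T x, B.apply_mem_cyclic x.2 T⟩ = A.π T (V₀ x) := by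
    intro T x
    refine he.induction_on (p := fun x : B.cyclic ξ =>
      V₀ ⟨B.π T x, B.apply_mem_cyclic x.2 T⟩ = A.π T (V₀ x)) x
      (isClosed_eq (by fun_prop) (by fun_prop)) fun S => ?_
    have e1 : (⟨B.π T (e S), B.apply_mem_cyclic (e S).2 T⟩ : B.cyclic ξ) = e (T * S) :=
      Subtype.ext (by
        change B.π T (B.π S ξ) = B.π (T * S) ξ
        rw [map_mul, mul_apply_eq_comp])
    rw [e1, hV₀, hV₀, map_mul, mul_apply_eq_comp]
  refine ⟨⟨V₀ ∘L (B.cyclic ξ).orthogonalProjectionOnto, fun T => ContinuousLinearMap.ext fun x => ?_⟩,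
    ?_⟩
  · rw [ContinuousLinearMap.comp_apply, ContinuousLinearMap.comp_apply,
      ContinuousLinearMap.comp_apply, ContinuousLinearMap.comp_apply, ← hV₁]
    exact congrArg V₀ (Subtype.ext (B.cyclicProj_apply ξ x T))
  · have e1 : (B.cyclic ξ).orthogonalProjectionOnto ξ = e 1 := Subtype.ext (by
      change B.cyclicProj ξ ξ = B.π 1 ξ
      rw [map_one, B.cyclicProj_self]
      rfl)
    rw [ContinuousLinearMap.comp_apply, e1, hV₀, map_one, one_apply_eq_self]

theorem seminorm_le_of_ball {V : Type*} [AddCommGroup V] [Module ℂ V] (p q : Seminorm ℂ V) {ε : ℝ}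
    (hε : 0 < ε) (h : ∀ x, q x < ε → p x ≤ 1) (x : V) : p x ≤ ε⁻¹ * q x := by
  refine le_of_forall_pos_le_add fun δ hδ => ?_
  have hq : 0 ≤ q x := apply_nonneg q x
  have hpos : 0 < q x + ε * δ := by positivity
  have h1 := h (((ε / (q x + ε * δ) : ℝ) : ℂ) • x) (by
    rw [map_smul_eq_mul, Complex.norm_real, Real.norm_of_nonneg (by positivity), div_mul_eq_mul_div,
      div_lt_iff₀ hpos]
    have := mul_pos hε hδ
    nlinarith)
  rw [map_smul_eq_mul, Complex.norm_real, Real.norm_of_nonneg (by positivity), div_mul_eq_mul_div,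
    div_le_iff₀ hpos, one_mul] at h1
  rw [← mul_le_mul_iff_of_pos_left hε, mul_add, ← mul_assoc, mul_inv_cancel₀ hε.ne', one_mul]
  exact h1

/-- A normal vector state is dominated by the vector state of a square-summable family in `H`: by
continuity at `0` finitely many pairings control `⟨v, T* T v⟩ = ‖T v‖²`. -/
theorem VNRep.exists_ell2_norm_le {N : VonNeumannAlgebra H} (A : VNRep N) (v : A.K)
    (hv : @Continuous _ _ (sigmaWeakAlg N) _ fun T => ⟪v, A.π T v⟫_ℂ) :
    ∃ (ι : Type) (ζ : Ell2 ι H), ∀ T, ‖A.π T v‖ ≤ ‖(VNRep.ell2 ι (idRep N)).π T ζ‖ := by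
  obtain ⟨o, ho, hoU⟩ := (@isOpen_induced_iff _ _ (sigmaWeak H H) _ _).1
    (@Continuous.isOpen_preimage _ _ (sigmaWeakAlg N) _ _ hv _
      (Metric.isOpen_ball (x := (0 : ℂ)) (ε := 1)))
  have hmem : ∀ T : Alg N, (T : H →L[ℂ] H) ∈ o ↔ ‖⟪v, A.π T v⟫_ℂ‖ < 1 := fun T => by
    have := congrArg (T ∈ ·) hoU
    simp only [Set.mem_preimage, mem_ball_zero_iff] at this
    exact Eq.to_iff this
  have h0 : (0 : H →L[ℂ] H) ∈ o := (hmem 0).2 (by simp)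
  obtain ⟨n, ξ, η, ε, hε, hδ⟩ := exists_pairings_of_isOpen ho h0
  let z := Ell2.join (Fin.append ξ η)
  let B : VNRep N := VNRep.ell2 (Fin (n + n) × ℕ) (idRep N)
  have hsq : ∀ T : Alg N, ‖A.π T v‖ ^ 2 = ‖⟪v, A.π (star T * T) v⟫_ℂ‖ := fun T => by
    rw [map_mul, map_star, mul_apply_eq_comp, ContinuousLinearMap.star_eq_adjoint,
      ContinuousLinearMap.adjoint_inner_right, inner_self_eq_norm_sq_to_K]
    simp
  have key : ∀ T : Alg N, ‖B.π T z‖ < √ε → ‖A.π T v‖ ≤ 1 := by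
    intro T hT
    have hT' : ‖B.π T z‖ ^ 2 < ε := by
      rw [← Real.sq_sqrt hε.le]
      gcongr
    refine (sq_le_sq₀ (norm_nonneg _) zero_le_one).1 ?_
    rw [hsq, one_pow]
    refine ((hmem _).1 (hδ _ fun i => ?_)).le
    rw [sub_zero]
    have e1 : Ell2.map ℕ ((star T * T : Alg N) : H →L[ℂ] H) (ξ i)
        = Ell2.map ℕ (T : H →L[ℂ] H).adjoint (Ell2.map ℕ (T : H →L[ℂ] H) (ξ i)) :=
      Ell2.ext fun _ => rfl
    have e2 := Ell2.inner_map (T : H →L[ℂ] H) (η i) (Ell2.map ℕ (T : H →L[ℂ] H) (ξ i))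
    have e3 := Ell2.norm_map_le_join (Fin.append ξ η) (Fin.castAdd n i) (T : H →L[ℂ] H)
    have e4 := Ell2.norm_map_le_join (Fin.append ξ η) (Fin.natAdd n i) (T : H →L[ℂ] H)
    rw [Fin.append_left] at e3
    rw [Fin.append_right] at e4
    -- `⟨η, T* T ξ⟩ = ⟨T η, T ξ⟩`, and `T ξ`, `T η` are parts of the orbit of the joined family
    rw [e1, ← e2]
    refine ((norm_inner_le_norm _ _).trans (mul_le_mul e4 e3 (norm_nonneg _)
      (norm_nonneg _))).trans_lt ?_
    rw [← sq]
    exact hT'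
  refine ⟨_, (((√ε)⁻¹ : ℝ) : ℂ) • z, fun T => ?_⟩
  have := seminorm_le_of_ball ((normSeminorm ℂ A.K).comp (A.orbit v))
    ((normSeminorm ℂ B.K).comp (B.orbit z)) (Real.sqrt_pos.2 hε) key T
  refine this.trans_eq ?_
  rw [map_smul, norm_smul, Complex.norm_real, Real.norm_of_nonneg (by positivity)]
  rfl

/-- The operator `k ↦ v ⊗ k`. -/
def PosKernel.tmulLeft {V K : Type u} [AddCommGroup V] [Module ℂ V] [NormedAddCommGroup K]
    [InnerProductSpace ℂ K] [CompleteSpace K] (κ : PosKernel V K) (v : V) : K →L[ℂ] κ.Space :=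
  LinearMap.mkContinuous
    { toFun := κ.tmul v
      map_add' := κ.tmul_add v
      map_smul' := fun c => κ.tmul_smul c v } (√‖κ.ker v v‖) fun k => by
    refine (sq_le_sq₀ (norm_nonneg _) (by positivity)).1 ?_
    rw [mul_pow, Real.sq_sqrt (norm_nonneg _), norm_sq_eq_re_inner_self]
    change (⟪κ.tmul v k, κ.tmul v k⟫_ℂ).re ≤ _
    rw [κ.inner_tmul]
    refine (Complex.re_le_norm _).trans ((norm_inner_le_norm _ _).trans ?_)
    rw [sq, ← mul_assoc, mul_comm ‖κ.ker v v‖, mul_assoc]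
    gcongr
    exact ContinuousLinearMap.le_opNorm _ _

theorem PosKernel.tmulLeft_apply {V K : Type u} [AddCommGroup V] [Module ℂ V]
    [NormedAddCommGroup K] [InnerProductSpace ℂ K] [CompleteSpace K] (κ : PosKernel V K) (v : V)
    (k : K) : κ.tmulLeft v k = κ.tmul v k := rfl

theorem continuous_inner_NCPMap (P : NCPMap M) (h : H) :
    @Continuous _ _ (sigmaWeakAlg M) _ fun T => ⟪h, (P.toLin T : H →L[ℂ] H) h⟫_ℂ := by
  let := sigmaWeak H H
  let := sigmaWeakAlg M
  exact (continuous_vector h h).comp (continuous_induced_dom.comp P.normal)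

/-- The Stinespring representation of a normal completely positive map is normal: the vector state
of `1 ⊗ h` is `T ↦ ⟨h, P(T) h⟩`, and the vectors `T (1 ⊗ h)` span. -/
theorem isGenerated_stine_idRep (P : NCPMap M) : (stine P (idRep M)).IsGenerated := fun w hw => by
  refine (stineKernel P (idRep M)).eq_zero_of_inner_tmul fun T h => ?_
  have e : ∀ S T, (stine P (idRep M)).π S ((stineKernel P (idRep M)).tmul T h)
    = (stineKernel P (idRep M)).tmul (S * T) h := fun S T => stine_π_tmul P (idRep M) S T h
  obtain ⟨ι, ζ, hζ⟩ := (stine P (idRep M)).exists_ell2_norm_le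
    ((stineKernel P (idRep M)).tmul 1 h) (by
      have h1 : ∀ T, ⟪(stineKernel P (idRep M)).tmul 1 h,
          (stine P (idRep M)).π T ((stineKernel P (idRep M)).tmul 1 h)⟫_ℂ
          = ⟪h, (P.toLin T : H →L[ℂ] H) h⟫_ℂ := fun T => by
        rw [e, PosKernel.inner_tmul, stineKernel_ker, star_one, one_mul, mul_one]
        rfl
      simp only [h1]
      exact continuous_inner_NCPMap P h)
  obtain ⟨V, hV⟩ := VNRep.exists_hom_of_norm_le _ _ hζ
  rw [← mul_one T, ← e, ← hV, ← VNRep.Hom.apply V]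
  exact inner_hom_ell2_eq_zero V _ hw

/-- The general case follows from that of the identity representation, as `I ⊗ Y` maps `M ⊗ H` to
`M ⊗ A` for each intertwiner `Y` from `H` to `A`. -/
theorem isGenerated_stine (P : NCPMap M) {A : VNRep M} (hA : A.IsGenerated) :
    (stine P A).IsGenerated := fun w hw => by
  refine (stineKernel P A).eq_zero_of_inner_tmul fun T k => ?_
  have h1 : ∀ Y ∈ VNRep.Hom (idRep M) A, ∀ h, ⟪(stineKernel P A).tmul T (Y h), w⟫_ℂ = 0 := by
    intro Y hY h
    have h2 : (stineMap P (⟨Y, hY⟩ : VNRep.Hom (idRep M) A)).1.adjoint w = 0 :=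
      isGenerated_stine_idRep P _ fun X hX h => by
        rw [ContinuousLinearMap.adjoint_inner_right]
        exact hw _ (VNRep.Hom.comp (stineMap P (⟨Y, hY⟩ : VNRep.Hom (idRep M) A)) ⟨X, hX⟩).2 h
    rw [← stineMap_tmul P (⟨Y, hY⟩ : VNRep.Hom (idRep M) A),
      ← ContinuousLinearMap.adjoint_inner_right, h2]
    exact inner_zero_right _
  have h2 : ((stineKernel P A).tmulLeft T).adjoint w = 0 := hA _ fun Y hY h => by
    rw [ContinuousLinearMap.adjoint_inner_right]
    exact h1 Y hY h
  rw [← PosKernel.tmulLeft_apply, ← ContinuousLinearMap.adjoint_inner_right, h2]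
  exact inner_zero_right _

theorem isGenerated_idRep (N : VonNeumannAlgebra H) : (idRep N).IsGenerated := fun _ hw =>
  ext_inner_left ℂ fun h => (hw _ (VNRep.Hom.id (idRep N)).2 h).trans (inner_zero_right _).symm

variable (Φ : CPSemigroup M)

/-- The representation of `M` on `H_𝔭` is normal. -/
theorem isGenerated_HPart (l : List ℝ≥0) : (HPart Φ l).IsGenerated := by
  induction l with
  | nil => exact isGenerated_idRep M
  | cons d l ih => exact isGenerated_stine _ ih

/-- The representation `I ⊗ R` of `M'` on `H_𝔭`. -/
@[reducible] def ampRep (l : List ℝ≥0) : VNRep M.commutant where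
  K := (HPart Φ l).K
  π :=
    { toFun := fun R => (amp Φ R l).1
      map_one' := by rw [amp_one]; rfl
      map_mul' := fun R R' => by rw [amp_mul]; rfl
      map_zero' := by
        have h := amp_smul Φ 0 0 l
        rw [zero_smul, zero_smul] at h
        rw [h]
        rfl
      map_add' := fun R R' => by rw [amp_add]; rfl
      commutes' := fun c => by
        rw [Algebra.algebraMap_eq_smul_one, amp_smul, amp_one]
        rfl
      map_star' := fun R => by rw [amp_star]; rfl }

/-- The operators `h ↦ T₁ ⊗ ⋯ ⊗ Tₙ ⊗ h` intertwine the actions of `M'`, and their ranges span. -/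
theorem isGenerated_ampRep (l : List ℝ≥0) : (ampRep Φ l).IsGenerated := by
  induction l with
  | nil => exact isGenerated_idRep _
  | cons d l ih =>
    intro w hw
    refine (stineKernel (Φ.P d) (HPart Φ l)).eq_zero_of_inner_tmul fun T k => ?_
    have h2 : ((stineKernel (Φ.P d) (HPart Φ l)).tmulLeft T).adjoint w = 0 := ih _ fun Y hY h => by
      rw [ContinuousLinearMap.adjoint_inner_right]
      refine hw ((stineKernel (Φ.P d) (HPart Φ l)).tmulLeft T ∘L Y) (fun R => ?_) h
      refine ContinuousLinearMap.ext fun h => ?_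
      change (stineKernel (Φ.P d) (HPart Φ l)).tmul T (Y ((R : H →L[ℂ] H) h))
        = (amp Φ R (d :: l)).1 ((stineKernel (Φ.P d) (HPart Φ l)).tmul T (Y h))
      rw [amp_cons, stineMap_tmul]
      exact congrArg _ (DFunLike.congr_fun (hY R) h)
    rw [← PosKernel.tmulLeft_apply, ← ContinuousLinearMap.adjoint_inner_right, h2]
    exact inner_zero_right _

end StineGenerated

/-! ### Isomorphisms out of tensor products -/

section TensorIso

variable {X Y Z : PreCorr M.commutant}

/-- A balanced bilinear map to a saturated correspondence that preserves inner products and has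
generating range induces an isomorphism of the tensor product. -/
theorem exists_tensorIso_of_bilin (hZ : Z.IsSaturated)
    (b : X.carrier →ₗ[ℂ] Y.carrier →ₗ[ℂ] Z.carrier)
    (hb : ∀ x y x' y', Z.ip (b x y) (b x' y') = Y.ip y (Y.lact (X.ip x x') y'))
    (hl : ∀ a x y, b (X.lact a x) y = Z.lact a (b x y))
    (hg : Z.Generates {z | ∃ x y, z = b x y}) :
    ∃ α : PreCorr.Iso (tensor X Y) Z, ∀ x y, α (tmul x y) = b x y := by
  let j : (algTensor X Y).carrier →ₗ[ℂ] Z.carrier := TensorProduct.lift b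
  have hj : ∀ x y, j (algTmul X Y x y) = b x y := fun x y => TensorProduct.lift.tmul x y
  have h₁ : ∀ z z', Z.ip (j z) (j z') = (algTensor X Y).ip z z' := by
    intro z z'
    refine tensorIp_induction X Y (p := fun z z' => Z.ip (TensorProduct.lift b z)
      (TensorProduct.lift b z') = tensorIp X Y z z') (by simp) (by simp)
      (fun z z' w h h' => by simp [h, h']) (fun z w w' h h' => by simp [h, h'])
      (fun x y x' y' => ?_) z z'
    rw [TensorProduct.lift.tmul, TensorProduct.lift.tmul, tensorIp_tmul, hb]
  have h₂ : ∀ a z, j ((algTensor X Y).lact a z) = Z.lact a (j z) := by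
    intro a z
    refine LinearMap.congr_fun (f := TensorProduct.lift b ∘ₗ (X.lact a).rTensor _)
      (g := Z.lact a ∘ₗ TensorProduct.lift b) (TensorProduct.ext' fun x y => ?_) z
    simp [hl]
  obtain ⟨α, hα⟩ := exists_completionIso hZ j h₁ h₂ (hg.mono (by
    rintro _ ⟨x, y, rfl⟩
    exact ⟨algTmul X Y x y, hj x y⟩))
  exact ⟨α, fun x y => (hα (algTmul X Y x y)).trans (hj x y)⟩

/-- The elementary tensors of generators generate the completed tensor product. -/
theorem PreCorr.Generates.tensor {D₁ : Set X.carrier} {D₂ : Set Y.carrier}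
    (h₁ : X.Generates D₁) (h₂ : Y.Generates D₂) (hl : (leftInd Y).IsGenerated) :
    (CPSemi.tensor X Y).Generates {z | ∃ d₁ ∈ D₁, ∃ d₂ ∈ D₂, z = tmul d₁ d₂} := by
  refine (h₁.algTensor h₂ hl).completion.mono ?_
  rintro _ ⟨_, ⟨d₁, hd₁, d₂, hd₂, rfl⟩, rfl⟩
  exact ⟨d₁, hd₁, d₂, hd₂, rfl⟩

/-- Isomorphisms that agree on a generating set are equal. -/
theorem PreCorr.Iso.eq_of_eqOn {N : VonNeumannAlgebra H} {X Z : PreCorr N} {D : Set X.carrier}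
    (hD : X.Generates D) (hZ : ∀ z, Z.ip z z = 0 → z = 0) (f g : PreCorr.Iso X Z)
    (hfg : ∀ d ∈ D, f d = g d) (x : X.carrier) : f x = g x :=
  eq_of_eqOn_generates hD hZ (f := f.toEquiv.toLinearMap) (g := g.toEquiv.toLinearMap) f.map_ip
    g.map_ip hfg x

theorem isGenerated_leftInd_algTensor (hX : (leftInd X).IsGenerated)
    (hY : (leftInd Y).IsGenerated) : (leftInd (algTensor X Y)).IsGenerated := fun w hw => by
  have s2 : ∀ B ∈ VNRep.Hom (idRep M.commutant) (leftInd Y), (tensorRight X Y B).adjoint w = 0 :=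
    fun B hB => hX _ fun S hS h => by
      have hmem : tensorRight X Y B ∈ VNRep.Hom (leftInd X) (leftInd (algTensor X Y)) := fun a =>
        (indKernel X).hom_ext fun x h => by
          rw [ContinuousLinearMap.comp_apply, ContinuousLinearMap.comp_apply, indRep_tmul,
            tensorRight_tmul hB, tensorRight_tmul hB]
          refine DFunLike.congr_fun (f := tensorLeft X Y (X.lact a x))
            (g := indRep (algTensor X Y) a ∘L tensorLeft X Y x)
            ((indKernel Y).hom_ext fun y h => ?_) (B h)
          rw [ContinuousLinearMap.comp_apply, tensorLeft_tmul, tensorLeft_tmul, indRep_tmul]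
          rfl
      rw [ContinuousLinearMap.adjoint_inner_right]
      exact hw _ (VNRep.Hom.comp (⟨_, hmem⟩ : VNRep.Hom (leftInd X) (leftInd (algTensor X Y)))
        ⟨S, hS⟩).2 h
  refine X.generates_univ.algTensor Y.generates_univ hY w ?_
  rintro _ ⟨x, -, y, -, rfl⟩ h
  have s3 : (tensorLeft X Y x).adjoint w = 0 := hY _ fun B hB h => by
    rw [ContinuousLinearMap.adjoint_inner_right, ← tensorRight_tmul hB,
      ← ContinuousLinearMap.adjoint_inner_right, s2 B hB]
    exact inner_zero_right _
  rw [← tensorLeft_tmul, ← ContinuousLinearMap.adjoint_inner_right, s3]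
  exact inner_zero_right _

/-- The map `(x ⊗ y) ⊗ z ↦ x ⊗ (y ⊗ z)` from the algebraic tensor product to the completed one. -/
def algAssoc (X Y Z : PreCorr M.commutant) :
    (algTensor (algTensor X Y) Z).carrier →ₗ[ℂ] (tensor X (tensor Y Z)).carrier :=
  toCompletion (algTensor X (tensor Y Z)) ∘ₗ
    LinearMap.lTensor X.carrier (toCompletion (algTensor Y Z)) ∘ₗ
      (TensorProduct.assoc ℂ X.carrier Y.carrier Z.carrier).toLinearMap

theorem algAssoc_tmul (x : X.carrier) (y : Y.carrier) (z : Z.carrier) :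
    algAssoc X Y Z (algTmul _ Z (algTmul X Y x y) z) = tmul x (tmul y z) := rfl

theorem algTensor₃_hom_ext {W : Type*} [AddCommGroup W] [Module ℂ W]
    {f g : (algTensor (algTensor X Y) Z).carrier →ₗ[ℂ] W}
    (h : ∀ x y z, f (algTmul _ Z (algTmul X Y x y) z) = g (algTmul _ Z (algTmul X Y x y) z)) :
    f = g :=
  TensorProduct.ext_threefold h

theorem algTensor₃_hom_ext' {W : Type*} [AddCommGroup W] [Module ℂ W]
    {f g : (algTensor (algTensor X Y) Z).carrier →ₗ⋆[ℂ] W}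
    (h : ∀ x y z, f (algTmul _ Z (algTmul X Y x y) z) = g (algTmul _ Z (algTmul X Y x y) z)) :
    f = g := by
  refine LinearMap.ext fun t => ?_
  refine algTensor_induction (p := fun t => f t = g t) (by rw [map_zero, map_zero])
    (fun s t hs ht => by rw [map_add, map_add, hs, ht]) (fun s z => ?_) t
  refine algTensor_induction (p := fun s => f (algTmul _ Z s z) = g (algTmul _ Z s z))
    (by rw [map_zero, LinearMap.zero_apply, map_zero, map_zero])
    (fun s t hs ht => by rw [map_add, LinearMap.add_apply, map_add, map_add, hs, ht])
    (fun x y => h x y z) s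

theorem ip_algAssoc (s t : (algTensor (algTensor X Y) Z).carrier) :
    (tensor X (tensor Y Z)).ip (algAssoc X Y Z s) (algAssoc X Y Z t)
      = (algTensor (algTensor X Y) Z).ip s t := by
  have h1 : ∀ x y z, ((tensor X (tensor Y Z)).ip
      (algAssoc X Y Z (algTmul _ Z (algTmul X Y x y) z))) ∘ₗ algAssoc X Y Z
      = (algTensor (algTensor X Y) Z).ip (algTmul _ Z (algTmul X Y x y) z) := by
    intro x y z
    refine algTensor₃_hom_ext fun x' y' z' => ?_
    rw [LinearMap.comp_apply, algAssoc_tmul, algAssoc_tmul, algTensor_ip, algTensor_ip]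
    refine (ip_toCompletion _ _ _).trans ?_
    refine (algTensor_ip X (tensor Y Z) x x' (tmul y z) (tmul y' z')).trans ?_
    refine (congrArg _ (toCompletion_lact (algTensor Y Z) (X.ip x x') (algTmul Y Z y' z')).symm).trans
      ?_
    exact (ip_toCompletion (algTensor Y Z) (algTmul Y Z y z)
      (algTmul Y Z (Y.lact (X.ip x x') y') z')).trans (algTensor_ip _ _ _ _ _ _)
  have h2 : (((tensor X (tensor Y Z)).ip.compl₂ (algAssoc X Y Z))).comp (algAssoc X Y Z)
      = (algTensor (algTensor X Y) Z).ip :=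
    algTensor₃_hom_ext' fun x y z => h1 x y z
  exact LinearMap.congr_fun (LinearMap.congr_fun h2 s) t

/-- Associativity of the tensor product of correspondences with normal left actions. -/
theorem exists_assocIso (hY : (leftInd Y).IsGenerated) (hZ : (leftInd Z).IsGenerated) :
    ∃ A : PreCorr.Iso (tensor (tensor X Y) Z) (tensor X (tensor Y Z)),
      ∀ x y z, A (tmul (tmul x y) z) = tmul x (tmul y z) := by
  obtain ⟨α, hα⟩ := exists_tensorIso (X := algTensor X Y) (Y := Z) (toCompletion (algTensor X Y))
    (ip_toCompletion _) (toCompletion_lact _) (algTensor X Y).generates_range_toCompletion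
    LinearMap.id (fun _ _ => rfl) (fun _ _ => rfl)
    (Z.generates_univ.mono fun z _ => ⟨z, rfl⟩) hZ
  obtain ⟨β, hβ⟩ := exists_completionIso (isSaturated_completion _) (algAssoc X Y Z) ip_algAssoc
    (fun a s => by
      refine LinearMap.congr_fun (f := algAssoc X Y Z ∘ₗ (algTensor (algTensor X Y) Z).lact a)
        (g := (tensor X (tensor Y Z)).lact a ∘ₗ algAssoc X Y Z)
        (algTensor₃_hom_ext fun x y z => ?_) s
      exact toCompletion_lact (algTensor X (tensor Y Z)) a (algTmul X (tensor Y Z) x (tmul y z)))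
    ((X.generates_univ.tensor (Y.generates_univ.tensor Z.generates_univ hZ)
      (isGenerated_leftInd_completion (isGenerated_leftInd_algTensor hY hZ))).mono (by
      rintro _ ⟨x, -, _, ⟨y, -, z, -, rfl⟩, rfl⟩
      exact ⟨_, algAssoc_tmul x y z⟩))
  refine ⟨α.symm.trans β, fun x y z => ?_⟩
  have h1 : α.symm (tmul (tmul x y) z) = tmul (X := algTensor X Y) (Y := Z) (algTmul X Y x y) z :=
    (LinearEquiv.symm_apply_eq _).2 (hα (algTmul X Y x y) z).symm
  exact (congrArg β h1).trans (hβ _)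

theorem isGenerated_leftInd_idCorr (N : VonNeumannAlgebra H) :
    (leftInd (idCorr N)).IsGenerated := by
  let e : (idCorr N).carrier →ₗ[ℂ] (H →L[ℂ] H) :=
    { toFun := fun R => (show Alg N from R).1
      map_add' := fun _ _ => rfl
      map_smul' := fun _ _ => rfl }
  have he : ∀ x y, (e x).adjoint ∘L e y = (idCorr N).ip x y := fun _ _ => rfl
  have hV : indLift (idCorr N) e ∈ VNRep.Hom (leftInd (idCorr N)) (idRep N) := fun a =>
    (indKernel (idCorr N)).hom_ext fun x h => by
      rw [ContinuousLinearMap.comp_apply, ContinuousLinearMap.comp_apply, indRep_tmul,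
        indLift_tmul he, indLift_tmul he]
      rfl
  refine (isGenerated_idRep N).of_hom (VNRep.Hom.adj ⟨_, hV⟩) ?_
  change Function.Injective (indLift (idCorr N) e).adjoint.adjoint
  rw [ContinuousLinearMap.adjoint_adjoint]
  exact indLift_injective he

/-- `N ⊗ Y ≅ Y`, by `R ⊗ y ↦ R y`. -/
theorem exists_leftUnitIso (hY : Y.IsSaturated) :
    ∃ α : PreCorr.Iso (tensor (idCorr M.commutant) Y) Y,
      ∀ (R : Alg M.commutant) y, α (tmul (X := idCorr M.commutant) R y) = Y.lact R y :=
  exists_tensorIso_of_bilin (X := idCorr M.commutant) hY Y.lact.toLinearMap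
    (fun (R : Alg M.commutant) y (R' : Alg M.commutant) y' => by
      change Y.ip (Y.lact R y) (Y.lact R' y') = Y.ip y (Y.lact (star R * R') y')
      rw [Y.ip_lact, map_mul]
      rfl)
    (fun (R R' : Alg M.commutant) y => by
      change Y.lact (R * R') y = _
      rw [map_mul]
      rfl)
    (Y.generates_univ.mono fun y _ => ⟨(1 : Alg M.commutant), y, by
      change y = Y.lact 1 y
      rw [map_one]
      rfl⟩)

/-- `X ⊗ N ≅ X`, by `x ⊗ R ↦ x R`. -/
theorem exists_rightUnitIso (hX : X.IsSaturated) :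
    ∃ α : PreCorr.Iso (tensor X (idCorr M.commutant)) X,
      ∀ x (R : Alg M.commutant), α (tmul (Y := idCorr M.commutant) x R) = X.ract (op R) x :=
  exists_tensorIso_of_bilin (Y := idCorr M.commutant) hX
    (LinearMap.flip (X.ract.toLinearMap ∘ₗ (opLinearEquiv ℂ).toLinearMap))
    (fun x (R : Alg M.commutant) x' (R' : Alg M.commutant) => by
      change X.ip (X.ract (op R) x) (X.ract (op R') x') = star R * (X.ip x x' * R')
      have h : X.ip (X.ract (op R) x) x' = star R * X.ip x x' := by
        rw [← X.star_ip, X.ip_ract, star_mul, X.star_ip]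
      rw [X.ip_ract, h, mul_assoc])
    (fun a x (R : Alg M.commutant) => (X.lact_ract a (op R) x).symm)
    (X.generates_univ.mono fun x _ => ⟨x, (1 : Alg M.commutant), by
      change x = X.ract (op 1) x
      rw [op_one, map_one]
      rfl⟩)

end TensorIso

/-! ### The correspondences `L_M(H, H_𝔭)` and the product `(I ⊗ X) Y` -/

section Juxt

variable (Φ : CPSemigroup M)

theorem isSaturated_lCorr (l : List ℝ≥0) : (lCorr Φ l).IsSaturated :=
  .of_equiv_hom (HPart Φ l) (Y := lCorr Φ l) (Submodule.subtype _) (fun _ _ => rfl)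
    (fun X => (show VNRep.Hom (idRep M) (HPart Φ l) from X).2) Subtype.val_injective
    fun S hS => ⟨(⟨S, hS⟩ : VNRep.Hom (idRep M) (HPart Φ l)), rfl⟩

/-- The isometry `X ⊗ h ↦ X h` from `L_M(H, H_𝔭) ⊗ H` to `H_𝔭`. -/
def lInd (l : List ℝ≥0) : Ind (lCorr Φ l) →L[ℂ] (HPart Φ l).K :=
  indLift (lCorr Φ l) (Submodule.subtype _)

theorem lInd_tmul (l : List ℝ≥0) (X : VNRep.Hom (idRep M) (HPart Φ l)) (h : H) :
    lInd Φ l ((indKernel (lCorr Φ l)).tmul X h) = X.1 h :=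
  indLift_tmul (X := lCorr Φ l) (e := Submodule.subtype _) (fun _ _ => rfl) X h

theorem inner_lInd (l : List ℝ≥0) (z w : Ind (lCorr Φ l)) :
    ⟪lInd Φ l z, lInd Φ l w⟫_ℂ = ⟪z, w⟫_ℂ :=
  inner_indLift (X := lCorr Φ l) (e := Submodule.subtype _) (fun _ _ => rfl) z w

theorem lInd_injective (l : List ℝ≥0) : Function.Injective (lInd Φ l) :=
  indLift_injective (X := lCorr Φ l) (e := Submodule.subtype _) (fun _ _ => rfl)

/-- The left action of `M'` on `L_M(H, H_𝔭)` is normal. -/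
theorem isGenerated_leftInd_lCorr (l : List ℝ≥0) : (leftInd (lCorr Φ l)).IsGenerated := by
  have hV : lInd Φ l ∈ VNRep.Hom (leftInd (lCorr Φ l)) (ampRep Φ l) := fun R =>
    (indKernel (lCorr Φ l)).hom_ext fun X h => by
      rw [ContinuousLinearMap.comp_apply, ContinuousLinearMap.comp_apply, indRep_tmul]
      exact (lInd_tmul Φ l (VNRep.Hom.comp (amp Φ R l) X) h).trans
        (congrArg (amp Φ R l).1 (lInd_tmul Φ l X h)).symm
  refine (isGenerated_ampRep Φ l).of_hom (VNRep.Hom.adj ⟨_, hV⟩) ?_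
  change Function.Injective (lInd Φ l).adjoint.adjoint
  rw [ContinuousLinearMap.adjoint_adjoint]
  exact lInd_injective Φ l

variable {l₁ : List ℝ≥0}

theorem ampTail_cons (X : VNRep.Hom (idRep M) (HPart Φ l₁)) (d : ℝ≥0) (l : List ℝ≥0) :
    ampTail Φ X (d :: l) = stineMap (Φ.P d) (ampTail Φ X l) := by
  rw [ampTail]

theorem ampTail_add (X Y : VNRep.Hom (idRep M) (HPart Φ l₁)) (l : List ℝ≥0) :
    ampTail Φ (X + Y) l = ampTail Φ X l + ampTail Φ Y l := by
  induction l with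
  | nil => rfl
  | cons d l ih => rw [ampTail_cons, ih, stineMap_add, ampTail_cons, ampTail_cons]

theorem ampTail_smul (c : ℂ) (X : VNRep.Hom (idRep M) (HPart Φ l₁)) (l : List ℝ≥0) :
    ampTail Φ (c • X) l = c • ampTail Φ X l := by
  induction l with
  | nil => rfl
  | cons d l ih => rw [ampTail_cons, ih, stineMap_smul, ampTail_cons]

/-- `(I ⊗ X)* (I ⊗ Y) = I ⊗ X* Y`. -/
theorem adj_ampTail_comp (X Y : VNRep.Hom (idRep M) (HPart Φ l₁)) (l : List ℝ≥0) :
    VNRep.Hom.comp (VNRep.Hom.adj (ampTail Φ X l)) (ampTail Φ Y l)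
      = amp Φ ((lCorr Φ l₁).ip X Y) l := by
  induction l with
  | nil => rfl
  | cons d l ih =>
    rw [ampTail_cons, ampTail_cons, ← stineMap_adj, ← stineMap_comp, ih, amp_cons]

theorem amp_comp_ampTail (R : Alg M.commutant) (X : VNRep.Hom (idRep M) (HPart Φ l₁))
    (l : List ℝ≥0) : VNRep.Hom.comp (amp Φ R (l ++ l₁)) (ampTail Φ X l)
      = ampTail Φ (VNRep.Hom.comp (amp Φ R l₁) X) l := by
  induction l with
  | nil => rfl
  | cons d l ih =>
    rw [ampTail_cons, ampTail_cons, ← ih, stineMap_comp, ← amp_cons]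
    rfl

/-- Inserting points commutes with `X ↦ I ⊗ X`. -/
theorem ins_comp_ampTail {l₂ l₂' : List ℝ≥0} (h : Refines l₂ l₂') (l₁' : List ℝ≥0)
    (X : VNRep.Hom (idRep M) (HPart Φ l₁)) :
    VNRep.Hom.comp (ins Φ (l₂ ++ l₁) (l₂' ++ l₁')) (ampTail Φ X l₂)
      = VNRep.Hom.comp (ampTail Φ (VNRep.Hom.comp (ins Φ l₁ l₁') X) l₂') (ins Φ l₂ l₂') := by
  induction h with
  | nil => rw [ins_nil]; rfl
  | @keep d m m' h ih =>
    rw [ampTail_cons, ampTail_cons, ins_keep, ← stineMap_comp, ← ih, stineMap_comp, ← ins_keep]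
    rfl
  | @cut d e f m m' hd hf h ih =>
    have e1 : ins Φ (d :: m ++ l₁) (e :: m' ++ l₁')
        = VNRep.Hom.comp (stineMap (Φ.P e) (ins Φ (f :: m ++ l₁) (m' ++ l₁')))
          (cutMap Φ d e f hd (HPart Φ (m ++ l₁))) := ins_cut Φ d e f hd hf (m ++ l₁) (m' ++ l₁')
    rw [ampTail_cons, ampTail_cons, e1, ins_cut Φ _ _ f hd hf, comp_assoc, cutMap_natural,
      ← comp_assoc, ← comp_assoc, ← stineMap_comp]
    exact congrArg (fun Z => VNRep.Hom.comp Z (cutMap Φ d e f hd (HPart Φ m)))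
      ((congrArg (stineMap (Φ.P e)) ih).trans (stineMap_comp _ _ _))

theorem ins_comp_juxt {l₁' l₂ l₂' : List ℝ≥0} (h : Refines l₂ l₂')
    (X : VNRep.Hom (idRep M) (HPart Φ l₁)) (Y : VNRep.Hom (idRep M) (HPart Φ l₂)) :
    VNRep.Hom.comp (ins Φ (l₂ ++ l₁) (l₂' ++ l₁')) (juxt Φ X Y)
      = juxt Φ (VNRep.Hom.comp (ins Φ l₁ l₁') X) (VNRep.Hom.comp (ins Φ l₂ l₂') Y) := by
  rw [juxt, juxt, ← comp_assoc, ins_comp_ampTail Φ h, comp_assoc]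

/-- The product `(I ⊗ X) Y` as a bilinear map. -/
def juxtBilin (l₁ l₂ : List ℝ≥0) : VNRep.Hom (idRep M) (HPart Φ l₁) →ₗ[ℂ]
    VNRep.Hom (idRep M) (HPart Φ l₂) →ₗ[ℂ] VNRep.Hom (idRep M) (HPart Φ (l₂ ++ l₁)) :=
  LinearMap.mk₂ ℂ (fun X Y => juxt Φ X Y)
    (fun X X' Y => by
      rw [juxt, ampTail_add]
      exact Subtype.ext (ContinuousLinearMap.add_comp _ _ _))
    (fun c X Y => by
      rw [juxt, ampTail_smul]
      exact Subtype.ext (ContinuousLinearMap.smul_comp _ _ _))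
    (fun X Y Y' => Subtype.ext (ContinuousLinearMap.comp_add _ _ _))
    (fun c X Y => Subtype.ext (ContinuousLinearMap.comp_smul _ _ _))

variable {l₂ : List ℝ≥0}

theorem ip_juxt (X X' : VNRep.Hom (idRep M) (HPart Φ l₁)) (Y Y' : VNRep.Hom (idRep M) (HPart Φ l₂)) :
    (lCorr Φ (l₂ ++ l₁)).ip (juxt Φ X Y) (juxt Φ X' Y')
      = (lCorr Φ l₂).ip Y ((lCorr Φ l₂).lact ((lCorr Φ l₁).ip X X') Y') := Subtype.ext (by
  change ((ampTail Φ X l₂).1 ∘L Y.1).adjoint ∘L ((ampTail Φ X' l₂).1 ∘L Y'.1)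
    = Y.1.adjoint ∘L ((amp Φ ((lCorr Φ l₁).ip X X') l₂).1 ∘L Y'.1)
  rw [← adj_ampTail_comp, ContinuousLinearMap.adjoint_comp]
  rfl)

theorem lact_juxt (R : Alg M.commutant) (X : VNRep.Hom (idRep M) (HPart Φ l₁))
    (Y : VNRep.Hom (idRep M) (HPart Φ l₂)) :
    juxt Φ ((lCorr Φ l₁).lact R X) Y = (lCorr Φ (l₂ ++ l₁)).lact R (juxt Φ X Y) := by
  change VNRep.Hom.comp (ampTail Φ (VNRep.Hom.comp (amp Φ R l₁) X) l₂) Y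
    = VNRep.Hom.comp (amp Φ R (l₂ ++ l₁)) (VNRep.Hom.comp (ampTail Φ X l₂) Y)
  rw [← comp_assoc, amp_comp_ampTail]

/-- The ranges of the operators `I ⊗ X` span. -/
theorem eq_zero_of_inner_ampTail (l₁ l₂ : List ℝ≥0) (w : (HPart Φ (l₂ ++ l₁)).K)
    (hw : ∀ (X : VNRep.Hom (idRep M) (HPart Φ l₁)) (k : (HPart Φ l₂).K),
      ⟪(ampTail Φ X l₂).1 k, w⟫_ℂ = 0) : w = 0 := by
  induction l₂ with
  | nil => exact isGenerated_HPart Φ l₁ w fun X hX h => hw ⟨X, hX⟩ h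
  | cons d l ih =>
    refine (stineKernel (Φ.P d) (HPart Φ (l ++ l₁))).eq_zero_of_inner_tmul fun T k => ?_
    have h2 : ((stineKernel (Φ.P d) (HPart Φ (l ++ l₁))).tmulLeft T).adjoint w = 0 :=
      ih _ fun X k => by
        rw [ContinuousLinearMap.adjoint_inner_right, PosKernel.tmulLeft_apply, ← stineMap_tmul,
          ← ampTail_cons]
        exact hw X _
    rw [← PosKernel.tmulLeft_apply, ← ContinuousLinearMap.adjoint_inner_right, h2]
    exact inner_zero_right _

/-- The operators `(I ⊗ X) Y` generate, since the ranges of the `Y` span `H_𝔭₂` and those of the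
`I ⊗ X` span `H_𝔭`. -/
theorem generates_juxt (l₁ l₂ : List ℝ≥0) :
    (lCorr Φ (l₂ ++ l₁)).Generates {Z | ∃ X Y, Z = juxtBilin Φ l₁ l₂ X Y} := by
  intro w hw
  refine lInd_injective Φ _ ?_
  rw [map_zero]
  refine eq_zero_of_inner_ampTail Φ l₁ l₂ _ fun X k => ?_
  have h1 : (ampTail Φ X l₂).1.adjoint (lInd Φ (l₂ ++ l₁) w) = 0 :=
    isGenerated_HPart Φ l₂ _ fun Y hY h => by
      rw [ContinuousLinearMap.adjoint_inner_right]
      have h2 := lInd_tmul Φ (l₂ ++ l₁) (juxt Φ X ⟨Y, hY⟩) h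
      refine (congrArg (fun z => ⟪z, lInd Φ (l₂ ++ l₁) w⟫_ℂ) h2).symm.trans ?_
      rw [inner_lInd]
      exact hw _ ⟨X, ⟨Y, hY⟩, rfl⟩ h
  rw [← ContinuousLinearMap.adjoint_inner_right, h1]
  exact inner_zero_right _

/-- The isomorphism `L_M(H, H_𝔭₁) ⊗ L_M(H, H_𝔭₂) ≅ L_M(H, H_𝔭)`, `X ⊗ Y ↦ (I ⊗ X) Y`. -/
theorem exists_juxtIso (l₁ l₂ : List ℝ≥0) :
    ∃ α : PreCorr.Iso (tensor (lCorr Φ l₁) (lCorr Φ l₂)) (lCorr Φ (l₂ ++ l₁)),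
      ∀ (X : VNRep.Hom (idRep M) (HPart Φ l₁)) (Y : VNRep.Hom (idRep M) (HPart Φ l₂)),
        α (tmul (X := lCorr Φ l₁) (Y := lCorr Φ l₂) X Y) = juxt Φ X Y :=
  exists_tensorIso_of_bilin (X := lCorr Φ l₁) (Y := lCorr Φ l₂) (isSaturated_lCorr Φ _)
    (juxtBilin Φ l₁ l₂) (fun X Y X' Y' => ip_juxt Φ X X' Y Y') (fun R X Y => lact_juxt Φ R X Y)
    (generates_juxt Φ l₁ l₂)

theorem heq_stineMap (P : NCPMap M) {A B B' : VNRep M} (h : B = B') {X : VNRep.Hom A B}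
    {X' : VNRep.Hom A B'} (hX : HEq X X') : HEq (stineMap P X) (stineMap P X') := by
  subst h
  rw [eq_of_heq hX]

theorem heq_comp {A B C C' : VNRep M} (h : C = C') {X : VNRep.Hom B C}
    {X' : VNRep.Hom B C'} (hX : HEq X X') (Y : VNRep.Hom A B) :
    HEq (VNRep.Hom.comp X Y) (VNRep.Hom.comp X' Y) := by
  subst h
  rw [eq_of_heq hX]

theorem heq_ampTail_ampTail {l₁ l₂ : List ℝ≥0} (X₁ : VNRep.Hom (idRep M) (HPart Φ l₁))
    (X₂ : VNRep.Hom (idRep M) (HPart Φ l₂)) (l : List ℝ≥0) :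
    HEq (ampTail Φ (juxt Φ X₁ X₂) l)
      (VNRep.Hom.comp (ampTail Φ X₁ (l ++ l₂)) (ampTail Φ X₂ l)) := by
  induction l with
  | nil => exact HEq.rfl
  | cons d l ih =>
    rw [ampTail_cons, ampTail_cons]
    have e : ampTail Φ X₁ (d :: l ++ l₂) = stineMap (Φ.P d) (ampTail Φ X₁ (l ++ l₂)) :=
      ampTail_cons Φ X₁ d (l ++ l₂)
    have e2 : VNRep.Hom.comp (ampTail Φ X₁ (d :: l ++ l₂)) (stineMap (Φ.P d) (ampTail Φ X₂ l))
        = stineMap (Φ.P d) (VNRep.Hom.comp (ampTail Φ X₁ (l ++ l₂)) (ampTail Φ X₂ l)) := by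
      rw [e, stineMap_comp]
    rw [e2]
    exact heq_stineMap _ (congrArg (HPart Φ) (List.append_assoc l l₂ l₁).symm) ih

/-- The product is associative. The two sides are intertwiners to spaces attached to the lists
`l₃ ++ (l₂ ++ l₁)` and `(l₃ ++ l₂) ++ l₁`. -/
theorem juxt_assoc {l₁ l₂ l₃ : List ℝ≥0} (X₁ : VNRep.Hom (idRep M) (HPart Φ l₁))
    (X₂ : VNRep.Hom (idRep M) (HPart Φ l₂)) (X₃ : VNRep.Hom (idRep M) (HPart Φ l₃)) :
    HEq (juxt Φ (juxt Φ X₁ X₂) X₃) (juxt Φ X₁ (juxt Φ X₂ X₃)) :=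
  heq_comp (congrArg (HPart Φ) (List.append_assoc l₃ l₂ l₁).symm)
    (heq_ampTail_ampTail Φ X₁ X₂ l₃) X₃

theorem heq_ampTail_ofCommutant (R : Alg M.commutant) (l : List ℝ≥0) :
    HEq (ampTail Φ (l₁ := []) (ofCommutant R) l) (amp Φ R l) := by
  induction l with
  | nil => exact HEq.rfl
  | cons d l ih =>
    rw [ampTail_cons, amp_cons]
    exact heq_stineMap _ (congrArg (HPart Φ) (List.append_nil l)) ih

theorem juxt_ofCommutant_left (R : Alg M.commutant) {l : List ℝ≥0}
    (X : VNRep.Hom (idRep M) (HPart Φ l)) :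
    HEq (juxt Φ (l₁ := []) (ofCommutant R) X) (VNRep.Hom.comp (amp Φ R l) X) :=
  heq_comp (congrArg (HPart Φ) (List.append_nil l)) (heq_ampTail_ofCommutant Φ R l) X

end Juxt

/-! ### Direct limits of correspondences -/

namespace CorrSystem

section

variable {N : VonNeumannAlgebra H} {ι : Type} [Preorder ι] [IsDirectedOrder ι] [Nonempty ι]
  (S : CorrSystem ι N)

/-- The canonical map of a member of the system to the limit, as a linear map. -/
def ofLin (i : ι) : (S.X i).carrier →ₗ[ℂ] S.lim.carrier where
  toFun := S.of i
  map_add' := S.of_add i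
  map_smul' := S.of_smul i

theorem hom_ext {Z : Type*} [AddCommGroup Z] [Module ℂ Z] {f g : S.lim.carrier →ₗ[ℂ] Z}
    (h : ∀ i x, f (S.ofLin i x) = g (S.ofLin i x)) : f = g :=
  LinearMap.ext (S.ind₁ h)

/-- The linear map out of the limit given by a compatible family. -/
def liftLin {Z : Type*} [AddCommGroup Z] [Module ℂ Z] (g : ∀ i, (S.X i).carrier →ₗ[ℂ] Z)
    (hg : ∀ i j h x, g j (S.f i j h x) = g i x) : S.lim.carrier →ₗ[ℂ] Z where
  toFun := DirectLimit.lift S.f (fun i x => g i x) fun i j h x => (hg i j h x).symm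
  map_add' := S.ind₂ fun i x y =>
    (congrArg (DirectLimit.lift S.f (fun i x => g i x) fun i j h x => (hg i j h x).symm)
      (S.of_add i x y).symm).trans (map_add (g i) x y)
  map_smul' c := S.ind₁ fun i x =>
    (congrArg (DirectLimit.lift S.f (fun i x => g i x) fun i j h x => (hg i j h x).symm)
      (S.of_smul i c x).symm).trans (map_smul (g i) c x)

theorem ip_ofLin (i : ι) (x y : (S.X i).carrier) :
    S.lim.ip (S.ofLin i x) (S.ofLin i y) = (S.X i).ip x y := S.limIp_of i x y

theorem ofLin_f (i j : ι) (h : i ≤ j) (x : (S.X i).carrier) :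
    S.ofLin j (S.f i j h x) = S.ofLin i x := S.of_f i j h x

theorem exists_ofLin (z : S.lim.carrier) : ∃ i x, z = S.ofLin i x :=
  S.ind₁ (p := fun z => ∃ i x, z = S.of i x) (fun i x => ⟨i, x, rfl⟩) z

/-- Generators of cofinally many members generate the limit. -/
theorem generates_lim {D : Set S.lim.carrier} (hD : ∀ i, ∃ j, i ≤ j ∧
    ∃ D' : Set (S.X j).carrier, (S.X j).Generates D' ∧ ∀ d ∈ D', S.ofLin j d ∈ D) :
    S.lim.Generates D := by
  intro w hw
  refine (indKernel S.lim).eq_zero_of_inner_tmul fun z h => ?_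
  obtain ⟨i, x, rfl⟩ := S.exists_ofLin z
  obtain ⟨j, hij, D', hgen, hD'⟩ := hD i
  have hV := indLift_tmul (adjoint_comp_creation_comp (S.ip_ofLin j))
  have h1 : (indLift (S.X j) (creation S.lim ∘ₗ S.ofLin j)).adjoint w = 0 :=
    hgen _ fun d hd h => by
      rw [ContinuousLinearMap.adjoint_inner_right, hV]
      exact hw _ (hD' d hd) h
  rw [← S.ofLin_f i j hij]
  refine (congrArg (fun z => ⟪z, w⟫_ℂ) (hV (S.f i j hij x) h)).symm.trans ?_
  rw [← ContinuousLinearMap.adjoint_inner_right, h1]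
  exact inner_zero_right _

/-- The left action on a limit of correspondences with normal left action is normal. -/
theorem isGenerated_leftInd_lim (hS : ∀ i, (leftInd (S.X i)).IsGenerated) :
    (leftInd S.lim).IsGenerated := by
  intro w hw
  refine (indKernel S.lim).eq_zero_of_inner_tmul fun z h => ?_
  obtain ⟨i, x, rfl⟩ := S.exists_ofLin z
  have hV := indLift_tmul (adjoint_comp_creation_comp (S.ip_ofLin i))
  have h1 : (indLift (S.X i) (creation S.lim ∘ₗ S.ofLin i)).adjoint w = 0 :=
    hS i _ fun Y hY h => by
      rw [ContinuousLinearMap.adjoint_inner_right]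
      exact hw _ (VNRep.Hom.comp (⟨_, indLift_comp_indRep (S.ip_ofLin i) fun a x => rfl⟩ :
        VNRep.Hom (leftInd (S.X i)) (leftInd S.lim)) ⟨Y, hY⟩).2 h
  refine (congrArg (fun z => ⟪z, w⟫_ℂ) (hV x h)).symm.trans ?_
  rw [← ContinuousLinearMap.adjoint_inner_right, h1]
  exact inner_zero_right _

/-- The bilinear map out of a pair of limits given by a compatible family. -/
def liftLin₂ {κ : Type} [Preorder κ] [IsDirectedOrder κ] [Nonempty κ] (S' : CorrSystem κ N)
    {Z : Type*} [AddCommGroup Z] [Module ℂ Z]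
    (g : ∀ i k, (S.X i).carrier →ₗ[ℂ] (S'.X k).carrier →ₗ[ℂ] Z)
    (hg : ∀ i j h k l h' x y, g j l (S.f i j h x) (S'.f k l h' y) = g i k x y) :
    S.lim.carrier →ₗ[ℂ] S'.lim.carrier →ₗ[ℂ] Z :=
  have hg₁ : ∀ i j h k x y, g j k (S.f i j h x) y = g i k x y := fun i j h k x y => by
    have := hg i j h k k le_rfl x y
    rwa [S'.map_self] at this
  have hg₂ : ∀ i k l h x y, g i l x (S'.f k l h y) = g i k x y := fun i k l h x y => by
    have := hg i i le_rfl k l h x y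
    rwa [S.map_self] at this
  S.liftLin
    (fun i =>
      { toFun := fun x => S'.liftLin (fun k => g i k x) fun k l h y => hg₂ i k l h x y
        map_add' := fun x x' => S'.hom_ext fun k y => by
          rw [LinearMap.add_apply]
          exact LinearMap.congr_fun (map_add (g i k) x x') y
        map_smul' := fun c x => S'.hom_ext fun k y => by
          rw [LinearMap.smul_apply]
          exact LinearMap.congr_fun (map_smul (g i k) c x) y })
    fun i j h x => S'.hom_ext fun k y => hg₁ i j h k x y

end

end CorrSystem

/-! ### Cutting refinements -/

theorem Refines.sum_eq {l l' : List ℝ≥0} (h : Refines l l') : l.sum = l'.sum := by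
  induction h with
  | nil => rfl
  | keep d h ih => rw [List.sum_cons, List.sum_cons, ih]
  | cut d e f hd hf h ih => rw [List.sum_cons, List.sum_cons, ← ih, List.sum_cons, hd, add_assoc]

theorem Refines.append {a a' b b' : List ℝ≥0} (h : Refines a a') (h' : Refines b b') :
    Refines (a ++ b) (a' ++ b') := by
  induction h with
  | nil => exact h'
  | keep d h ih => exact .keep d ih
  | cut d e f hd hf h ih => exact .cut d e f hd hf ih

/-- A refinement of a concatenation is a concatenation of refinements. -/
theorem Refines.exists_append {l l' : List ℝ≥0} (h : Refines l l') : ∀ {a b : List ℝ≥0},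
    l = a ++ b → ∃ a' b', l' = a' ++ b' ∧ Refines a a' ∧ Refines b b' := by
  induction h with
  | nil =>
    intro a b hab
    obtain ⟨rfl, rfl⟩ := List.append_eq_nil_iff.1 hab.symm
    exact ⟨[], [], rfl, .nil, .nil⟩
  | @keep d m m' h ih =>
    intro a b hab
    cases a with
    | nil =>
      obtain rfl : d :: m = b := hab
      exact ⟨[], _, rfl, .nil, .keep d h⟩
    | cons c a =>
      obtain ⟨rfl, hm⟩ := List.cons.inj hab
      obtain ⟨a', b', rfl, ha, hb⟩ := ih hm
      exact ⟨d :: a', b', rfl, .keep d ha, hb⟩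
  | @cut d e f m m' hd hf h ih =>
    intro a b hab
    cases a with
    | nil =>
      obtain rfl : d :: m = b := hab
      exact ⟨[], _, rfl, .nil, .cut d e f hd hf h⟩
    | cons c a =>
      obtain ⟨rfl, hm⟩ := List.cons.inj hab
      obtain ⟨a', b', rfl, ha, hb⟩ := ih (a := f :: a) (congrArg (f :: ·) hm)
      exact ⟨e :: a', b', rfl, .cut d e f hd hf ha, hb⟩

/-- The concatenations are cofinal among the partitions of `[0, t + s]`. -/
theorem Part.exists_le_concat {t s u : ℝ≥0} (h : t + s = u) (r : Part u) :
    ∃ (p : Part t) (q : Part s), r ≤ Part.concat h p q := by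
  obtain ⟨p₀⟩ : Nonempty (Part t) := inferInstance
  obtain ⟨q₀⟩ : Nonempty (Part s) := inferInstance
  -- a common refinement of `r` and some concatenation is a concatenation by `Refines.exists_append`
  obtain ⟨r', hr, hr'⟩ := exists_ge_ge r (Part.concat h p₀ q₀)
  obtain ⟨a, b, hab, ha, hb⟩ := Refines.exists_append hr' rfl
  have hpos : ∀ d ∈ a ++ b, 0 < d := hab ▸ r'.pos
  refine ⟨⟨b, fun d hd => hpos d (List.mem_append_right _ hd), hb.sum_eq.symm.trans p₀.sum⟩,
    ⟨a, fun d hd => hpos d (List.mem_append_left _ hd), ha.sum_eq.symm.trans q₀.sum⟩, ?_⟩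
  change Refines r.gaps (a ++ b)
  rw [← hab]
  exact hr

theorem Part.ext {t : ℝ≥0} {p q : Part t} (h : p.gaps = q.gaps) : p = q := by
  cases p
  cases q
  cases h
  rfl

theorem Part.eq_trivial (p : Part 0) : p = Part.trivial := by
  refine Part.ext ?_
  rcases hp : p.gaps with _ | ⟨d, l⟩
  · rfl
  · have h1 := p.sum
    have h2 := p.pos d (by rw [hp]; exact List.mem_cons_self)
    rw [hp, List.sum_cons, add_eq_zero] at h1
    exact absurd h1.1 h2.ne'

/-! ### The product system -/

section Product

variable (Φ : CPSemigroup M)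

theorem isSaturated_E (t : ℝ≥0) : (E Φ t).IsSaturated := isSaturated_completion _

theorem isGenerated_leftInd_lim (t : ℝ≥0) : (leftInd (lSystem Φ t).lim).IsGenerated :=
  (lSystem Φ t).isGenerated_leftInd_lim fun p => isGenerated_leftInd_lCorr Φ p.gaps

theorem isGenerated_leftInd_E (t : ℝ≥0) : (leftInd (E Φ t)).IsGenerated :=
  isGenerated_leftInd_completion (isGenerated_leftInd_lim Φ t)

theorem ip_toE {t : ℝ≥0} (p : Part t) (X Y : VNRep.Hom (idRep M) (HPart Φ p.gaps)) :
    (E Φ t).ip (toE Φ p X) (toE Φ p Y) = (lCorr Φ p.gaps).ip X Y :=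
  (ip_toCompletion _ _ _).trans ((lSystem Φ t).ip_ofLin p X Y)

theorem lact_toE {t : ℝ≥0} (p : Part t) (R : Alg M.commutant)
    (X : VNRep.Hom (idRep M) (HPart Φ p.gaps)) :
    (E Φ t).lact R (toE Φ p X) = toE Φ p (VNRep.Hom.comp (amp Φ R p.gaps) X) :=
  (toCompletion_lact (lSystem Φ t).lim R ((lSystem Φ t).of p X)).symm

theorem ract_toE {t : ℝ≥0} (p : Part t) (R : Alg M.commutant)
    (X : VNRep.Hom (idRep M) (HPart Φ p.gaps)) :
    (E Φ t).ract (op R) (toE Φ p X) = toE Φ p (VNRep.Hom.comp X (ofCommutant R)) :=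
  (toCompletion_ract (lSystem Φ t).lim R ((lSystem Φ t).of p X)).symm

theorem toE_congr {t : ℝ≥0} {p q : Part t} (h : p.gaps = q.gaps)
    {X : VNRep.Hom (idRep M) (HPart Φ p.gaps)} {Y : VNRep.Hom (idRep M) (HPart Φ q.gaps)}
    (hXY : HEq X Y) : toE Φ p X = toE Φ q Y := by
  obtain rfl := Part.ext h
  rw [eq_of_heq hXY]

theorem toE_ins {t : ℝ≥0} {p q : Part t} (h : p ≤ q) (X : VNRep.Hom (idRep M) (HPart Φ p.gaps)) :
    toE Φ q (VNRep.Hom.comp (ins Φ p.gaps q.gaps) X) = toE Φ p X :=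
  congrArg (toCompletion (lSystem Φ t).lim) ((lSystem Φ t).of_f p q h X)

/-- The elements of the spaces `L_M(H, H_𝔭)` generate `E(t)`. -/
theorem generates_toE (t : ℝ≥0) : (E Φ t).Generates {z | ∃ p X, z = toE Φ p X} := by
  refine (lSystem Φ t).lim.generates_univ.completion.mono ?_
  rintro _ ⟨z, -, rfl⟩
  obtain ⟨p, X, rfl⟩ := (lSystem Φ t).exists_ofLin z
  exact ⟨p, X, rfl⟩

/-- The elements `(I ⊗ X) Y` generate `E(t + s)`. -/
theorem generates_toE_juxt {t s u : ℝ≥0} (h : t + s = u) : (E Φ u).Generates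
    {z | ∃ (p : Part t) (q : Part s) (X : VNRep.Hom (idRep M) (HPart Φ p.gaps))
      (Y : VNRep.Hom (idRep M) (HPart Φ q.gaps)),
        z = toE Φ (Part.concat h p q) (juxt Φ X Y)} := by
  have h1 : (lSystem Φ u).lim.Generates
      {z | ∃ (p : Part t) (q : Part s) (X : VNRep.Hom (idRep M) (HPart Φ p.gaps))
        (Y : VNRep.Hom (idRep M) (HPart Φ q.gaps)),
          z = (lSystem Φ u).ofLin (Part.concat h p q) (juxt Φ X Y)} := by
    refine (lSystem Φ u).generates_lim fun r => ?_
    obtain ⟨p, q, hr⟩ := Part.exists_le_concat h r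
    refine ⟨_, hr, _, generates_juxt Φ p.gaps q.gaps, ?_⟩
    rintro _ ⟨X, Y, rfl⟩
    exact ⟨p, q, X, Y, rfl⟩
  refine h1.completion.mono ?_
  rintro _ ⟨_, ⟨p, q, X, Y, rfl⟩, rfl⟩
  exact ⟨p, q, X, Y, rfl⟩

/-- The canonical map `L_M(H, H_𝔭) → E(t)`, as a linear map. -/
def toELin {t : ℝ≥0} (p : Part t) : (lCorr Φ p.gaps).carrier →ₗ[ℂ] (E Φ t).carrier :=
  toCompletion (lSystem Φ t).lim ∘ₗ (lSystem Φ t).ofLin p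

/-- The bilinear map of algebraic limits to `E(t + s)` induced by `(X, Y) ↦ (I ⊗ X) Y`. -/
def limProd {t s u : ℝ≥0} (h : t + s = u) : (lSystem Φ t).lim.carrier →ₗ[ℂ]
    (lSystem Φ s).lim.carrier →ₗ[ℂ] (E Φ u).carrier :=
  (lSystem Φ t).liftLin₂ (lSystem Φ s)
    (fun p q => (juxtBilin Φ p.gaps q.gaps).compr₂ (toELin Φ (Part.concat h p q)))
    fun p p' hp q q' hq X Y => by
      have h1 := ins_comp_juxt Φ (l₁' := p'.gaps) hq X Y
      have h2 : Part.concat h p q ≤ Part.concat h p' q' := Refines.append hq hp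
      exact (congrArg (toE Φ (Part.concat h p' q')) h1).symm.trans (toE_ins Φ h2 (juxt Φ X Y))

end Product

/-! ### The isomorphisms of the product system -/

section ProductSystem

variable (Φ : CPSemigroup M)

theorem limProd_ofLin {t s u : ℝ≥0} (h : t + s = u) (p : Part t) (q : Part s)
    (X : VNRep.Hom (idRep M) (HPart Φ p.gaps)) (Y : VNRep.Hom (idRep M) (HPart Φ q.gaps)) :
    limProd Φ h ((lSystem Φ t).ofLin p X) ((lSystem Φ s).ofLin q Y)
      = toE Φ (Part.concat h p q) (juxt Φ X Y) := rfl

theorem ip_limProd {t s u : ℝ≥0} (h : t + s = u) (x x' : (lSystem Φ t).lim.carrier)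
    (y y' : (lSystem Φ s).lim.carrier) :
    (E Φ u).ip (limProd Φ h x y) (limProd Φ h x' y')
      = (lSystem Φ s).lim.ip y ((lSystem Φ s).lim.lact ((lSystem Φ t).lim.ip x x') y') := by
  refine (lSystem Φ t).ind₂ (p := fun x x' => (E Φ u).ip (limProd Φ h x y) (limProd Φ h x' y')
    = (lSystem Φ s).lim.ip y ((lSystem Φ s).lim.lact ((lSystem Φ t).lim.ip x x') y'))
    (fun p X X' => ?_) x x'
  refine (lSystem Φ s).ind₂ (p := fun y y' => (E Φ u).ip
    (limProd Φ h ((lSystem Φ t).ofLin p X) y) (limProd Φ h ((lSystem Φ t).ofLin p X') y')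
    = (lSystem Φ s).lim.ip y ((lSystem Φ s).lim.lact ((lSystem Φ t).lim.ip
      ((lSystem Φ t).ofLin p X) ((lSystem Φ t).ofLin p X')) y')) (fun q Y Y' => ?_) y y'
  refine (ip_toE Φ (Part.concat h p q) (juxt Φ X Y) (juxt Φ X' Y')).trans ?_
  rw [(lSystem Φ t).ip_ofLin]
  exact (ip_juxt Φ X X' Y Y').trans ((lSystem Φ s).ip_ofLin q Y _).symm

theorem lact_limProd {t s u : ℝ≥0} (h : t + s = u) (R : Alg M.commutant)
    (x : (lSystem Φ t).lim.carrier) (y : (lSystem Φ s).lim.carrier) :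
    limProd Φ h ((lSystem Φ t).lim.lact R x) y = (E Φ u).lact R (limProd Φ h x y) := by
  obtain ⟨p, X, rfl⟩ := (lSystem Φ t).exists_ofLin x
  obtain ⟨q, Y, rfl⟩ := (lSystem Φ s).exists_ofLin y
  exact (congrArg (toE Φ (Part.concat h p q)) (lact_juxt Φ R X Y)).trans
    (lact_toE Φ (Part.concat h p q) R (juxt Φ X Y)).symm

/-- The product of the system: the tensor product of the algebraic limits has as completion both
`E(t) ⊗ E(s)` and `E(t + s)`. -/
theorem exists_productIso {t s u : ℝ≥0} (h : t + s = u) :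
    ∃ U : PreCorr.Iso (tensor (E Φ t) (E Φ s)) (E Φ u),
      ∀ (p : Part t) (q : Part s) (X : VNRep.Hom (idRep M) (HPart Φ p.gaps))
        (Y : VNRep.Hom (idRep M) (HPart Φ q.gaps)),
          U (tmul (toE Φ p X) (toE Φ q Y)) = toE Φ (Part.concat h p q) (juxt Φ X Y) := by
  obtain ⟨α, hα⟩ := exists_tensorIso_of_bilin (isSaturated_E Φ u) (limProd Φ h) (fun x y x' y' =>
    ip_limProd Φ h x x' y y') (lact_limProd Φ h) ((generates_toE_juxt Φ h).mono (by
      rintro _ ⟨p, q, X, Y, rfl⟩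
      exact ⟨_, _, (limProd_ofLin Φ h p q X Y).symm⟩))
  obtain ⟨β, hβ⟩ := exists_tensorCompletionIso (X := (lSystem Φ t).lim) (Y := (lSystem Φ s).lim)
    (isGenerated_leftInd_lim Φ s)
  refine ⟨β.symm.trans α, fun p q X Y => ?_⟩
  have h1 : β.symm (tmul (X := E Φ t) (Y := E Φ s) (toE Φ p X) (toE Φ q Y))
      = tmul ((lSystem Φ t).ofLin p X) ((lSystem Φ s).ofLin q Y) :=
    (LinearEquiv.symm_apply_eq _).2
      (hβ ((lSystem Φ t).ofLin p X) ((lSystem Φ s).ofLin q Y)).symm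
  exact (congrArg α h1).trans (hα _ _)

/-- `E(0) = M'`, as `[0, 0]` has only one partition. -/
theorem exists_unitIso : ∃ ε : PreCorr.Iso (idCorr M.commutant) (E Φ 0),
    ∀ R : Alg M.commutant, ε R = toE Φ Part.trivial (ofCommutant R) := by
  let j : (idCorr M.commutant).carrier →ₗ[ℂ] (E Φ 0).carrier :=
    toELin Φ Part.trivial ∘ₗ
      { toFun := fun R : Alg M.commutant => (ofCommutant R : VNRep.Hom (idRep M) (idRep M))
        map_add' := fun _ _ => rfl
        map_smul' := fun _ _ => rfl }
  have hj : ∀ R : Alg M.commutant, j R = toE Φ Part.trivial (ofCommutant R) := fun _ => rfl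
  obtain ⟨α, hα⟩ := exists_completionIso (X := idCorr M.commutant) (isSaturated_E Φ 0) j
    (fun R R' => ip_toE Φ Part.trivial _ _)
    (fun (R R' : Alg M.commutant) => (lact_toE Φ Part.trivial R (ofCommutant R')).symm)
    ((generates_toE Φ 0).mono (by
      rintro _ ⟨p, X, rfl⟩
      obtain rfl := p.eq_trivial
      have hX : X.1 ∈ M.commutant.toStarSubalgebra :=
        mem_commutant_of_forall fun T => (X.2 T).symm
      exact ⟨(⟨X.1, hX⟩ : Alg M.commutant), rfl⟩))
  obtain ⟨β, hβ⟩ := exists_completionIso (X := idCorr M.commutant) (isSaturated_idCorr (M := M))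
    LinearMap.id (fun _ _ => rfl) (fun _ _ => rfl)
    ((idCorr M.commutant).generates_univ.mono fun R _ => ⟨R, rfl⟩)
  refine ⟨β.symm.trans α, fun R => ?_⟩
  have h1 : β.symm (show (idCorr M.commutant).carrier from R) = toCompletion (idCorr M.commutant) R :=
    (LinearEquiv.symm_apply_eq _).2 (hβ R).symm
  exact (congrArg α h1).trans (hα _)

/-- `U_{0,t}(ε(R) ⊗ ξ) = R ξ`: on generators this is `(I ⊗ R) X = R · X`. -/
theorem product_unit_left
    {ε : PreCorr.Iso (idCorr M.commutant) (E Φ 0)}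
    {U : ∀ {t s u : ℝ≥0}, t + s = u → PreCorr.Iso (tensor (E Φ t) (E Φ s)) (E Φ u)}
    (hε : ∀ R : Alg M.commutant, ε R = toE Φ Part.trivial (ofCommutant R))
    (hU : ∀ (t s u : ℝ≥0) (h : t + s = u) (p₁ : Part t) (p₂ : Part s)
      (X : VNRep.Hom (idRep M) (HPart Φ p₁.gaps)) (Y : VNRep.Hom (idRep M) (HPart Φ p₂.gaps)),
        U h (tmul (toE Φ p₁ X) (toE Φ p₂ Y)) = toE Φ (Part.concat h p₁ p₂) (juxt Φ X Y))
    (t : ℝ≥0) (R : Alg M.commutant) (ξ : (E Φ t).carrier) :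
    U (zero_add t) (tmul (ε R) ξ) = (E Φ t).lact R ξ := by
  obtain ⟨α, hα⟩ := exists_leftUnitIso (isSaturated_E Φ t)
  obtain ⟨β, hβ⟩ := exists_tensorCongr (Y := E Φ t) ε
    (PreCorr.Iso.refl _)
    (isGenerated_leftInd_E Φ t)
  have key := PreCorr.Iso.eq_of_eqOn (((idCorr M.commutant).generates_univ).tensor
    (generates_toE Φ t) (isGenerated_leftInd_E Φ t)) (isSaturated_E Φ t).definite
    (β.trans (U (zero_add t))) α (by
      rintro _ ⟨R, -, _, ⟨p, X, rfl⟩, rfl⟩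
      refine (congrArg (U (zero_add t)) (hβ R (toE Φ p X))).trans (Eq.trans ?_ (hα R _).symm)
      refine (congrArg (fun z => U (zero_add t) (tmul z (toE Φ p X))) (hε R)).trans ?_
      refine (hU _ _ _ _ _ _ _ _).trans ?_
      exact (toE_congr Φ (List.append_nil p.gaps) (juxt_ofCommutant_left Φ R X)).trans
        (lact_toE Φ p R X).symm)
    (tmul (X := idCorr M.commutant) R ξ)
  exact ((congrArg (U (zero_add t)) (hβ R ξ)).symm.trans key).trans (hα R ξ)

/-- `U_{t,0}(ξ ⊗ ε(R)) = ξ R`: on generators this is `X R = X · R`. -/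
theorem product_unit_right
    {ε : PreCorr.Iso (idCorr M.commutant) (E Φ 0)}
    {U : ∀ {t s u : ℝ≥0}, t + s = u → PreCorr.Iso (tensor (E Φ t) (E Φ s)) (E Φ u)}
    (hε : ∀ R : Alg M.commutant, ε R = toE Φ Part.trivial (ofCommutant R))
    (hU : ∀ (t s u : ℝ≥0) (h : t + s = u) (p₁ : Part t) (p₂ : Part s)
      (X : VNRep.Hom (idRep M) (HPart Φ p₁.gaps)) (Y : VNRep.Hom (idRep M) (HPart Φ p₂.gaps)),
        U h (tmul (toE Φ p₁ X) (toE Φ p₂ Y)) = toE Φ (Part.concat h p₁ p₂) (juxt Φ X Y))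
    (t : ℝ≥0) (R : Alg M.commutant) (ξ : (E Φ t).carrier) :
    U (add_zero t) (tmul ξ (ε R)) = (E Φ t).ract (op R) ξ := by
  obtain ⟨α, hα⟩ := exists_rightUnitIso (isSaturated_E Φ t)
  obtain ⟨β, hβ⟩ := exists_tensorCongr (X := E Φ t)
    (PreCorr.Iso.refl _) ε
    (isGenerated_leftInd_E Φ 0)
  have key := PreCorr.Iso.eq_of_eqOn ((generates_toE Φ t).tensor
    (idCorr M.commutant).generates_univ (isGenerated_leftInd_idCorr _))
    (isSaturated_E Φ t).definite (β.trans (U (add_zero t))) α (by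
      rintro _ ⟨_, ⟨p, X, rfl⟩, R, -, rfl⟩
      refine (congrArg (U (add_zero t)) (hβ (toE Φ p X) R)).trans (Eq.trans ?_ (hα _ R).symm)
      refine (congrArg (fun z => U (add_zero t) (tmul (toE Φ p X) z)) (hε R)).trans ?_
      exact (hU _ _ _ _ _ _ _ _).trans (ract_toE Φ p R X).symm)
    (tmul (Y := idCorr M.commutant) ξ R)
  exact ((congrArg (U (add_zero t)) (hβ ξ R)).symm.trans key).trans (hα ξ R)

/-- Both isomorphisms of `(E(t) ⊗ E(s)) ⊗ E(r)` with `E(t + s + r)` are determined by their values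
on the tensors of elements `ι_𝔭(X)`, for which associativity is `juxt_assoc`. -/
theorem product_assoc
    {U : ∀ {t s u : ℝ≥0}, t + s = u → PreCorr.Iso (tensor (E Φ t) (E Φ s)) (E Φ u)}
    (hU : ∀ (t s u : ℝ≥0) (h : t + s = u) (p₁ : Part t) (p₂ : Part s)
      (X : VNRep.Hom (idRep M) (HPart Φ p₁.gaps)) (Y : VNRep.Hom (idRep M) (HPart Φ p₂.gaps)),
        U h (tmul (toE Φ p₁ X) (toE Φ p₂ Y)) = toE Φ (Part.concat h p₁ p₂) (juxt Φ X Y))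
    {t s r u v w : ℝ≥0} (hu : t + s = u) (hv : s + r = v) (hur : u + r = w)
    (htv : t + v = w) : ∃ (A : PreCorr.Iso (tensor (tensor (E Φ t) (E Φ s)) (E Φ r))
        (tensor (E Φ t) (tensor (E Φ s) (E Φ r))))
      (V : PreCorr.Iso (tensor (tensor (E Φ t) (E Φ s)) (E Φ r)) (tensor (E Φ u) (E Φ r)))
      (W : PreCorr.Iso (tensor (E Φ t) (tensor (E Φ s) (E Φ r))) (tensor (E Φ t) (E Φ v))),
      (∀ x y z, A (tmul (tmul x y) z) = tmul x (tmul y z)) ∧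
      (∀ x z, V (tmul x z) = tmul (U hu x) z) ∧
      (∀ x z, W (tmul x z) = tmul x (U hv z)) ∧
      ∀ ζ, U hur (V ζ) = U htv (W (A ζ)) := by
  obtain ⟨A, hA⟩ := exists_assocIso (X := E Φ t) (isGenerated_leftInd_E Φ s)
    (isGenerated_leftInd_E Φ r)
  obtain ⟨V, hV⟩ := exists_tensorCongr (Y := E Φ r) (U hu)
    (PreCorr.Iso.refl _)
    (isGenerated_leftInd_E Φ r)
  obtain ⟨W, hW⟩ := exists_tensorCongr (X := E Φ t)
    (PreCorr.Iso.refl _) (U hv)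
    (isGenerated_leftInd_E Φ v)
  refine ⟨A, V, W, hA, hV, hW, PreCorr.Iso.eq_of_eqOn (((generates_toE Φ t).tensor
    (generates_toE Φ s) (isGenerated_leftInd_E Φ s)).tensor (generates_toE Φ r)
    (isGenerated_leftInd_E Φ r)) (isSaturated_E Φ w).definite (V.trans (U hur))
    ((A.trans W).trans (U htv)) ?_⟩
  rintro _ ⟨_, ⟨_, ⟨p₁, X₁, rfl⟩, _, ⟨p₂, X₂, rfl⟩, rfl⟩, _, ⟨p₃, X₃, rfl⟩, rfl⟩
  have e1 : U hur (V (tmul (tmul (toE Φ p₁ X₁) (toE Φ p₂ X₂)) (toE Φ p₃ X₃)))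
      = toE Φ (Part.concat hur (Part.concat hu p₁ p₂) p₃) (juxt Φ (juxt Φ X₁ X₂) X₃) := by
    rw [hV, hU]
    exact hU _ _ _ hur (Part.concat hu p₁ p₂) p₃ (juxt Φ X₁ X₂) X₃
  have e2 : U htv (W (A (tmul (tmul (toE Φ p₁ X₁) (toE Φ p₂ X₂)) (toE Φ p₃ X₃))))
      = toE Φ (Part.concat htv p₁ (Part.concat hv p₂ p₃)) (juxt Φ X₁ (juxt Φ X₂ X₃)) := by
    rw [hA, hW, hU]
    exact hU _ _ _ htv p₁ (Part.concat hv p₂ p₃) X₁ (juxt Φ X₂ X₃)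
  refine e1.trans (Eq.trans ?_ e2.symm)
  exact toE_congr Φ (List.append_assoc p₃.gaps p₂.gaps p₁.gaps).symm (juxt_assoc Φ X₁ X₂ X₃)

end ProductSystem

end Commutant

end CPSemi

end

theorem lemma2p2 {H : Type u} [NormedAddCommGroup H] [InnerProductSpace ℂ H] [CompleteSpace H]
    (M : VonNeumannAlgebra H) (Φ : CPSemigroup M) :
    -- `X ⊗ Y ↦ (I_s ⊗ X) Y` extends to an isomorphism of `M'`-correspondences
    (∀ (t s u : ℝ≥0) (h : t + s = u) (p₁ : Part t) (p₂ : Part s),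
      ∃ α : PreCorr.Iso (tensor (lCorr Φ p₁.gaps) (lCorr Φ p₂.gaps))
          (lCorr Φ (Part.concat h p₁ p₂).gaps),
        ∀ (X : VNRep.Hom (idRep M) (HPart Φ p₁.gaps)) (Y : VNRep.Hom (idRep M) (HPart Φ p₂.gaps)),
          α (tmul (X := lCorr Φ p₁.gaps) (Y := lCorr Φ p₂.gaps) X Y) = juxt Φ X Y) ∧
    -- associativity for partitions
    (∀ (t s r : ℝ≥0) (p₁ : Part t) (p₂ : Part s) (p₃ : Part r)
      (X₁ : VNRep.Hom (idRep M) (HPart Φ p₁.gaps)) (X₂ : VNRep.Hom (idRep M) (HPart Φ p₂.gaps))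
      (X₃ : VNRep.Hom (idRep M) (HPart Φ p₃.gaps)),
        HEq (juxt Φ (juxt Φ X₁ X₂) X₃) (juxt Φ X₁ (juxt Φ X₂ X₃))) ∧
    -- in the limit
    (∃ (ε : PreCorr.Iso (idCorr M.commutant) (E Φ 0))
      (U : ∀ {t s u : ℝ≥0}, t + s = u → PreCorr.Iso (tensor (E Φ t) (E Φ s)) (E Φ u)),
      -- `E(0) = M'`
      (∀ R : Alg M.commutant, ε R = toE Φ Part.trivial (ofCommutant R)) ∧
      -- `U` is induced by the isomorphisms for partitions
      (∀ (t s u : ℝ≥0) (h : t + s = u) (p₁ : Part t) (p₂ : Part s)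
        (X : VNRep.Hom (idRep M) (HPart Φ p₁.gaps)) (Y : VNRep.Hom (idRep M) (HPart Φ p₂.gaps)),
          U h (tmul (toE Φ p₁ X) (toE Φ p₂ Y)) = toE Φ (Part.concat h p₁ p₂) (juxt Φ X Y)) ∧
      -- for `E(0) = M'` the product is the bimodule structure
      (∀ (t : ℝ≥0) (R : Alg M.commutant) (ξ : (E Φ t).carrier),
        U (zero_add t) (tmul (ε R) ξ) = (E Φ t).lact R ξ ∧
        U (add_zero t) (tmul ξ (ε R)) = (E Φ t).ract (MulOpposite.op R) ξ) ∧
      -- associativity: the two isomorphisms from `(E(t) ⊗ E(s)) ⊗ E(r)` to `E(t + s + r)` agree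
      (∀ (t s r u v w : ℝ≥0) (hu : t + s = u) (hv : s + r = v) (hur : u + r = w) (htv : t + v = w),
        ∃ (A : PreCorr.Iso (tensor (tensor (E Φ t) (E Φ s)) (E Φ r))
            (tensor (E Φ t) (tensor (E Φ s) (E Φ r))))
          (V : PreCorr.Iso (tensor (tensor (E Φ t) (E Φ s)) (E Φ r)) (tensor (E Φ u) (E Φ r)))
          (W : PreCorr.Iso (tensor (E Φ t) (tensor (E Φ s) (E Φ r))) (tensor (E Φ t) (E Φ v))),
          (∀ x y z, A (tmul (tmul x y) z) = tmul x (tmul y z)) ∧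
          (∀ x z, V (tmul x z) = tmul (U hu x) z) ∧
          (∀ x z, W (tmul x z) = tmul x (U hv z)) ∧
          ∀ ζ, U hur (V ζ) = U htv (W (A ζ)))) ∧
    IsDiscreteProductSystem (E Φ) := by
  choose U hU using fun (t s u : ℝ≥0) (h : t + s = u) => exists_productIso Φ h
  obtain ⟨ε, hε⟩ := exists_unitIso Φ
  let U' : ∀ {t s u : ℝ≥0}, t + s = u → PreCorr.Iso (tensor (E Φ t) (E Φ s)) (E Φ u) :=
    fun {t s u} h => U t s u h
  refine ⟨fun t s u h p₁ p₂ => exists_juxtIso Φ p₁.gaps p₂.gaps,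
    fun t s r p₁ p₂ p₃ X₁ X₂ X₃ => juxt_assoc Φ X₁ X₂ X₃,
    ⟨ε, U', hε, hU, fun t R ξ => ⟨product_unit_left Φ (U := U') hε hU t R ξ,
        product_unit_right Φ (U := U') hε hU t R ξ⟩,
      fun t s r u v w hu hv hur htv => product_assoc Φ (U := U') hU hu hv hur htv⟩,
    fun t => (isSaturated_E Φ t).isWStar (isGenerated_leftInd_E Φ t), ⟨ε.symm⟩,
    fun t s => ⟨(U t s _ rfl).symm⟩⟩
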